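/- Let $X$ be a standard Borel space, let $E$ be a Borel equivalence relation on $X$ (as a subset of $X\times X$) all of whose classes are countable, and let $\rho\colon E\to(0,\infty)$ be a Borel cocycle, i.e. a Borel function with $\rho(x,z)=\rho(x,y)\rho(y,z)$ whenever $x\mathrel{E}y\mathrel{E}z$. Definitions. For a subset $Y$ of the $E$-class of a point $z$, put $|Y|^\rho_z=\sum_{y\in Y}\rho(y,z)\in[0,\infty]$. A set is $E$-complete if it meets every $E$-class, and $E$-invariant if it is a union of $E$-classes. The relation $E$ is smooth if it has a Borel transversal, i.e. a Borel set meeting every $E$-class in exactly one point. The cocycle $\rho$ is aperiodic if $|C|^\rho_z=\infty$ for every $E$-class $C$ and $z\in C$. It is smooth if there are an open neighborhood $U\subseteq(0,\infty)$ of $1$ and a Borel function $c\colon X\to\mathbb N$ such that $c(x)\neq c(y)$ whenever $x\neq y$, $x\mathrel{E}y$ and $\rho(x,y)\in U$. A function $\phi\colon X\to X$ is a compression of $\rho$ if $x\mathrel{E}\phi(x)$ and $|\phi^{-1}(x)|^\rho_x\le 1$ for all $x\in X$ and the set $\{x\in X: |\phi^{-1}(x)|^\rho_x<1\}$ is $E$-complete;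 it is strictly $\rho$-increasing if $x\mathrel{E}\phi(x)$ and $|\phi^{-1}(x)|^\rho_x<1$ for all $x\in X$. A subequivalence relation of $E$ is an equivalence relation $F\subseteq E$ on $X$; it is finite if all its classes are finite. For such a finite $F$, the quotient $\rho/F$ is the cocycle on the relation $E/F$ on $X/F$ (with the quotient Borel structure) given by $(\rho/F)([x]_F,[y]_F)=|[x]_F|^\rho_z/|[y]_F|^\rho_z$ for any $z\in[x]_E=[y]_E$. The notions above are also applied to $\rho/F$ on $E/F$, to the restriction $\rho\restriction F$ of $\rho$ to a Borel subequivalence relation $F$ of $E$, and to $\rho\restriction(F\restriction B)$ on a Borel set $B\subseteq X$, where $F\restriction B=F\cap(B\times B)$. Then the following are equivalent: (1) There is a finite Borel subequivalence relation $F$ of $E$ for which there is an injective Borel compression $X/F\to X/F$ of $\rho/F$. (2) There is a Borel subequivalence relation $F$ of $E$ for which $\rho\restriction F$ is aperiodic and smooth. (3) There exist an $E$-invariant Borel set $B\subseteq X$ and a Borel subequivalence relation $F$ of $E$ such that $F\restriction(X\setminus B)$ is smooth, $\rho\restriction(F\restriction(X\setminus B))$ is aperiodic, and there is a strictly $(\rho\restriction(F\restriction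 B))$-increasing Borel automorphism of $B$. -/

import Mathlib

open scoped ENNReal

namespace BorelCocycle

/-- The equivalence relation `E` is Borel, as a subset of the square. -/
def IsBorelRel {X : Type*} [MeasurableSpace X] (E : Setoid X) : Prop :=
  MeasurableSet {p : X × X | E p.1 p.2}

/-- `E` is a countable Borel equivalence relation: it is Borel and all classes are countable. -/
structure IsCountableBorel {X : Type*} [MeasurableSpace X] (E : Setoid X) : Prop where
  borel : IsBorelRel E
  countable : ∀ x : X, {y : X | E y x}.Countable

/-- All classes of `F` are finite. -/
def IsFiniteRel {X : Type*} (F : Setoid X) : Prop :=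
  ∀ x : X, {y : X | F y x}.Finite

/-- `Y` meets every `E`-class. -/
def IsComplete {X : Type*} (E : Setoid X) (Y : Set X) : Prop :=
  ∀ x : X, ∃ y ∈ Y, E x y

/-- `Y` meets every `E`-class in at most one point. -/
def IsPartialTransversal {X : Type*} (E : Setoid X) (Y : Set X) : Prop :=
  ∀ x ∈ Y, ∀ y ∈ Y, E x y → x = y

/-- `Y` is a union of `E`-classes. -/
def IsInvariant {X : Type*} (E : Setoid X) (Y : Set X) : Prop :=
  ∀ x y : X, E x y → x ∈ Y → y ∈ Y

/-- A (countable Borel) equivalence relation is smooth if it has a Borel transversal. -/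
def IsSmoothRel {X : Type*} [MeasurableSpace X] (E : Setoid X) : Prop :=
  ∃ Y : Set X, MeasurableSet Y ∧ IsComplete E Y ∧ IsPartialTransversal E Y

/-- The restriction `E ↾ B` of an equivalence relation on `X` to a set `B ⊆ X`. -/
def restrictRel {X : Type*} (E : Setoid X) (B : Set X) : Setoid B :=
  E.comap Subtype.val

/-- `ρ` is a Borel cocycle from `E` to `(0, ∞)`.  A function on `E` is represented by a function
of two variables; only the values at pairs in `E` are constrained or ever used, so that the
restriction of `ρ` to a subequivalence relation of `E` is represented by `ρ` itself. -/
structure IsBorelCocycle {X : Type*} [MeasurableSpace X] (E : Setoid X) (ρ : X → X → ℝ) :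
    Prop where
  pos : ∀ x y : X, E x y → 0 < ρ x y
  mul : ∀ x y z : X, E x y → E y z → ρ x z = ρ x y * ρ y z
  borel : Measurable (fun p : {p : X × X // E p.1 p.2} => ρ p.1.1 p.1.2)

/-- The restriction of `ρ` to pairs of points of `B`. -/
def restrictCocycle {X : Type*} (ρ : X → X → ℝ) (B : Set X) : B → B → ℝ :=
  fun x y => ρ x y

/-- The `ρ`-size `∑ y ∈ Y, ρ y z` of `Y` relative to the point `z`, an extended real number. -/
noncomputable def size {X : Type*} (ρ : X → X → ℝ) (z : X) (Y : Set X) : ℝ≥0∞ :=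
  ∑' y : Y, ENNReal.ofReal (ρ y z)

/-- The cocycle `ρ` on `E` is aperiodic: every `E`-class is `ρ`-infinite. -/
def IsAperiodic {X : Type*} (E : Setoid X) (ρ : X → X → ℝ) : Prop :=
  ∀ z : X, size ρ z {y : X | E y z} = ∞

/-- The digraph in which `x` and `y` are related if they are distinct, `E`-equivalent and
`ρ x y ∈ U`. -/
def lacunarityGraph {X : Type*} (E : Setoid X) (ρ : X → X → ℝ) (U : Set ℝ) (x y : X) : Prop :=
  x ≠ y ∧ E x y ∧ ρ x y ∈ U

/-- The Borel cocycle `ρ` on `E` is smooth: for some open neighborhood `U ⊆ (0, ∞)` of `1`, the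
digraph `lacunarityGraph E ρ U` has a Borel coloring by natural numbers. -/
def IsSmoothCocycle {X : Type*} [MeasurableSpace X] (E : Setoid X) (ρ : X → X → ℝ) : Prop :=
  ∃ U : Set ℝ, IsOpen U ∧ U ⊆ Set.Ioi 0 ∧ (1 : ℝ) ∈ U ∧
    ∃ c : X → ℕ, Measurable c ∧ ∀ x y : X, lacunarityGraph E ρ U x y → c x ≠ c y

/-- `φ` is a compression of the cocycle `ρ` on `E`. -/
structure IsCompression {X : Type*} (E : Setoid X) (ρ : X → X → ℝ) (φ : X → X) : Prop where
  graph : ∀ x : X, E x (φ x)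
  le_one : ∀ x : X, size ρ x (φ ⁻¹' {x}) ≤ 1
  complete : IsComplete E {x : X | size ρ x (φ ⁻¹' {x}) < 1}

/-- `φ` is strictly `ρ`-increasing, where `ρ` is a cocycle on `E`. -/
structure IsStrictlyIncreasing {X : Type*} (E : Setoid X) (ρ : X → X → ℝ) (φ : X → X) :
    Prop where
  graph : ∀ x : X, E x (φ x)
  lt_one : ∀ x : X, size ρ x (φ ⁻¹' {x}) < 1

/-- The equivalence relation `E / F` on `X / F`, for a subequivalence relation `F` of `E`: two
`F`-classes are related if they have `E`-equivalent representatives. -/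
def quotientRel {X : Type*} (E F : Setoid X) (h : F ≤ E) : Setoid (Quotient F) :=
  E.mapOfSurjective (Quotient.mk F) ((Setoid.ker_mk_eq F).le.trans h) Quotient.mk_surjective

/-- The quotient cocycle `ρ / F`: its value at `F`-classes `a` and `b` is the `ρ`-size of `a`
relative to `b`, which is the ratio of their `ρ`-sizes relative to any point of the common
`E`-class.  The point used here is a representative of `b`. -/
noncomputable def quotientCocycle {X : Type*} (F : Setoid X) (ρ : X → X → ℝ) :
    Quotient F → Quotient F → ℝ :=
  fun a b => (size ρ b.out {x : X | Quotient.mk F x = a} /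
    size ρ b.out {x : X | Quotient.mk F x = b}).toReal

end BorelCocycle

namespace BorelCocycle

open MeasureTheory Set

/-! The three conditions are linked through locally finite sets: Borel sets `V` meeting every class
of a subrelation, with finitely many points of each class in any range of sizes bounded above and
below. Such a set exists exactly when the cocycle on the subrelation is smooth
(`IsSmoothCocycle.exists_isLocallyFinite`, `IsLocallyFinite.isSmoothCocycle`).

From (1) to (2), lift the compression to a Borel map `h` on points and pass to its orbits modulo the
finite relation. The sizes of the finite classes never decrease along `h`. On an orbit where they
fail to be preserved, the classes never recur, so the orbit has infinite size. Such an active orbit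
also has a definable locally finite part (`IsLift.IsActive.exists_candidate`): a first class, or the
first class past some threshold of growth or of near-maximality, or the points larger than all
points before them. Every `E`-class contains an active orbit, and attaching the remaining points to
active orbits gives the subrelation.

From (2) to (3), look at how `V` is bounded on each class. Bounded on one side, it has finitely many
extremal points, so a transversal can be chosen. Unbounded on both sides, it yields an automorphism:
colour the points so that every colour is locally finite, has no two points of equal size in a class
and is unbounded on both sides, then move each point to the next larger one of its colour
(`IsLocallyFinite.exists_automorphism`). The set `B` is the `E`-saturation of the second kind of
classes, and inside `B` all points are attached to such classes
(`IsLocallyFinite.exists_splitting`).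

From (3) to (1), keep singletons on `B` and use the automorphism there. Cut each smooth class of
infinite size into a sequence of finite blocks of nondecreasing size and shift each block to the
next (`IsCountableBorel.exists_blocks`); the initial block is not in the image, which makes the
compression strict there.

Borel choices inside countable classes rest on the Lusin–Novikov theorem, proved here by a Cantor
scheme argument. -/

/-! ### The Lusin–Novikov theorem -/

/-- `A` is covered by countably many Borel sets on which `g` is injective. -/
def IsInjCovered {Z W : Type*} [MeasurableSpace Z] (g : Z → W) (A : Set Z) : Prop :=
  ∃ C : ℕ → Set Z, (∀ n, MeasurableSet (C n)) ∧ (∀ n, InjOn g (C n)) ∧ A ⊆ ⋃ n, C n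

theorem IsInjCovered.iUnion {Z W ι : Type*} [MeasurableSpace Z] [Countable ι] {g : Z → W} {A : ι → Set Z}
    (h : ∀ i, IsInjCovered g (A i)) : IsInjCovered g (⋃ i, A i) := by
  choose C hm hi hs using h
  rcases isEmpty_or_nonempty ι with h0 | h0
  · exact ⟨fun _ => ∅, by simp, by simp, by simp⟩
  obtain ⟨e, he⟩ := exists_surjective_nat (ι × ℕ)
  refine ⟨fun n => C (e n).1 (e n).2, fun n => hm _ _, fun n => hi _ _, ?_⟩
  refine iUnion_subset fun i z hz => ?_
  obtain ⟨k, hk⟩ := mem_iUnion.1 (hs i hz)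
  obtain ⟨n, hn⟩ := he (i, k)
  exact mem_iUnion.2 ⟨n, by simpa [hn] using hk⟩


/-- A finite stage of a Cantor scheme of cylinders in the Baire space: a common length and the
nodes of that length assigned to the binary words of length `n`. -/
abbrev Scheme (n : ℕ) : Type := (L : ℕ) × ((Fin n → Bool) → Fin L → ℕ)

/-- The cylinder assigned to a binary word. -/
def Scheme.cyl {n : ℕ} (a : Scheme n) (t : Fin n → Bool) : Set (ℕ → ℕ) :=
  {z | ∀ i : Fin a.1, z i = a.2 t i}

theorem Scheme.cyl_nonempty {n : ℕ} (a : Scheme n) (t : Fin n → Bool) : (a.cyl t).Nonempty :=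
  ⟨fun i => if h : i < a.1 then a.2 t ⟨i, h⟩ else 0, fun i => by simp⟩

theorem Scheme.isClosed_cyl {n : ℕ} (a : Scheme n) (t : Fin n → Bool) : IsClosed (a.cyl t) := by
  have : a.cyl t = ⋂ i : Fin a.1, {z : ℕ → ℕ | z i = a.2 t i} := by ext; simp [Scheme.cyl]
  rw [this]
  exact isClosed_iInter fun i => isClosed_eq (continuous_apply _) continuous_const

/-- Families of points in the cylinders of a scheme that avoid `S` and have a common image. -/
def Scheme.config {Z W : Type*} (f : (ℕ → ℕ) → Z) (g : Z → W) {n : ℕ} (a : Scheme n) (S : Set Z) :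
    Set ((Fin n → Bool) → (ℕ → ℕ)) :=
  {z | (∀ t, z t ∈ a.cyl t) ∧ (∀ t, f (z t) ∉ S) ∧ ∀ t t', g (f (z t)) = g (f (z t'))}

/-- `b` refines `a`, and separates the two extensions of the word `u`. -/
def Scheme.Extends {Z : Type*} (f : (ℕ → ℕ) → Z) {n : ℕ} (u : Fin n → Bool) (a : Scheme n)
    (b : Scheme (n + 1)) : Prop :=
  a.1 < b.1 ∧ (∀ t, b.cyl t ⊆ a.cyl (Fin.init t)) ∧
    Disjoint (f '' b.cyl (Fin.snoc (α := fun _ => Bool) u false))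
      (f '' b.cyl (Fin.snoc (α := fun _ => Bool) u true))

/-- The scheme has no configurations off some set covered by injective pieces. -/
def Scheme.IsTerminal {Z W : Type*} [MeasurableSpace Z] (f : (ℕ → ℕ) → Z) (g : Z → W) {n : ℕ}
    (a : Scheme n) : Prop :=
  ∃ S, MeasurableSet S ∧ IsInjCovered g S ∧ a.config f g S = ∅

theorem exists_cylinder_subset {A : Type*} [TopologicalSpace A] [DiscreteTopology A] {x : ℕ → A}
    {U : Set (ℕ → A)} (h : U ∈ nhds x) : ∃ m, PiNat.cylinder (E := fun _ => A) x m ⊆ U := by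
  obtain ⟨V, hVU, hV, hxV⟩ := mem_nhds_iff.1 h
  obtain ⟨s, ⟨y, m, rfl⟩, hxs, hs⟩ :=
    (PiNat.isTopologicalBasis_cylinders fun _ => A).exists_subset_of_mem_open hxV hV
  rw [← PiNat.mem_cylinder_iff_eq.1 hxs] at hs
  exact ⟨m, hs.trans hVU⟩

/-- Long enough initial segments give disjoint images. -/
theorem exists_forall_disjoint_image {Z : Type*} [TopologicalSpace Z] [T2Space Z]
    {f : (ℕ → ℕ) → Z} (hf : Continuous f) {x y : ℕ → ℕ} (h : f x ≠ f y) :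
    ∃ m, ∀ L ≥ m, Disjoint (f '' {z | ∀ i : Fin L, z i = x i})
      (f '' {z | ∀ i : Fin L, z i = y i}) := by
  obtain ⟨U, V, hU, hV, hxU, hyV, hd⟩ := t2_separation h
  have key : ∀ (x : ℕ → ℕ) (U : Set Z), IsOpen U → f x ∈ U →
      ∃ m, ∀ L ≥ m, f '' {z | ∀ i : Fin L, z i = x i} ⊆ U := by
    intro x U hU hx
    obtain ⟨m, hm⟩ := exists_cylinder_subset ((hU.preimage hf).mem_nhds hx)
    refine ⟨m, fun L hL => ?_⟩
    rintro _ ⟨z, hz, rfl⟩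
    exact hm fun i hi => hz ⟨i, hi.trans_le hL⟩
  obtain ⟨m, hm⟩ := key x U hU hxU
  obtain ⟨k, hk⟩ := key y V hV hyV
  exact ⟨max m k, fun L hL => hd.mono (hm L (le_of_max_le_left hL)) (hk L (le_of_max_le_right hL))⟩

section LusinNovikov

variable {Z W : Type*} [TopologicalSpace Z] [PolishSpace Z] [MeasurableSpace Z] [BorelSpace Z]
  [TopologicalSpace W] [PolishSpace W]

/-- The points that have the same image under `g` as some other point of `A`. -/
theorem analyticSet_exists_ne_eq {g : Z → W} (hg : Continuous g) {A : Set Z}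
    (hA : AnalyticSet A) : AnalyticSet {z | ∃ a ∈ A, a ≠ z ∧ g a = g z} := by
  have h1 : AnalyticSet {p : Z × Z | p.1 ∈ A} := hA.preimage continuous_fst
  have h2 : AnalyticSet {p : Z × Z | p.1 ≠ p.2 ∧ g p.1 = g p.2} := by
    apply MeasurableSet.analyticSet
    apply MeasurableSet.inter
    · exact (isClosed_diagonal (X := Z)).measurableSet.compl
    · exact (isClosed_eq (hg.comp continuous_fst) (hg.comp continuous_snd)).measurableSet
  have h3 : AnalyticSet ({p : Z × Z | p.1 ∈ A} ∩ {p : Z × Z | p.1 ≠ p.2 ∧ g p.1 = g p.2}) := by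
    have := AnalyticSet.iInter (s := fun b : Bool => cond b {p : Z × Z | p.1 ∈ A}
      {p : Z × Z | p.1 ≠ p.2 ∧ g p.1 = g p.2}) (by rintro (_ | _) <;> assumption)
    rwa [← inter_eq_iInter] at this
  convert h3.image_of_continuous continuous_snd using 1
  ext z
  constructor
  · rintro ⟨a, ha, hne, he⟩
    exact ⟨(a, z), ⟨ha, hne, he⟩, rfl⟩
  · rintro ⟨⟨a, b⟩, ⟨ha, hne, he⟩, rfl⟩
    exact ⟨a, ha, hne, he⟩

/-- An analytic set on which `g` is injective is contained in a Borel set on which `g` is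
injective. -/
theorem exists_measurableSet_injOn_of_analyticSet {g : Z → W} (hg : Continuous g) {A : Set Z}
    (hA : AnalyticSet A) (hi : InjOn g A) :
    ∃ C, MeasurableSet C ∧ A ⊆ C ∧ InjOn g C := by
  -- Separate twice: `D` avoids the points that share a `g`-value with another point of `A`, and
  -- `D'` avoids those that share one with another point of `D`. A collision inside `D ∩ D'` is then
  -- impossible.
  obtain ⟨D, hAD, hD, hDm⟩ := hA.measurablySeparable (analyticSet_exists_ne_eq hg hA) (by
    rw [disjoint_left]
    rintro z hz ⟨a, ha, hne, he⟩
    exact hne (hi ha hz he))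
  obtain ⟨D', hAD', hD', hDm'⟩ := hA.measurablySeparable
    (analyticSet_exists_ne_eq hg hDm.analyticSet) (by
    rw [disjoint_left]
    rintro z hz ⟨a, ha, hne, he⟩
    exact disjoint_left.1 hD ⟨z, hz, hne.symm, he.symm⟩ ha)
  refine ⟨D ∩ D', hDm.inter hDm', subset_inter hAD hAD', ?_⟩
  rintro x ⟨hx, -⟩ y ⟨-, hy⟩ hxy
  by_contra hne
  exact disjoint_left.1 hD' ⟨x, hx, hne, hxy⟩ hy


theorem Scheme.analyticSet_config_image {Z W : Type*} [TopologicalSpace Z] [MeasurableSpace Z]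
    [BorelSpace Z] [TopologicalSpace W] [PolishSpace W] {f : (ℕ → ℕ) → Z} (hf : Continuous f) {g : Z → W}
    (hg : Continuous g) {n : ℕ} (a : Scheme n) {S : Set Z} (hS : MeasurableSet S)
    (u : Fin n → Bool) : AnalyticSet ((fun z => f (z u)) '' a.config f g S) := by
  have hm : MeasurableSet (a.config f g S) := by
    have : a.config f g S = (⋂ t, {z | z t ∈ a.cyl t}) ∩ ((⋂ t, {z | z t ∈ f ⁻¹' Sᶜ}) ∩
        ⋂ t, ⋂ t', {z | g (f (z t)) = g (f (z t'))}) := by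
      ext z; simp [Scheme.config]
    rw [this]
    refine (MeasurableSet.iInter fun t => ?_).inter ((MeasurableSet.iInter fun t => ?_).inter
      (MeasurableSet.iInter fun t => MeasurableSet.iInter fun t' => ?_))
    · exact ((a.isClosed_cyl t).preimage (continuous_apply t)).measurableSet
    · exact (measurable_pi_apply t) (hf.measurable hS.compl)
    · exact (isClosed_eq (by fun_prop) (by fun_prop)).measurableSet
  exact hm.analyticSet.image_of_continuous (by fun_prop)

/-- A scheme all of whose extensions are terminal is terminal. -/
theorem Scheme.isTerminal_of_extends {f : (ℕ → ℕ) → Z} (hf : Continuous f) {g : Z → W}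
    (hg : Continuous g) {n : ℕ} (u : Fin n → Bool) (a : Scheme n)
    (h : ∀ b : Scheme (n + 1), a.Extends f u b → b.IsTerminal f g) : a.IsTerminal f g := by
  choose S hSm hSc hSe using fun b : {b : Scheme (n + 1) // a.Extends f u b} => h b.1 b.2
  have hUm : MeasurableSet (⋃ b, S b) := .iUnion hSm
  obtain ⟨D, hDm, hAD, hDi⟩ := exists_measurableSet_injOn_of_analyticSet hg
    (a.analyticSet_config_image hf hg hUm u) (by
    rintro _ ⟨z₀, hz₀, rfl⟩ _ ⟨z₁, hz₁, rfl⟩ he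
    by_contra hne
    dsimp only at he hne
    -- Two configurations with the same `g`-value but different points at `u` can be spliced, one on
    -- each half of the words of length `n + 1`, into a configuration of an extension `b` that
    -- avoids the very set off which `b` has none.
    obtain ⟨m, hm⟩ := exists_forall_disjoint_image hf hne
    let z : (Fin (n + 1) → Bool) → ℕ → ℕ :=
      fun t => if t (Fin.last n) then z₁ (Fin.init t) else z₀ (Fin.init t)
    let b : Scheme (n + 1) := ⟨max m (a.1 + 1), fun t i => z t i⟩
    have hb : a.Extends f u b := by
      refine ⟨by simp [b], fun t x hx i => ?_, ?_⟩
      · have h1 := hx ⟨i, by have := i.2; simp only [b]; omega⟩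
        dsimp only [b, z] at h1
        split_ifs at h1 with hl
        · exact h1.trans (hz₁.1 _ i)
        · exact h1.trans (hz₀.1 _ i)
      · convert hm (max m (a.1 + 1)) (le_max_left _ _) using 2 <;>
          simp [b, z, Scheme.cyl]
    have hz : z ∈ b.config f g (S ⟨b, hb⟩) := by
      refine ⟨fun t i => rfl, fun t => ?_, fun t t' => ?_⟩
      · dsimp only [z]
        split_ifs
        · exact fun h => hz₁.2.1 _ (mem_iUnion.2 ⟨_, h⟩)
        · exact fun h => hz₀.2.1 _ (mem_iUnion.2 ⟨_, h⟩)
      · have key : ∀ t, g (f (z t)) = g (f (z₀ u)) := by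
          intro t
          dsimp only [z]
          split_ifs
          · rw [he]; exact hz₁.2.2 _ _
          · exact hz₀.2.2 _ _
        rw [key, key]
    have hz' := hSe ⟨b, hb⟩
    exact eq_empty_iff_forall_notMem.1 hz' z hz)
  refine ⟨(⋃ b, S b) ∪ D, hUm.union hDm, ?_, ?_⟩
  · rw [union_eq_iUnion]
    refine IsInjCovered.iUnion ?_
    rintro (_ | _)
    · exact ⟨fun _ => D, fun _ => hDm, fun _ => hDi, fun z hz => mem_iUnion.2 ⟨0, hz⟩⟩
    · exact IsInjCovered.iUnion hSc
  · by_contra hne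
    obtain ⟨z, hz⟩ := nonempty_iff_ne_empty.2 hne
    refine hz.2.1 u (Or.inr (hAD ⟨z, ⟨hz.1, fun t ht => hz.2.1 t (Or.inl ht), hz.2.2⟩, rfl⟩))

/-- **Lusin–Novikov**, for a continuous function that is countable-to-one on a Borel set. -/
theorem isInjCovered_of_countable_fibers {g : Z → W} (hg : Continuous g) {M : Set Z}
    (hM : MeasurableSet M) (hc : ∀ w, (M ∩ g ⁻¹' {w}).Countable) : IsInjCovered g M := by
  have hMa := hM.analyticSet
  rw [AnalyticSet] at hMa
  rcases hMa with rfl | ⟨f, hf, rfl⟩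
  · exact ⟨fun _ => ∅, by simp, by simp, by simp⟩
  by_contra hnc
  -- Only one word is split at each stage. Unpairing makes every term of the dense sequence recur at
  -- arbitrarily late stages, so some word below any given node is eventually split.
  let d : ℕ → ℕ → Bool := fun n => TopologicalSpace.denseSeq (ℕ → Bool) n.unpair.1
  let u : ∀ n, Fin n → Bool := fun n i => d n i
  have hroot : ¬ Scheme.IsTerminal f g (⟨0, fun _ => Fin.elim0⟩ : Scheme 0) := by
    rintro ⟨S, hSm, ⟨C, hCm, hCi, hSC⟩, hSe⟩
    refine hnc ⟨C, hCm, hCi, ?_⟩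
    rintro _ ⟨z, rfl⟩
    by_contra hz
    have : (fun _ => z) ∈ Scheme.config f g (⟨0, fun _ => Fin.elim0⟩ : Scheme 0) S :=
      ⟨fun t i => i.elim0, fun t h => hz (hSC h), fun _ _ => rfl⟩
    rw [hSe] at this
    exact this
  have hstep : ∀ n (a : {a : Scheme n // ¬ a.IsTerminal f g}),
      ∃ b : {b : Scheme (n + 1) // ¬ b.IsTerminal f g}, a.1.Extends f (u n) b.1 := by
    rintro n ⟨a, ha⟩
    by_contra hb
    push Not at hb
    exact ha (a.isTerminal_of_extends hf hg (u n) fun b hab => by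
      by_contra hbt
      exact hb ⟨b, hbt⟩ hab)
  choose next hnext using hstep
  let a : ∀ n, {a : Scheme n // ¬ a.IsTerminal f g} :=
    fun n => Nat.rec ⟨_, hroot⟩ (fun n a => next n a) n
  have ha : ∀ n, (a n).1.Extends f (u n) (a (n + 1)).1 := fun n => hnext n (a n)
  have hL : ∀ n, n ≤ (a n).1.1 := by
    intro n
    induction n with
    | zero => exact Nat.zero_le _
    | succ n ih => exact ih.trans_lt (ha n).1
  let r : (ℕ → Bool) → ∀ n, Fin n → Bool := fun c n i => c i
  have hmono : ∀ c m k, (a (m + k)).1.cyl (r c (m + k)) ⊆ (a m).1.cyl (r c m) := by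
    intro c m k
    induction k with
    | zero => exact subset_rfl
    | succ k ih => exact ((ha (m + k)).2.1 (r c (m + k + 1))).trans ih
  have hmono' : ∀ c m k, m ≤ k → (a k).1.cyl (r c k) ⊆ (a m).1.cyl (r c m) := by
    intro c m k h
    obtain ⟨j, rfl⟩ := Nat.exists_eq_add_of_le h
    exact hmono c m j
  let lim : (ℕ → Bool) → ℕ → ℕ := fun c i => (a (i + 1)).1.2 (r c (i + 1)) ⟨i, hL (i + 1)⟩
  have hlim : ∀ c n, lim c ∈ (a n).1.cyl (r c n) := by
    intro c n i
    obtain ⟨z, hz⟩ := (a (max n (i + 1))).1.cyl_nonempty (r c (max n (i + 1)))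
    have h1 := hmono' c _ _ (le_max_left n (i + 1)) hz i
    have h2 := hmono' c _ _ (le_max_right n (i + 1)) hz ⟨i, hL (i + 1)⟩
    exact h2.symm.trans h1
  have hlimc : Continuous lim := by
    refine continuous_pi fun i => ?_
    have h1 : Continuous fun c : ℕ → Bool => r c (i + 1) := by
      refine continuous_pi fun j => ?_
      exact continuous_apply _
    exact (continuous_of_discreteTopology
      (f := fun t : Fin (i + 1) → Bool => (a (i + 1)).1.2 t ⟨i, hL (i + 1)⟩)).comp h1
  have hgeq : ∀ c c', g (f (lim c)) = g (f (lim c')) := by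
    intro c c'
    by_contra hne
    obtain ⟨U, V, hU, hV, hcU, hcV, hd⟩ := t2_separation hne
    obtain ⟨m, hm⟩ := exists_cylinder_subset
      ((hU.preimage (hg.comp hf)).mem_nhds hcU)
    obtain ⟨k, hk⟩ := exists_cylinder_subset
      ((hV.preimage (hg.comp hf)).mem_nhds hcV)
    have hlt : m ≤ max m k ∧ k ≤ max m k := ⟨le_max_left _ _, le_max_right _ _⟩
    generalize max m k = n at hlt
    have hz : ∃ z, z ∈ (a n).1.config f g ∅ := by
      by_contra hz
      exact (a n).2 ⟨∅, .empty, ⟨fun _ => ∅, by simp, by simp, by simp⟩,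
        eq_empty_iff_forall_notMem.2 fun z hz' => hz ⟨z, hz'⟩⟩
    obtain ⟨z, hz⟩ := hz
    have h1 : z (r c n) ∈ PiNat.cylinder (lim c) m := fun i hi => by
      have h2 : i < (a n).1.1 := (hi.trans_le hlt.1).trans_le (hL n)
      exact (hz.1 (r c n) ⟨i, h2⟩).trans (hlim c n ⟨i, h2⟩).symm
    have h2 : z (r c' n) ∈ PiNat.cylinder (lim c') k := fun i hi => by
      have h2 : i < (a n).1.1 := (hi.trans_le hlt.2).trans_le (hL n)
      exact (hz.1 (r c' n) ⟨i, h2⟩).trans (hlim c' n ⟨i, h2⟩).symm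
    have h3 := hm h1
    have h4 := hk h2
    simp only [mem_preimage, Function.comp] at h3 h4
    rw [hz.2.2 (r c n) (r c' n)] at h3
    exact disjoint_left.1 hd h3 h4
  have hcount : (range fun c => f (lim c)).Countable := by
    refine (hc (g (f (lim fun _ => false)))).mono ?_
    rintro _ ⟨c, rfl⟩
    exact ⟨⟨_, rfl⟩, mem_preimage.2 (hgeq c fun _ => false)⟩
  have := hcount.to_subtype
  -- By Baire category, a countable range forces `f ∘ lim` to be constant on some cylinder; a later
  -- stage splits a word inside that cylinder into pieces with disjoint images.
  obtain ⟨⟨y, hy⟩, c, hcint⟩ := nonempty_interior_of_iUnion_of_closed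
    (f := fun y : range (fun c => f (lim c)) => {c | f (lim c) = y})
    (fun y => isClosed_eq (hf.comp hlimc) continuous_const)
    (eq_univ_of_forall fun c => mem_iUnion.2 ⟨⟨_, c, rfl⟩, rfl⟩)
  obtain ⟨m, hm⟩ := exists_cylinder_subset (mem_interior_iff_mem_nhds.1 hcint)
  obtain ⟨j, hj⟩ := (TopologicalSpace.denseRange_denseSeq (ℕ → Bool)).exists_mem_open
    (PiNat.isOpen_cylinder (fun _ => Bool) c m) ⟨c, PiNat.self_mem_cylinder c m⟩
  let n := Nat.pair j m
  have hmn : m ≤ n := Nat.right_le_pair j m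
  have hdn : d n = TopologicalSpace.denseSeq (ℕ → Bool) j := by simp [d, n]
  have hsnoc : ∀ b : Bool, ∃ e : ℕ → Bool, r e (n + 1) = Fin.snoc (α := fun _ => Bool) (u n) b ∧
      f (lim e) = y := by
    intro b
    refine ⟨fun i => if i < n then d n i else b, ?_, ?_⟩
    · funext i
      refine Fin.lastCases ?_ (fun i => ?_) i
      · simp [r]
      · simp [r, u]
    · refine hm (a := fun i => if i < n then d n i else b) fun i hi => ?_
      have h1 : i < n := hi.trans_le hmn
      simp only [h1, if_true, hdn]
      exact hj i hi
  obtain ⟨e₀, h0, h0'⟩ := hsnoc false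
  obtain ⟨e₁, h1, h1'⟩ := hsnoc true
  refine (ha n).2.2.le_bot ⟨⟨lim e₀, ?_, h0'⟩, lim e₁, ?_, h1'⟩
  · rw [← h0]; exact hlim _ _
  · rw [← h1]; exact hlim _ _

end LusinNovikov

/-! ### Borel enumeration of classes and Borel choice -/

theorem exists_measurable_least {X : Type*} [MeasurableSpace X] {P : X → ℕ → Prop}
    (hP : ∀ n, Measurable fun x => P x n) (h : ∀ x, ∃ n, P x n) :
    ∃ n : X → ℕ, Measurable n ∧ ∀ x, P x (n x) ∧ ∀ m, P x m → n x ≤ m := by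
  classical
  exact ⟨fun x => Nat.find (h x), measurable_find h fun n => measurableSet_setOfPred.2 (hP n),
    fun x => ⟨Nat.find_spec (h x), fun m hm => Nat.find_min' _ hm⟩⟩

section Enumeration

variable {X : Type*} [MeasurableSpace X] {F : Setoid X}

theorem IsCountableBorel.measurable_rel (hF : IsCountableBorel F) :
    Measurable fun p : X × X => F p.1 p.2 :=
  measurableSet_setOfPred.1 hF.borel

theorem IsCountableBorel.mono {E : Setoid X} (hE : IsCountableBorel E) (h : F ≤ E)
    (hF : IsBorelRel F) : IsCountableBorel F :=
  ⟨hF, fun x => (hE.countable x).mono fun _ hy => h hy⟩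

/-- The comap of a countable Borel equivalence relation along a Borel function that moves points
within the classes of a countable relation. -/
theorem IsBorelRel.comap (hF : IsBorelRel F) {Y : Type*} [MeasurableSpace Y] {f : Y → X}
    (hf : Measurable f) : IsBorelRel (F.comap f) :=
  (hf.prodMap hf) hF

/-- Lusin–Novikov for the first projection cuts the relation into countably many Borel graphs of
partial functions. These have Borel domains and are Borel because injective Borel images of Borel
sets are Borel. -/
theorem IsCountableBorel.exists_enum [StandardBorelSpace X] (hF : IsCountableBorel F) :
    ∃ g : ℕ → X → X, (∀ n, Measurable (g n)) ∧ ∀ x y, F x y ↔ ∃ n, g n x = y := by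
  let _ := upgradeStandardBorel X
  obtain ⟨C, hCm, hCi, hC⟩ := isInjCovered_of_countable_fibers (Z := X × X) (W := X)
    continuous_fst hF.borel (fun x => by
      refine ((hF.countable x).image fun y => (x, y)).mono ?_
      rintro ⟨a, b⟩ ⟨h1, rfl⟩
      exact ⟨b, F.symm h1, rfl⟩)
  obtain ⟨D, hC'm, hC'i, hC', hC'F⟩ : ∃ D : ℕ → Set (X × X), (∀ n, MeasurableSet (D n)) ∧
      (∀ n, InjOn Prod.fst (D n)) ∧ (∀ x y, F x y → ∃ n, (x, y) ∈ D n) ∧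
      ∀ n x y, (x, y) ∈ D n → F x y := by
    refine ⟨fun n => C n ∩ {p : X × X | F p.1 p.2}, fun n => (hCm n).inter hF.borel,
      fun n => (hCi n).mono inter_subset_left, fun x y h => ?_, fun n x y h => h.2⟩
    obtain ⟨n, hn⟩ := mem_iUnion.1 (hC (show (x, y) ∈ {p : X × X | F p.1 p.2} from h))
    exact ⟨n, hn, h⟩
  -- Off its domain each partial function is extended by the identity, which stays in the class.
  have : ∀ n x, ∃ y, (∀ z, (x, z) ∈ D n → y = z) ∧ ((∀ z, (x, z) ∉ D n) → y = x) := by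
    intro n x
    by_cases h : ∃ z, (x, z) ∈ D n
    · obtain ⟨z, hz⟩ := h
      refine ⟨z, fun z' hz' => ?_, fun h => absurd hz (h z)⟩
      exact congrArg Prod.snd (hC'i n hz hz' rfl)
    · push Not at h
      exact ⟨x, fun z hz => absurd hz (h z), fun _ => rfl⟩
  choose g hg hg' using this
  refine ⟨g, fun n A hA => ?_, fun x y => ⟨fun h => ?_, ?_⟩⟩
  · have : g n ⁻¹' A = Prod.fst '' (D n ∩ Prod.snd ⁻¹' A) ∪ ((Prod.fst '' D n)ᶜ ∩ A) := by
      ext x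
      by_cases h : ∃ z, (x, z) ∈ D n
      · obtain ⟨z, hz⟩ := h
        have h1 : x ∈ Prod.fst '' D n := ⟨_, hz, rfl⟩
        simp only [mem_preimage, hg n x z hz, mem_union, mem_inter_iff, mem_compl_iff, h1,
          not_true_eq_false, false_and, or_false]
        constructor
        · exact fun h => ⟨(x, z), ⟨hz, h⟩, rfl⟩
        · rintro ⟨⟨a, b⟩, ⟨h2, h3⟩, rfl⟩
          rw [← hg n _ _ hz, hg n _ _ h2]; exact h3
      · push Not at h
        simp only [mem_preimage, hg' n x h, mem_union, mem_inter_iff, mem_compl_iff]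
        constructor
        · refine fun hx => Or.inr ⟨?_, hx⟩
          rintro ⟨⟨a, b⟩, h2, rfl⟩
          exact h _ h2
        · rintro (⟨⟨a, b⟩, ⟨h2, -⟩, rfl⟩ | ⟨-, h2⟩)
          · exact absurd h2 (h _)
          · exact h2
    rw [this]
    exact (((hC'm n).inter (measurable_snd hA)).image_of_measurable_injOn measurable_fst
      ((hC'i n).mono inter_subset_left)).union
      (((hC'm n).image_of_measurable_injOn measurable_fst (hC'i n)).compl.inter hA)
  · obtain ⟨n, hn⟩ := hC' x y h
    exact ⟨n, hg n x y hn⟩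
  · rintro ⟨n, rfl⟩
    by_cases h : ∃ z, (x, z) ∈ D n
    · obtain ⟨z, hz⟩ := h
      rw [hg n x z hz]; exact hC'F n x z hz
    · push Not at h
      rw [hg' n x h]

variable [StandardBorelSpace X]

/-- Borel functions that enumerate the classes of a countable Borel equivalence relation. -/
noncomputable def IsCountableBorel.enum (hF : IsCountableBorel F) : ℕ → X → X :=
  hF.exists_enum.choose

@[fun_prop]
theorem IsCountableBorel.measurable_enum (hF : IsCountableBorel F) (n : ℕ) :
    Measurable (hF.enum n) :=
  hF.exists_enum.choose_spec.1 n

theorem IsCountableBorel.rel_iff (hF : IsCountableBorel F) {x y : X} :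
    F x y ↔ ∃ n, hF.enum n x = y :=
  hF.exists_enum.choose_spec.2 x y

theorem IsCountableBorel.rel_enum (hF : IsCountableBorel F) (n : ℕ) (x : X) : F x (hF.enum n x) :=
  hF.rel_iff.2 ⟨n, rfl⟩

/-- This and the next two lemmas turn quantification over a class into quantification over `ℕ`, so
that conditions on classes are seen to be Borel. -/
theorem IsCountableBorel.exists_iff (hF : IsCountableBorel F) {x : X} {P : X → Prop} :
    (∃ y, F x y ∧ P y) ↔ ∃ n, P (hF.enum n x) := by
  constructor
  · rintro ⟨y, h, hy⟩
    obtain ⟨n, rfl⟩ := hF.rel_iff.1 h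
    exact ⟨n, hy⟩
  · rintro ⟨n, hn⟩
    exact ⟨_, hF.rel_enum n x, hn⟩

theorem IsCountableBorel.forall_iff (hF : IsCountableBorel F) {x : X} {P : X → Prop} :
    (∀ y, F x y → P y) ↔ ∀ n, P (hF.enum n x) := by
  constructor
  · exact fun h n => h _ (hF.rel_enum n x)
  · intro h y hy
    obtain ⟨n, rfl⟩ := hF.rel_iff.1 hy
    exact h n

theorem IsCountableBorel.finite_iff (hF : IsCountableBorel F) {x : X} {P : X → Prop} :
    {y | F x y ∧ P y}.Finite ↔
      ∃ N : ℕ, ∀ n : ℕ, P (hF.enum n x) → ∃ i : Fin N, hF.enum i x = hF.enum n x := by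
  constructor
  · intro h
    have : ∀ y, ∃ n, F x y → hF.enum n x = y := fun y => by
      by_cases hy : F x y
      · obtain ⟨n, hn⟩ := hF.rel_iff.1 hy
        exact ⟨n, fun _ => hn⟩
      · exact ⟨0, fun h => absurd h hy⟩
    choose k hk using this
    obtain ⟨N, hN⟩ := (h.image k).bddAbove
    refine ⟨N + 1, fun n hn => ?_⟩
    have h1 := hF.rel_enum n x
    exact ⟨⟨k (hF.enum n x), Nat.lt_succ_of_le (hN ⟨_, ⟨h1, hn⟩, rfl⟩)⟩, hk _ h1⟩
  · rintro ⟨N, hN⟩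
    refine (finite_range fun i : Fin N => hF.enum i x).subset ?_
    rintro y ⟨hy, hP⟩
    obtain ⟨n, rfl⟩ := hF.rel_iff.1 hy
    exact hN n hP

/-- Borel uniformization of Borel subsets of countable Borel equivalence relations. -/
theorem IsCountableBorel.exists_select (hF : IsCountableBorel F) {P : X → X → Prop}
    (hP : Measurable fun p : X × X => P p.1 p.2) (h : ∀ x, ∃ y, F x y ∧ P x y) :
    ∃ σ : X → X, Measurable σ ∧ ∀ x, F x (σ x) ∧ P x (σ x) := by
  classical
  have h' : ∀ x, ∃ n, P x (hF.enum n x) := fun x => hF.exists_iff.1 (h x)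
  refine ⟨fun x => hF.enum (Nat.find (h' x)) x, ?_, fun x => ⟨hF.rel_enum _ _, ?_⟩⟩
  · exact Measurable.find (p := fun n x => P x (hF.enum n x)) (fun n => hF.measurable_enum n)
      (fun n => measurableSet_setOfPred.2 (by fun_prop)) h'
  · exact Nat.find_spec (h' x)

/-- Move every point, within its class, into a given complete Borel set. -/
theorem IsCountableBorel.exists_retract (hF : IsCountableBorel F) {A : Set X}
    (hA : MeasurableSet A) (h : ∀ x, ∃ y ∈ A, F x y) :
    ∃ f : X → X, Measurable f ∧ (∀ x, F x (f x)) ∧ (∀ x, f x ∈ A) ∧ ∀ x ∈ A, f x = x := by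
  have hA' : Measurable fun x => x ∈ A := hA.mem
  obtain ⟨f, hf, h1⟩ := hF.exists_select (P := fun x y => y ∈ A ∧ (x ∈ A → y = x))
    (by fun_prop) (fun x => by
      by_cases hx : x ∈ A
      · exact ⟨x, F.refl x, hx, fun _ => rfl⟩
      · obtain ⟨y, hy, hxy⟩ := h x
        exact ⟨y, hxy, hy, fun h => absurd h hx⟩)
  exact ⟨f, hf, fun x => (h1 x).1, fun x => (h1 x).2.1, fun x hx => (h1 x).2.2 hx⟩

/-- The position of `y` in the enumeration of the class of `x`. -/
theorem IsCountableBorel.exists_index (hF : IsCountableBorel F) :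
    ∃ k : X → X → ℕ, (Measurable fun p : X × X => k p.1 p.2) ∧
      ∀ x y, F x y → hF.enum (k x y) x = y := by
  classical
  have hr := hF.measurable_rel
  have h : ∀ p : X × X, ∃ n, F p.1 p.2 → hF.enum n p.1 = p.2 := fun p => by
    by_cases hy : F p.1 p.2
    · obtain ⟨n, hn⟩ := hF.rel_iff.1 hy
      exact ⟨n, fun _ => hn⟩
    · exact ⟨0, fun h => absurd h hy⟩
  refine ⟨fun x y => Nat.find (h (x, y)), ?_, fun x y => Nat.find_spec (h (x, y))⟩
  exact measurable_find h fun n => measurableSet_setOfPred.2 (by fun_prop)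

end Enumeration

/-! ### Sizes and cocycle identities -/

section Size

variable {X : Type*} {ρ : X → X → ℝ}

theorem size_congr {ρ' : X → X → ℝ} {z : X} {Y : Set X} (h : ∀ y ∈ Y, ρ y z = ρ' y z) :
    size ρ z Y = size ρ' z Y :=
  tsum_congr fun y => by rw [h y y.2]

theorem size_mono {z : X} {Y Y' : Set X} (h : Y ⊆ Y') : size ρ z Y ≤ size ρ z Y' :=
  ENNReal.tsum_mono_subtype (fun y => ENNReal.ofReal (ρ y z)) h

theorem size_singleton {z y : X} : size ρ z {y} = ENNReal.ofReal (ρ y z) :=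
  tsum_singleton y fun y => ENNReal.ofReal (ρ y z)

end Size

section Cocycle

variable {X : Type*} [MeasurableSpace X] {F : Setoid X} {ρ : X → X → ℝ}

theorem IsBorelCocycle.mono {E : Setoid X} (hρ : IsBorelCocycle E ρ) (h : F ≤ E) :
    IsBorelCocycle F ρ where
  pos x y hxy := hρ.pos x y (h hxy)
  mul x y z hxy hyz := hρ.mul x y z (h hxy) (h hyz)
  borel := Measurable.comp (f := fun p : {p : X × X // F p.1 p.2} =>
    (⟨p.1, h p.2⟩ : {p : X × X // E p.1 p.2})) hρ.borel measurable_subtype_coe.subtype_mk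

theorem IsBorelCocycle.self (hρ : IsBorelCocycle F ρ) (x : X) : ρ x x = 1 := by
  have h := hρ.mul x x x (F.refl x) (F.refl x)
  have h' := hρ.pos x x (F.refl x)
  exact (mul_left_cancel₀ h'.ne' (by linarith))

theorem IsBorelCocycle.mul_swap (hρ : IsBorelCocycle F ρ) {x y : X} (h : F x y) :
    ρ x y * ρ y x = 1 := by
  rw [← hρ.mul x y x h (F.symm h), hρ.self]

theorem IsBorelCocycle.swap (hρ : IsBorelCocycle F ρ) : IsBorelCocycle F fun x y => ρ y x where
  pos x y h := hρ.pos y x (F.symm h)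
  mul x y z h h' := by rw [mul_comm]; exact hρ.mul z y x (F.symm h') (F.symm h)
  borel := Measurable.comp (f := fun p : {p : X × X // F p.1 p.2} =>
    (⟨p.1.swap, F.symm p.2⟩ : {p : X × X // F p.1 p.2})) hρ.borel
    (measurable_swap.comp measurable_subtype_coe).subtype_mk

theorem IsBorelCocycle.le_iff (hρ : IsBorelCocycle F ρ) {x y z w : X} (hx : F z x) (hy : F z y)
    (hw : F z w) : ρ x z ≤ ρ y z ↔ ρ x w ≤ ρ y w := by
  rw [hρ.mul x z w (F.symm hx) hw, hρ.mul y z w (F.symm hy) hw,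
    mul_le_mul_iff_of_pos_right (hρ.pos z w hw)]

theorem IsBorelCocycle.size_mul (hρ : IsBorelCocycle F ρ) {z z' : X} (h : F z z') {Y : Set X}
    (hY : ∀ y ∈ Y, F z y) : size ρ z' Y = size ρ z Y * ENNReal.ofReal (ρ z z') := by
  rw [size, size, ← ENNReal.tsum_mul_right]
  refine tsum_congr fun y => ?_
  rw [hρ.mul y z z' (F.symm (hY y y.2)) h,
    ENNReal.ofReal_mul (hρ.pos _ _ (F.symm (hY y y.2))).le]

/-- A Borel cocycle can be extended to a Borel function on the square. -/
theorem IsBorelCocycle.exists_measurable_extension (hF : IsBorelRel F) (hρ : IsBorelCocycle F ρ) :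
    ∃ ρ' : X → X → ℝ, (∀ x y, F x y → ρ' x y = ρ x y) ∧
      Measurable fun p : X × X => ρ' p.1 p.2 := by
  classical
  refine ⟨fun x y => if F x y then ρ x y else 1, fun x y h => if_pos h, ?_⟩
  have := Measurable.dite (s := {p : X × X | F p.1 p.2})
    (f := fun p => ρ p.1.1 p.1.2) hρ.borel (g := fun _ => 1) measurable_const hF
  exact this

theorem IsBorelCocycle.congr {ρ' : X → X → ℝ} (hρ : IsBorelCocycle F ρ)
    (h : ∀ x y, F x y → ρ' x y = ρ x y) : IsBorelCocycle F ρ' where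
  pos x y hxy := by rw [h x y hxy]; exact hρ.pos x y hxy
  mul x y z hxy hyz := by
    rw [h x y hxy, h y z hyz, h x z (F.trans hxy hyz)]; exact hρ.mul x y z hxy hyz
  borel := by
    convert hρ.borel using 2 with p
    exact h _ _ p.2

variable [StandardBorelSpace X]

/-- Summing over the first occurrences in the enumeration counts each point of the class once and
writes the size as a countable sum of Borel functions. -/
theorem IsCountableBorel.measurable_size (hF : IsCountableBorel F)
    (hρ : Measurable fun p : X × X => ρ p.1 p.2) {α : Type*} [MeasurableSpace α] {u v : α → X}
    (hu : Measurable u) (hv : Measurable v) {P : α → X → Prop}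
    (hP : Measurable fun p : α × X => P p.1 p.2) :
    Measurable fun a => size ρ (v a) {y | F (u a) y ∧ P a y} := by
  classical
  have key : ∀ a, size ρ (v a) {y | F (u a) y ∧ P a y} =
      ∑' n : ℕ, if (∀ m : Fin n, hF.enum m (u a) ≠ hF.enum n (u a)) ∧ P a (hF.enum n (u a)) then
        ENNReal.ofReal (ρ (hF.enum n (u a)) (v a)) else 0 := by
    intro a
    let N : Set ℕ := {n | (∀ m : Fin n, hF.enum m (u a) ≠ hF.enum n (u a)) ∧
      P a (hF.enum n (u a))}
    let e : N → {y | F (u a) y ∧ P a y} := fun n => ⟨hF.enum n (u a), hF.rel_enum _ _, n.2.2⟩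
    have he : e.Bijective := by
      constructor
      · rintro ⟨n, hn⟩ ⟨m, hm⟩ h
        have h : hF.enum n (u a) = hF.enum m (u a) := congrArg Subtype.val h
        rcases lt_trichotomy n m with hl | hl | hl
        · exact absurd h (hm.1 ⟨n, hl⟩)
        · exact Subtype.ext hl
        · exact absurd h.symm (hn.1 ⟨m, hl⟩)
      · rintro ⟨y, hy, hP⟩
        have h := hF.rel_iff.1 hy
        refine ⟨⟨Nat.find h, fun m => ?_, ?_⟩, Subtype.ext (Nat.find_spec h)⟩
        · rw [Nat.find_spec h]; exact Nat.find_min h m.2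
        · rw [Nat.find_spec h]; exact hP
    rw [size, ← (Equiv.ofBijective e he).tsum_eq]
    simp only [Equiv.ofBijective_apply, e]
    rw [tsum_subtype N fun n => ENNReal.ofReal (ρ (hF.enum n (u a)) (v a))]
    exact tsum_congr fun n => by simp only [indicator, N, mem_ofPred]
  simp only [key]
  refine Measurable.tsum fun n => Measurable.ite (measurableSet_setOfPred.2 ?_) ?_ measurable_const
  · fun_prop
  · fun_prop

/-- The points of `V` of bounded size form a finite subset of each class. -/
def IsLocallyFinite (F : Setoid X) (ρ : X → X → ℝ) (V : Set X) : Prop :=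
  ∀ x, ∀ b : ℝ, {v | F x v ∧ v ∈ V ∧ ρ v x ≤ b ∧ ρ x v ≤ b}.Finite

/-- Borel choice of a point of least size among the candidates. -/
theorem IsCountableBorel.exists_argmin (hF : IsCountableBorel F)
    (hρ : Measurable fun p : X × X => ρ p.1 p.2) {P : X → X → Prop}
    (hP : Measurable fun p : X × X => P p.1 p.2) (h : ∀ x, ∃ y, F x y ∧ P x y)
    (hfin : ∀ x, ∀ b : ℝ, {y | F x y ∧ P x y ∧ ρ y x ≤ b}.Finite) :
    ∃ σ : X → X, Measurable σ ∧ ∀ x, F x (σ x) ∧ P x (σ x) ∧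
      ∀ y, F x y → P x y → ρ (σ x) x ≤ ρ y x := by
  refine hF.exists_select (P := fun x y => P x y ∧ ∀ y', F x y' → P x y' → ρ y x ≤ ρ y' x) ?_ ?_
  · simp only [hF.forall_iff]
    fun_prop
  · intro x
    obtain ⟨y₀, hy₀, hP₀⟩ := h x
    obtain ⟨y, ⟨hy, hPy, hyb⟩, hmin⟩ := exists_min_image _ (fun y => ρ y x) (hfin x (ρ y₀ x))
      ⟨y₀, hy₀, hP₀, le_rfl⟩
    refine ⟨y, hy, hPy, fun y' hy' hP' => ?_⟩
    by_cases hb : ρ y' x ≤ ρ y₀ x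
    · exact hmin y' ⟨hy', hP', hb⟩
    · exact hyb.trans (not_le.1 hb).le

end Cocycle

/-! ### Smooth cocycles and locally finite complete sets -/

section Smooth

variable {X : Type*} [MeasurableSpace X] [StandardBorelSpace X] {F : Setoid X} {ρ : X → X → ℝ}

/-- Keep the points of least colour in their class. They share a colour, so no ratio of two of them
lies in `U`: their logarithmic sizes are uniformly separated, and a bounded range holds finitely
many. -/
theorem IsSmoothCocycle.exists_isLocallyFinite (hF : IsCountableBorel F)
    (hρ : IsBorelCocycle F ρ) (h : IsSmoothCocycle F ρ) :
    ∃ V : Set X, MeasurableSet V ∧ (∀ x, ∃ v ∈ V, F x v) ∧ IsLocallyFinite F ρ V := by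
  obtain ⟨U, hU, -, h1, c, hc, hcU⟩ := h
  refine ⟨{x | ∀ y, F x y → c x ≤ c y}, ?_, fun x => ?_, fun x b => ?_⟩
  · simp only [hF.forall_iff]
    exact measurableSet_setOfPred.2 (by fun_prop)
  · obtain ⟨v, hv, hmin⟩ := (measure c).wf.has_min {y | F x y} ⟨x, F.refl x⟩
    exact ⟨v, fun y hy => not_lt.1 (hmin y (F.trans hv hy)), hv⟩
  · obtain ⟨r, hr, hrU⟩ := Metric.isOpen_iff.1 (hU.preimage Real.continuous_exp) 0 (by simpa using h1)
    refine Set.Finite.of_injOn (f := fun v => ⌊Real.log (ρ v x) / r⌋)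
      (t := Icc ⌊-Real.log b / r⌋ ⌊Real.log b / r⌋) ?_ ?_ (finite_Icc _ _)
    · rintro v ⟨hv, -, hb, hb'⟩
      have hp := hρ.pos v x (F.symm hv)
      have hp' := hρ.pos x v hv
      have h2 : ρ v x = (ρ x v)⁻¹ := eq_inv_of_mul_eq_one_left (hρ.mul_swap (F.symm hv))
      have h3 := Real.log_le_log hp hb
      have h4 := Real.log_le_log hp' hb'
      have h5 : Real.log (ρ v x) = - Real.log (ρ x v) := by rw [h2, Real.log_inv]
      constructor <;> apply Int.floor_le_floor <;> gcongr
      linarith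
    · rintro u ⟨hu, hum, -⟩ v ⟨hv, hvm, -⟩ huv
      by_contra hne
      have huv' := F.trans (F.symm hu) hv
      refine hcU u v ⟨hne, huv', ?_⟩ (le_antisymm (hum v huv') (hvm u (F.symm huv')))
      have hp := hρ.pos u x (F.symm hu)
      have hp' := hρ.pos x v hv
      have h2 : ρ v x = (ρ x v)⁻¹ := eq_inv_of_mul_eq_one_left (hρ.mul_swap (F.symm hv))
      have h5 : Real.log (ρ u v) = Real.log (ρ u x) - Real.log (ρ v x) := by
        rw [hρ.mul u x v (F.symm hu) hv, Real.log_mul hp.ne' hp'.ne', h2, Real.log_inv]; ring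
      have h6 := Int.abs_sub_lt_one_of_floor_eq_floor huv
      rw [← sub_div, ← h5, abs_div, abs_of_pos hr, div_lt_one hr] at h6
      have h7 := hrU (show Real.log (ρ u v) ∈ Metric.ball 0 r by simpa using h6)
      rwa [mem_preimage, Real.exp_log (hρ.pos _ _ huv')] at h7

/-- A locally finite Borel digraph has a countable Borel colouring. -/
theorem IsCountableBorel.exists_coloring (hF : IsCountableBorel F) {H : X → X → Prop}
    (hH : Measurable fun p : X × X => H p.1 p.2) (hfin : ∀ x, {y | F x y ∧ H x y}.Finite) :
    ∃ c : X → ℕ, Measurable c ∧ ∀ x y, F x y → H x y → x ≠ y → c x ≠ c y := by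
  classical
  obtain ⟨q, hq⟩ := exists_surjective_nat (ℚ × ℚ)
  have he := (measurableEmbedding_embeddingReal X).measurable
  have hi := (measurableEmbedding_embeddingReal X).injective
  generalize embeddingReal X = e at he hi
  -- The colour of `x` codes a rational interval that isolates the real code of `x` from those of
  -- its finitely many neighbours.
  have hex : ∀ x, ∃ n, ((q n).1 < e x ∧ e x < (q n).2) ∧
      ∀ y, F x y → H x y → x ≠ y → ¬ ((q n).1 < e y ∧ e y < (q n).2) := by
    intro x
    have hS := ((hfin x).subset (t := {y | (F x y ∧ H x y) ∧ x ≠ y}) fun y hy => hy.1).image e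
    obtain ⟨l, u, ⟨hl, hu⟩, hlu⟩ := mem_nhds_iff_exists_Ioo_subset.1
      (hS.isClosed.isOpen_compl.mem_nhds (x := e x) (by
        rintro ⟨y, hy, hxy⟩
        exact hy.2 (hi hxy).symm))
    obtain ⟨a, hla, hax⟩ := exists_rat_btwn hl
    obtain ⟨b, hxb, hbu⟩ := exists_rat_btwn hu
    obtain ⟨n, hn⟩ := hq (a, b)
    refine ⟨n, by simp [hn, hax, hxb], fun y h1 h2 h3 h4 => ?_⟩
    simp only [hn] at h4
    exact hlu ⟨hla.trans h4.1, h4.2.trans hbu⟩ ⟨y, ⟨⟨h1, h2⟩, h3⟩, rfl⟩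
  obtain ⟨c, hcm, hc⟩ := exists_measurable_least (fun n => by
    simp only [hF.forall_iff]
    fun_prop) hex
  refine ⟨c, hcm, fun x y hxy hH hne h => ?_⟩
  have h1 := (hc x).1.2 y hxy hH hne
  rw [h] at h1
  exact h1 (hc y).1.1

/-- Retract every point to `V` by `f`. The colour records a bound on the ratio between `x` and `f
x`, the position of `x` in the enumeration from `f x`, and a colour of `f x` among the points of `V`
of comparable size. -/
theorem IsLocallyFinite.isSmoothCocycle (hF : IsCountableBorel F)
    (hρ : IsBorelCocycle F ρ) (hm : Measurable fun p : X × X => ρ p.1 p.2)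
    {V : Set X} (hV : MeasurableSet V) (hVc : ∀ x, ∃ v ∈ V, F x v) (hVf : IsLocallyFinite F ρ V) :
    IsSmoothCocycle F ρ := by
  classical
  obtain ⟨f, hf, hFf, hfV, -⟩ := hF.exists_retract hV hVc
  obtain ⟨k, hk, hk'⟩ := hF.exists_index
  have hVm : Measurable fun x => x ∈ V := hV.mem
  -- The bound `n * 2 * n` comes from going from `f x` to `x`, to `y`, to `f y`, where the middle
  -- ratio is at most `2` by the choice of `U`.
  have hcol := fun n : ℕ => hF.exists_coloring
    (H := fun x y => y ∈ V ∧ ρ y x ≤ n * 2 * n ∧ ρ x y ≤ n * 2 * n) (by fun_prop)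
    (fun x => hVf x _)
  choose c hc hcH using hcol
  have hex : ∀ x, ∃ n : ℕ, ρ (f x) x ≤ n ∧ ρ x (f x) ≤ n := fun x => by
    obtain ⟨n, hn⟩ := exists_nat_ge (max (ρ (f x) x) (ρ x (f x)))
    exact ⟨n, (le_max_left _ _).trans hn, (le_max_right _ _).trans hn⟩
  obtain ⟨n, hnm, hns⟩ := exists_measurable_least (fun n => by fun_prop) hex
  replace hns := fun x => (hns x).1
  have hcm : Measurable fun p : ℕ × X => c p.1 p.2 := measurable_from_prod_countable_right hc
  have hpair : Measurable fun p : ℕ × ℕ => Nat.pair p.1 p.2 := measurable_of_countable _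
  refine ⟨Ioo (1 / 2) 2, isOpen_Ioo, fun x hx => lt_trans (by norm_num) hx.1, by norm_num,
    fun x => Nat.pair (n x) (Nat.pair (k (f x) x) (c (n x) (f x))), ?_, ?_⟩
  · fun_prop
  · rintro x y ⟨hne, hxy, h1, h2⟩ he
    obtain ⟨hn, he⟩ := Nat.pair_eq_pair.1 he
    obtain ⟨hkk, he⟩ := Nat.pair_eq_pair.1 he
    have hff : F (f x) (f y) := F.trans (F.symm (hFf x)) (F.trans hxy (hFf y))
    have h3 : ρ (f x) (f y) = ρ (f x) x * ρ x y * ρ y (f y) := by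
      rw [← hρ.mul (f x) x y (F.symm (hFf x)) hxy,
        ← hρ.mul (f x) y (f y) (F.trans (F.symm (hFf x)) hxy) (hFf y)]
    have h4 : ρ (f y) (f x) = ρ (f y) y * ρ y x * ρ x (f x) := by
      rw [← hρ.mul (f y) y x (F.symm (hFf y)) (F.symm hxy),
        ← hρ.mul (f y) x (f x) (F.trans (F.symm (hFf y)) (F.symm hxy)) (hFf x)]
    have h5 : ρ y x ≤ 2 := by
      have := hρ.mul_swap hxy
      have := hρ.pos y x (F.symm hxy)
      nlinarith
    have hx := hns x
    have hy := hns y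
    rw [← hn] at hy
    have p1 := hρ.pos _ _ (F.symm (hFf x))
    have p2 := hρ.pos _ _ (F.symm (hFf y))
    have p3 := hρ.pos _ _ (hFf x)
    have p4 := hρ.pos _ _ (hFf y)
    have p5 := hρ.pos _ _ hxy
    have p6 := hρ.pos _ _ (F.symm hxy)
    have hfe : f x = f y := by
      by_contra hfne
      refine hcH (n x) (f x) (f y) hff ⟨hfV y, ?_, ?_⟩ hfne (by rw [he, hn])
      · rw [h4]; gcongr
        exacts [hy.1, hx.2]
      · rw [h3]; gcongr
        exacts [hx.1, hy.2]
    apply hne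
    rw [← hk' (f x) x (F.symm (hFf x)), ← hk' (f y) y (F.symm (hFf y)), hkk, hfe]

end Smooth

/-! ### Transversals from one-sided bounds -/

theorem IsLocallyFinite.swap {X : Type*} {F : Setoid X} {ρ : X → X → ℝ} {V : Set X} (h : IsLocallyFinite F ρ V) :
    IsLocallyFinite F (fun x y => ρ y x) V :=
  fun x b => (h x b).subset fun _ hv => ⟨hv.1, hv.2.1, hv.2.2.2, hv.2.2.1⟩

theorem IsLocallyFinite.mono {X : Type*} {F : Setoid X} {ρ : X → X → ℝ} {V W : Set X} (h : IsLocallyFinite F ρ V) (hW : W ⊆ V) :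
    IsLocallyFinite F ρ W :=
  fun x b => (h x b).subset fun _ hv => ⟨hv.1, hW hv.2.1, hv.2.2⟩

section Selection

variable {X : Type*} [MeasurableSpace X] {F : Setoid X} {ρ : X → X → ℝ}

theorem IsBorelCocycle.le_one_iff (hρ : IsBorelCocycle F ρ) {x y : X} (h : F x y) :
    ρ x y ≤ 1 ↔ 1 ≤ ρ y x := by
  have h1 := hρ.mul_swap h
  have h2 := hρ.pos x y h
  have h3 := hρ.pos y x (F.symm h)
  constructor <;> intro h <;> nlinarith

theorem IsBorelCocycle.lt_one_iff (hρ : IsBorelCocycle F ρ) {x y : X} (h : F x y) :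
    ρ x y < 1 ↔ 1 < ρ y x := by
  have h1 := hρ.le_one_iff (F.symm h)
  exact ⟨fun h2 => not_le.1 fun h3 => absurd (h1.1 h3) (not_le.2 h2),
    fun h2 => not_le.1 fun h3 => absurd (h1.2 h3) (not_le.2 h2)⟩

theorem IsLocallyFinite.finite_of_le (hρ : IsBorelCocycle F ρ) {V : Set X}
    (h : IsLocallyFinite F ρ V) (x : X) (b : ℝ) :
    {v | F x v ∧ (v ∈ V ∧ 1 ≤ ρ v x) ∧ ρ v x ≤ b}.Finite := by
  refine (h x (max b 1)).subset ?_
  rintro v ⟨hv, ⟨hV, h1⟩, hb⟩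
  exact ⟨hv, hV, hb.trans (le_max_left _ _),
    ((hρ.le_one_iff hv).2 h1).trans (le_max_right _ _)⟩

theorem IsLocallyFinite.exists_isMax (hρ : IsBorelCocycle F ρ) {V : Set X}
    (h : IsLocallyFinite F ρ V) {x : X} (hx : x ∈ V) {b : ℝ}
    (hb : ∀ v ∈ V, F x v → ρ v x ≤ b) :
    ∃ v ∈ V, F x v ∧ ∀ w ∈ V, F v w → ρ w v ≤ 1 := by
  obtain ⟨v, ⟨hv, ⟨hV, h1⟩, -⟩, hmax⟩ := exists_max_image _ (fun v => ρ v x) (h.finite_of_le hρ x b)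
    ⟨x, F.refl x, ⟨hx, (hρ.self x).ge⟩, hb x hx (F.refl x)⟩
  refine ⟨v, hV, hv, fun w hw hvw => ?_⟩
  have hxw := F.trans hv hvw
  have h2 : ρ w x ≤ ρ v x := by
    by_cases h3 : 1 ≤ ρ w x
    · exact hmax w ⟨hxw, ⟨hw, h3⟩, hb w hw hxw⟩
    · exact (not_le.1 h3).le.trans h1
  rwa [hρ.le_iff hxw hv hv, hρ.self] at h2

variable [StandardBorelSpace X]

/-- Borel choice of one point in each nonempty finite trace of a Borel set on the classes. -/
theorem IsCountableBorel.exists_transversal_of_finite (hF : IsCountableBorel F) {Z : Set X}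
    (hZ : MeasurableSet Z) (hfin : ∀ x, {z | F x z ∧ z ∈ Z}.Finite) :
    ∃ Y ⊆ Z, MeasurableSet Y ∧ IsPartialTransversal F Y ∧ ∀ z ∈ Z, ∃ y ∈ Y, F z y := by
  have he := (measurableEmbedding_embeddingReal X).measurable
  have hi := (measurableEmbedding_embeddingReal X).injective
  generalize embeddingReal X = e at he hi
  have hZ' : Measurable fun x => x ∈ Z := hZ.mem
  refine ⟨{z | z ∈ Z ∧ ∀ y, F z y → y ∈ Z → e z ≤ e y}, fun z hz => hz.1, ?_, ?_, fun z hz => ?_⟩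
  · simp only [hF.forall_iff]
    exact measurableSet_setOfPred.2 (by fun_prop)
  · exact fun x hx y hy hxy => hi (le_antisymm (hx.2 y hxy hy.1) (hy.2 x (F.symm hxy) hx.1))
  · obtain ⟨y, ⟨hy, hyZ⟩, hmin⟩ := exists_min_image _ e (hfin z) ⟨z, F.refl z, hz⟩
    exact ⟨y, ⟨hyZ, fun w hw hwZ => hmin w ⟨F.trans hy hw, hwZ⟩⟩, hy⟩

/-- Borel choice of one point in each class in which a locally finite set is nonempty and bounded
on some side. -/
theorem IsLocallyFinite.exists_transversal (hF : IsCountableBorel F) (hρ : IsBorelCocycle F ρ)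
    (hm : Measurable fun p : X × X => ρ p.1 p.2) {V : Set X} (hV : MeasurableSet V)
    (hVf : IsLocallyFinite F ρ V)
    (hb : ∀ x ∈ V, (∃ b : ℝ, ∀ v ∈ V, F x v → ρ v x ≤ b) ∨ ∃ b : ℝ, ∀ v ∈ V, F x v → ρ x v ≤ b) :
    ∃ Y ⊆ V, MeasurableSet Y ∧ IsPartialTransversal F Y ∧ ∀ v ∈ V, ∃ y ∈ Y, F v y := by
  have hVm : Measurable fun x => x ∈ V := hV.mem
  let Up : X → Prop := fun x => ∃ n : ℕ, ∀ v, F x v → v ∈ V → ρ v x ≤ n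
  have hUpm : Measurable Up := by
    simp only [Up, hF.forall_iff]
    fun_prop
  have hUp : ∀ x y, F x y → Up x → Up y := by
    rintro x y hxy ⟨n, hn⟩
    obtain ⟨m, hmn⟩ := exists_nat_ge (n * ρ x y)
    refine ⟨m, fun v hv hvV => le_trans ?_ hmn⟩
    have hxv := F.trans hxy hv
    rw [hρ.mul v x y (F.symm hxv) hxy]
    exact mul_le_mul_of_nonneg_right (hn v hxv hvV) (hρ.pos x y hxy).le
  -- The largest points where `V` is bounded above, the smallest ones otherwise. The side depends
  -- only on the class, so chosen points of one class have equal size and are finitely many.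
  let Z : Set X := {x | x ∈ V ∧ ((Up x ∧ ∀ v, F x v → v ∈ V → ρ v x ≤ 1) ∨
    (¬ Up x ∧ ∀ v, F x v → v ∈ V → ρ x v ≤ 1))}
  have hZm : MeasurableSet Z := by
    simp only [Z, hF.forall_iff]
    exact measurableSet_setOfPred.2 (by fun_prop)
  have hZ1 : ∀ z ∈ Z, ∀ z' ∈ Z, F z z' → ρ z' z ≤ 1 := by
    rintro z ⟨hz, h⟩ z' ⟨hz', h'⟩ hzz'
    rcases h with ⟨-, h⟩ | ⟨hu, -⟩
    · exact h z' hzz' hz'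
    · rcases h' with ⟨hu', -⟩ | ⟨-, h'⟩
      · exact absurd (hUp _ _ (F.symm hzz') hu') hu
      · exact h' z (F.symm hzz') hz
  obtain ⟨Y, hYZ, hYm, hYt, hY⟩ := hF.exists_transversal_of_finite hZm (fun x => by
    rcases eq_empty_or_nonempty {z | F x z ∧ z ∈ Z} with h0 | ⟨z₀, hz₀, hz₀Z⟩
    · rw [h0]; exact finite_empty
    · refine (hVf z₀ 1).subset ?_
      rintro z ⟨hz, hzZ⟩
      have h := F.trans (F.symm hz₀) hz
      exact ⟨h, hzZ.1, hZ1 _ hz₀Z _ hzZ h, hZ1 _ hzZ _ hz₀Z (F.symm h)⟩)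
  refine ⟨Y, fun y hy => (hYZ hy).1, hYm, hYt, fun v hv => ?_⟩
  suffices ∃ z ∈ Z, F v z by
    obtain ⟨z, hz, hvz⟩ := this
    obtain ⟨y, hy, hzy⟩ := hY z hz
    exact ⟨y, hy, F.trans hvz hzy⟩
  by_cases hu : Up v
  · obtain ⟨n, hn⟩ := id hu
    obtain ⟨z, hz, hvz, hmax⟩ := hVf.exists_isMax hρ hv fun w hw hvw => hn w hvw hw
    exact ⟨z, ⟨hz, Or.inl ⟨hUp _ _ hvz hu, fun w h1 h2 => hmax w h2 h1⟩⟩, hvz⟩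
  · rcases hb v hv with ⟨b, hb⟩ | ⟨b, hb⟩
    · obtain ⟨n, hn⟩ := exists_nat_ge b
      exact absurd ⟨n, fun w h1 h2 => (hb w h2 h1).trans hn⟩ hu
    · obtain ⟨z, hz, hvz, hmax⟩ := hVf.swap.exists_isMax hρ.swap hv hb
      exact ⟨z, ⟨hz, Or.inr ⟨fun h => hu (hUp _ _ (F.symm hvz) h), fun w h1 h2 => hmax w h2 h1⟩⟩,
        hvz⟩

end Selection

/-! ### Automorphisms from colourings -/

section Automorphism

variable {X : Type*} [MeasurableSpace X] {F : Setoid X} {ρ : X → X → ℝ}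

/-- `σ` maps every point to a next larger point of the same colour. -/
structure IsNext (F : Setoid X) (ρ : X → X → ℝ) (ι : X → ℕ) (σ : X → X) : Prop where
  rel : ∀ x, F x (σ x)
  color : ∀ x, ι (σ x) = ι x
  one_lt : ∀ x, 1 < ρ (σ x) x
  le : ∀ x y, F x y → ι y = ι x → 1 < ρ y x → ρ (σ x) x ≤ ρ y x

/-- Since `x` lies below `σ x`, the point `τ (σ x)` is at least as large as `x`. If it were another
point it would be strictly larger, there being no ties, and strictly below `σ x`, against the
minimality of `σ x`. -/
theorem IsNext.leftInverse (hρ : IsBorelCocycle F ρ) {ι : X → ℕ} {σ τ : X → X}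
    (hσ : IsNext F ρ ι σ) (hτ : IsNext F (fun x y => ρ y x) ι τ)
    (htie : ∀ x y, F x y → ι x = ι y → ρ x y = 1 → x = y) : Function.LeftInverse τ σ := by
  intro x
  have h1 := hσ.rel x
  have h2 := hτ.rel (σ x)
  have h12 := F.trans h1 h2
  have h3 := hτ.le (σ x) x (F.symm h1) (hσ.color x).symm (hσ.one_lt x)
  have hc : ι (τ (σ x)) = ι x := (hτ.color _).trans (hσ.color x)
  by_contra hne
  have h4 : 1 ≤ ρ (τ (σ x)) x := by
    have h5 := hρ.mul (σ x) (τ (σ x)) x h2 (F.symm h12)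
    have := hρ.pos (σ x) (τ (σ x)) h2
    have := hρ.pos (τ (σ x)) x (F.symm h12)
    by_contra h6
    nlinarith
  have h5 : 1 < ρ (τ (σ x)) x :=
    lt_of_le_of_ne h4 fun h => hne (htie _ _ (F.symm h12) hc h.symm)
  have h6 := hσ.le x _ h12 hc h5
  rw [hρ.le_iff h1 h12 h12, hρ.self] at h6
  exact absurd (hτ.one_lt (σ x)) (not_lt.2 h6)

theorem IsStrictlyIncreasing.of_equiv (hρ : IsBorelCocycle F ρ) (φ : X ≃ X)
    (h : ∀ x, F x (φ x)) (h1 : ∀ x, 1 < ρ (φ x) x) : IsStrictlyIncreasing F ρ φ where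
  graph := h
  lt_one x := by
    have h2 : φ ⁻¹' {x} = {φ.symm x} := by
      ext y
      simp [Equiv.eq_symm_apply]
    have h3 := h1 (φ.symm x)
    have h4 := h (φ.symm x)
    rw [Equiv.apply_symm_apply] at h3 h4
    rw [h2, size_singleton, ENNReal.ofReal_lt_one]
    exact (hρ.lt_one_iff h4).2 h3

variable [StandardBorelSpace X]

theorem IsCountableBorel.exists_isNext (hF : IsCountableBorel F) (hρ : IsBorelCocycle F ρ)
    (hm : Measurable fun p : X × X => ρ p.1 p.2) {ι : X → ℕ} (hι : Measurable ι)
    (hfin : ∀ k, IsLocallyFinite F ρ (ι ⁻¹' {k}))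
    (hup : ∀ x, ∃ y, F x y ∧ ι y = ι x ∧ 1 < ρ y x) : ∃ σ, Measurable σ ∧ IsNext F ρ ι σ := by
  obtain ⟨σ, hσ, h⟩ := hF.exists_argmin hm (P := fun x y => ι y = ι x ∧ 1 < ρ y x) (by fun_prop)
    hup (fun x b => ((hfin (ι x)).finite_of_le hρ x b).subset
      fun y hy => ⟨hy.1, ⟨hy.2.1.1, hy.2.1.2.le⟩, hy.2.2⟩)
  exact ⟨σ, hσ, fun x => (h x).1, fun x => (h x).2.1.1, fun x => (h x).2.1.2,
    fun x y h1 h2 h3 => (h x).2.2 y h1 ⟨h2, h3⟩⟩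

theorem IsCountableBorel.exists_automorphism_of_coloring (hF : IsCountableBorel F)
    (hρ : IsBorelCocycle F ρ) (hm : Measurable fun p : X × X => ρ p.1 p.2) {ι : X → ℕ}
    (hι : Measurable ι) (hfin : ∀ k, IsLocallyFinite F ρ (ι ⁻¹' {k}))
    (htie : ∀ x y, F x y → ι x = ι y → ρ x y = 1 → x = y)
    (hup : ∀ x, ∃ y, F x y ∧ ι y = ι x ∧ 1 < ρ y x)
    (hdown : ∀ x, ∃ y, F x y ∧ ι y = ι x ∧ 1 < ρ x y) :
    ∃ φ : X ≃ᵐ X, IsStrictlyIncreasing F ρ φ := by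
  obtain ⟨σ, hσm, hσ⟩ := hF.exists_isNext hρ hm hι hfin hup
  obtain ⟨τ, hτm, hτ⟩ := hF.exists_isNext hρ.swap (hm.comp measurable_swap) hι
    (fun k => (hfin k).swap) hdown
  refine ⟨⟨⟨σ, τ, hσ.leftInverse hρ hτ htie, hτ.leftInverse hρ.swap hσ
    fun x y h1 h2 h3 => (htie y x (F.symm h1) h2.symm h3).symm⟩, hσm, hτm⟩,
    .of_equiv hρ _ hσ.rel hσ.one_lt⟩

end Automorphism

/-! ### Rounding down to a locally finite set -/

section Floor

variable {X : Type*} [MeasurableSpace X] {F : Setoid X} {ρ : X → X → ℝ}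

/-- `L` is unbounded above on every class. -/
def IsCofinal (F : Setoid X) (ρ : X → X → ℝ) (L : Set X) : Prop :=
  ∀ x, ∀ b : ℝ, ∃ v ∈ L, F x v ∧ b < ρ v x

/-- `L` has no two points of the same size in a class. -/
def IsTieFree (F : Setoid X) (ρ : X → X → ℝ) (L : Set X) : Prop :=
  ∀ v ∈ L, ∀ w ∈ L, F v w → ρ v w = 1 → v = w

/-- `π` maps every point to a largest point of `L` that is not larger. -/
structure IsFloor (F : Setoid X) (ρ : X → X → ℝ) (L : Set X) (π : X → X) : Prop where
  rel : ∀ x, F x (π x)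
  mem : ∀ x, π x ∈ L
  le_one : ∀ x, ρ (π x) x ≤ 1
  le : ∀ x, ∀ y ∈ L, F x y → ρ y x ≤ 1 → ρ x (π x) ≤ ρ x y

theorem IsFloor.eq_of_tie (hρ : IsBorelCocycle F ρ) {L : Set X} {π : X → X}
    (hπ : IsFloor F ρ L π) (hL : IsTieFree F ρ L) {x y : X} (h : F x y) (h1 : ρ x y = 1) :
    π x = π y := by
  have h1' : ρ y x = 1 := by have := hρ.mul_swap h; rwa [h1, one_mul] at this
  have hyx := F.trans (F.symm h) (hπ.rel x)
  have hxy := F.trans h (hπ.rel y)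
  have e1 : ρ (π x) y = ρ (π x) x := by
    rw [hρ.mul (π x) x y (F.symm (hπ.rel x)) h, h1, mul_one]
  have e2 : ρ (π y) x = ρ (π y) y := by
    rw [hρ.mul (π y) y x (F.symm (hπ.rel y)) (F.symm h), h1', mul_one]
  have h2 := hπ.le y (π x) (hπ.mem x) hyx (e1 ▸ hπ.le_one x)
  have h3 := hπ.le x (π y) (hπ.mem y) hxy (e2 ▸ hπ.le_one y)
  rw [hρ.mul x y (π y) h (hπ.rel y), h1, one_mul] at h3
  rw [hρ.mul y x (π x) (F.symm h) (hπ.rel x), h1', one_mul] at h2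
  refine hL _ (hπ.mem x) _ (hπ.mem y) (F.trans (F.symm (hπ.rel x)) hxy) ?_
  rw [hρ.mul (π x) x (π y) (F.symm (hπ.rel x)) hxy, hρ.mul x y (π y) h (hπ.rel y), h1, one_mul,
    le_antisymm h2 h3]
  exact hρ.mul_swap (F.symm (hπ.rel x))

theorem IsFloor.eq_self (hρ : IsBorelCocycle F ρ) {L : Set X} {π : X → X}
    (hπ : IsFloor F ρ L π) (hL : IsTieFree F ρ L) {x : X} (hx : x ∈ L) : π x = x := by
  have h := hπ.rel x
  refine hL _ (hπ.mem x) _ hx (F.symm h) (le_antisymm (hπ.le_one x) ?_)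
  rw [← hρ.le_one_iff h]
  simpa [hρ.self] using hπ.le x x hx (F.refl x) (hρ.self x).le

/-- A set with at most one point over each value of `π` is locally finite. -/
theorem IsFloor.isLocallyFinite (hρ : IsBorelCocycle F ρ) {L : Set X} {π : X → X}
    (hπ : IsFloor F ρ L π) (hLf : IsLocallyFinite F ρ L)
    (hdown : IsCofinal F (fun x y => ρ y x) L) {S : Set X}
    (hS : ∀ x ∈ S, ∀ y ∈ S, F x y → π x = π y → x = y) : IsLocallyFinite F ρ S := by
  intro x b
  obtain ⟨w, hw, hxw, hbw⟩ := hdown x b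
  refine Set.Finite.of_injOn (f := π) ?_ ?_ (hLf x (max b (ρ x w)))
  · rintro p ⟨hp, -, h1, h2⟩
    have hpw := F.trans (F.symm hp) hxw
    have p0 := hρ.pos _ _ hp
    have p1 := hρ.pos _ _ (F.symm hp)
    have h3 : ρ w p ≤ 1 := by
      rw [hρ.mul w x p (F.symm hxw) hp]
      have := hρ.mul_swap hxw
      have := hρ.pos _ _ (F.symm hxw)
      nlinarith
    have h4 := hπ.le p w hw hpw h3
    refine ⟨F.trans hp (hπ.rel p), hπ.mem p, le_trans ?_ (le_max_left _ _),
      le_trans ?_ (le_max_right _ _)⟩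
    · rw [hρ.mul (π p) p x (F.symm (hπ.rel p)) (F.symm hp)]
      have := hπ.le_one p
      nlinarith
    · rw [hρ.mul x p (π p) hp (hπ.rel p), hρ.mul x p w hp hpw]
      exact mul_le_mul_of_nonneg_left h4 p0.le
  · rintro p ⟨hp, hpS, -⟩ q ⟨hq, hqS, -⟩ h
    exact hS p hpS q hqS (F.trans (F.symm hp) hq) h

/-- Orbits of a function that increases size are unbounded along any injective sequence of times. -/
theorem IsLocallyFinite.exists_lt_iterate (hρ : IsBorelCocycle F ρ) {L : Set X}
    (hLf : IsLocallyFinite F ρ L) {σ : X → X} (hσ : ∀ x, F x (σ x)) (hσL : ∀ x, σ x ∈ L)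
    (h1 : ∀ x, 1 < ρ (σ x) x) {o : X} (ho : o ∈ L) {e : ℕ → ℕ} (he : e.Injective) (b : ℝ) :
    (StrictMono fun j => ρ (σ^[j] o) o) ∧ (∀ j, F o (σ^[j] o)) ∧ (∀ j, σ^[j] o ∈ L) ∧
      ∃ i, b < ρ (σ^[e i] o) o := by
  have hrel : ∀ j, F o (σ^[j] o) := by
    intro j
    induction j with
    | zero => exact F.refl o
    | succ j ih => rw [Function.iterate_succ_apply']; exact F.trans ih (hσ _)
  have hmem : ∀ j, σ^[j] o ∈ L := by
    rintro (_ | j)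
    · exact ho
    · rw [Function.iterate_succ_apply']; exact hσL _
  have hmono : StrictMono fun j => ρ (σ^[j] o) o := by
    refine strictMono_nat_of_lt_succ fun j => ?_
    rw [Function.iterate_succ_apply', hρ.mul _ (σ^[j] o) o (F.symm (hσ _)) (F.symm (hrel j))]
    have := hρ.pos _ _ (F.symm (hrel j))
    have := h1 (σ^[j] o)
    nlinarith
  refine ⟨hmono, hrel, hmem, ?_⟩
  by_contra! hb
  refine Set.infinite_of_injective_forall_mem (f := fun i => σ^[e i] o) ?_ ?_
    (hLf.finite_of_le hρ o b)
  · intro i j hij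
    exact he (hmono.injective (congrArg (fun x => ρ x o) hij))
  · intro i
    refine ⟨hrel _, ⟨hmem _, ?_⟩, hb i⟩
    have := hmono.monotone (Nat.zero_le (e i))
    simpa [hρ.self] using this

variable [StandardBorelSpace X]

theorem IsCountableBorel.exists_isFloor (hF : IsCountableBorel F) (hρ : IsBorelCocycle F ρ)
    (hm : Measurable fun p : X × X => ρ p.1 p.2) {L : Set X} (hL : MeasurableSet L)
    (hLf : IsLocallyFinite F ρ L) (hdown : IsCofinal F (fun x y => ρ y x) L) :
    ∃ π, Measurable π ∧ IsFloor F ρ L π := by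
  have hLm : Measurable fun x => x ∈ L := hL.mem
  obtain ⟨π, hπ, h⟩ := hF.exists_argmin (ρ := fun x y => ρ y x) (hm.comp measurable_swap)
    (P := fun x y => y ∈ L ∧ ρ y x ≤ 1) (by fun_prop) (fun x => by
      obtain ⟨v, hv, hxv, h1⟩ := hdown x 1
      exact ⟨v, hxv, hv, (hρ.le_one_iff (F.symm hxv)).2 h1.le⟩)
    (fun x b => (hLf.swap.finite_of_le hρ.swap x b).subset fun y hy =>
      ⟨hy.1, ⟨hy.2.1.1, (hρ.le_one_iff (F.symm hy.1)).1 hy.2.1.2⟩, hy.2.2⟩)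
  exact ⟨π, hπ, fun x => (h x).1, fun x => (h x).2.1.1, fun x => (h x).2.1.2,
    fun x y h1 h2 h3 => (h x).2.2 y h2 ⟨h1, h3⟩⟩

/-- Points of `L` of equal size in one class are finitely many, so the one with the least real code
can be kept. -/
theorem IsLocallyFinite.exists_isTieFree (hF : IsCountableBorel F) (hρ : IsBorelCocycle F ρ)
    (hm : Measurable fun p : X × X => ρ p.1 p.2) {L : Set X} (hL : MeasurableSet L)
    (hLf : IsLocallyFinite F ρ L) :
    ∃ K ⊆ L, MeasurableSet K ∧ IsTieFree F ρ K ∧ ∀ v ∈ L, ∃ w ∈ K, F v w ∧ ρ w v = 1 := by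
  have he := (measurableEmbedding_embeddingReal X).measurable
  have hi := (measurableEmbedding_embeddingReal X).injective
  generalize embeddingReal X = e at he hi
  have hLm : Measurable fun x => x ∈ L := hL.mem
  refine ⟨{v | v ∈ L ∧ ∀ w, F v w → w ∈ L → ρ w v = 1 → e v ≤ e w}, fun v hv => hv.1, ?_, ?_,
    fun v hv => ?_⟩
  · simp only [hF.forall_iff]
    exact measurableSet_setOfPred.2 (by fun_prop)
  · intro v hv w hw hvw h1
    have h2 : ρ w v = 1 := by have := hρ.mul_swap hvw; rwa [h1, one_mul] at this
    exact hi (le_antisymm (hv.2 w hvw hw.1 h2) (hw.2 v (F.symm hvw) hv.1 h1))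
  · obtain ⟨w, ⟨hw, hwL, h1⟩, hmin⟩ := exists_min_image {w | F v w ∧ w ∈ L ∧ ρ w v = 1} e
      ((hLf v 1).subset fun w hw => ⟨hw.1, hw.2.1, hw.2.2.le,
        (hρ.le_one_iff hw.1).2 hw.2.2.ge⟩) ⟨v, F.refl v, hv, hρ.self v⟩
    refine ⟨w, ⟨hwL, fun u hu huL hu1 => hmin u ⟨F.trans hw hu, huL, ?_⟩⟩, hw, h1⟩
    rw [hρ.mul u w v (F.symm hu) (F.symm hw), hu1, h1, one_mul]

end Floor

/-! ### Automorphisms from a locally finite set unbounded on both sides -/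

section Automorphism

variable {X : Type*} [MeasurableSpace X] [StandardBorelSpace X] {F : Setoid X} {ρ : X → X → ℝ}

/-- On the classes with a distinguished point, a Borel colouring of `L` each of whose colours is
unbounded on both sides. -/
theorem exists_coloring_isCofinal_of_basepoint (hF : IsCountableBorel F) (hρ : IsBorelCocycle F ρ)
    (hm : Measurable fun p : X × X => ρ p.1 p.2) {L : Set X} (hL : MeasurableSet L)
    (hLf : IsLocallyFinite F ρ L) (hup : IsCofinal F ρ L)
    (hdown : IsCofinal F (fun x y => ρ y x) L) {o : X → X} (ho : Measurable o)
    (hFo : ∀ x, F x (o x)) (hoL : ∀ x, o x ∈ L) :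
    ∃ κ : X → ℕ, Measurable κ ∧ ∀ x, (∀ y, F x y → o x = o y) → ∀ c, ∀ b : ℝ,
      (∃ v ∈ L, F x v ∧ κ v = c ∧ b < ρ v x) ∧ ∃ v ∈ L, F x v ∧ κ v = c ∧ b < ρ x v := by
  have hLm : Measurable fun x => x ∈ L := hL.mem
  obtain ⟨σ, hσm, hσ⟩ := hF.exists_select (P := fun x y => y ∈ L ∧ 1 < ρ y x) (by fun_prop)
    fun x => by obtain ⟨v, h1, h2, h3⟩ := hup x 1; exact ⟨v, h2, h1, h3⟩
  obtain ⟨τ, hτm, hτ⟩ := hF.exists_select (P := fun x y => y ∈ L ∧ 1 < ρ x y) (by fun_prop)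
    fun x => by obtain ⟨v, h1, h2, h3⟩ := hdown x 1; exact ⟨v, h2, h1, h3⟩
  have hσi : ∀ j, Measurable σ^[j] := fun j => hσm.iterate j
  have hτi : ∀ j, Measurable τ^[j] := fun j => hτm.iterate j
  -- From the distinguished point, `σ` climbs and `τ` descends inside `L`, both without bound. The
  -- time at which a point is reached is unique, since the two orbits meet only at time `0`.
  let J : X → ℕ → Prop := fun x j => σ^[j] (o x) = x ∨ τ^[j] (o x) = x
  have hJm : ∀ j, Measurable fun x => J x j := fun j =>
    Measurable.or (Measurable.eq (by fun_prop) measurable_id)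
      (Measurable.eq (by fun_prop) measurable_id)
  obtain ⟨j, hjm, hj⟩ := exists_measurable_least (P := fun x j => J x j ∨ ∀ i, ¬ J x i)
    (by fun_prop) fun x => by
      by_cases h : ∃ i, J x i
      · exact h.imp fun i hi => Or.inl hi
      · exact ⟨0, Or.inr (not_exists.1 h)⟩
  have key := fun x {e : ℕ → ℕ} (he : e.Injective) b => hLf.exists_lt_iterate hρ
    (fun x => (hσ x).1) (fun x => (hσ x).2.1) (fun x => (hσ x).2.2) (hoL x) he b
  have key' := fun x {e : ℕ → ℕ} (he : e.Injective) b => hLf.swap.exists_lt_iterate hρ.swap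
    (fun x => (hτ x).1) (fun x => (hτ x).2.1) (fun x => (hτ x).2.2) (hoL x) he b
  have huniq : ∀ x i k, J x i → J x k → i = k := by
    intro x i k hi hk
    obtain ⟨hs, hsr, -⟩ := key x Function.injective_id 0
    obtain ⟨ht, htr, -⟩ := key' x Function.injective_id 0
    have aux : ∀ i k, σ^[i] (o x) = x → τ^[k] (o x) = x → i = k := by
      intro i k h1 h2
      have h3 := hs.monotone (Nat.zero_le i)
      have h4 := ht.monotone (Nat.zero_le k)
      have h5 := hρ.mul_swap (F.symm (hFo x))
      simp only [h1, h2, Function.iterate_zero, id, hρ.self] at h3 h4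
      have p1 := hρ.pos _ _ (hFo x)
      have h6 : ρ x (o x) = 1 := by nlinarith
      have h7 : ρ (o x) x = 1 := by nlinarith
      have h8 : i = 0 := hs.injective (by simp [h1, h6, hρ.self])
      have h9 : k = 0 := ht.injective (by simp [h2, h7, hρ.self])
      rw [h8, h9]
    rcases hi with hi | hi <;> rcases hk with hk | hk
    · exact hs.injective (by simp only [hi, hk])
    · exact aux i k hi hk
    · exact (aux k i hk hi).symm
    · exact ht.injective (by simp only [hi, hk])
  have hjeq : ∀ x i, J x i → j x = i := fun x i hi => by
    rcases (hj x).1 with h | h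
    · exact huniq x _ _ h hi
    · exact absurd hi (h i)
  -- Each colour `c` is attained at the infinitely many times `Nat.pair c i`, on the climbing orbit
  -- and on the descending one.
  refine ⟨fun x => (Nat.unpair (j x)).1, (measurable_of_countable fun n => (Nat.unpair n).1).comp hjm,
    fun x hx c b => ?_⟩
  have he : Function.Injective fun i => Nat.pair c i := fun i k h => (Nat.pair_eq_pair.1 h).2
  constructor
  · obtain ⟨-, hr, hmem, i, hi⟩ := key x he (b * ρ x (o x))
    have hxr := F.trans (hFo x) (hr (Nat.pair c i))
    refine ⟨σ^[Nat.pair c i] (o x), hmem _, hxr, ?_, ?_⟩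
    · dsimp only
      rw [hjeq _ (Nat.pair c i) (Or.inl (by rw [← hx _ hxr])), Nat.unpair_pair]
    · rw [hρ.mul _ x (o x) (F.symm hxr) (hFo x)] at hi
      exact lt_of_mul_lt_mul_right hi (hρ.pos _ _ (hFo x)).le
  · obtain ⟨-, hr, hmem, i, hi⟩ := key' x he (b * ρ (o x) x)
    have hxr := F.trans (hFo x) (hr (Nat.pair c i))
    refine ⟨τ^[Nat.pair c i] (o x), hmem _, hxr, ?_, ?_⟩
    · dsimp only
      rw [hjeq _ (Nat.pair c i) (Or.inr (by rw [← hx _ hxr])), Nat.unpair_pair]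
    · rw [hρ.mul (o x) x _ (F.symm (hFo x)) hxr, mul_comm (ρ (o x) x)] at hi
      exact lt_of_mul_lt_mul_right hi (hρ.pos _ _ (F.symm (hFo x))).le

/-- A locally finite set that is unbounded on both sides on every class yields a strictly
increasing Borel automorphism. -/
theorem IsLocallyFinite.exists_automorphism (hF : IsCountableBorel F) (hρ : IsBorelCocycle F ρ)
    (hm : Measurable fun p : X × X => ρ p.1 p.2) {K : Set X} (hK : MeasurableSet K)
    (hKf : IsLocallyFinite F ρ K) (hKup : IsCofinal F ρ K)
    (hKdown : IsCofinal F (fun x y => ρ y x) K) :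
    ∃ φ : X ≃ᵐ X, IsStrictlyIncreasing F ρ φ := by
  classical
  obtain ⟨L, hLK, hL, htie, hLK'⟩ := hKf.exists_isTieFree hF hρ hm hK
  have hLf := hKf.mono hLK
  have hup : IsCofinal F ρ L := fun x b => by
    obtain ⟨v, hv, hxv, hb⟩ := hKup x b
    obtain ⟨w, hw, hvw, h1⟩ := hLK' v hv
    refine ⟨w, hw, F.trans hxv hvw, ?_⟩
    rwa [hρ.mul w v x (F.symm hvw) (F.symm hxv), h1, one_mul]
  have hdown : IsCofinal F (fun x y => ρ y x) L := fun x b => by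
    obtain ⟨v, hv, hxv, hb⟩ := hKdown x b
    obtain ⟨w, hw, hvw, h1⟩ := hLK' v hv
    have h2 := hρ.mul_swap hvw
    rw [h1, mul_one] at h2
    refine ⟨w, hw, F.trans hxv hvw, ?_⟩
    dsimp only at hb ⊢
    rwa [hρ.mul x v w hxv hvw, h2, mul_one]
  have hLm : Measurable fun x => x ∈ L := hL.mem
  obtain ⟨π, hπm, hπ⟩ := hF.exists_isFloor hρ hm hL hLf hdown
  obtain ⟨idx, hidx, hidx'⟩ := hF.exists_index
  -- A first colouring, by the position in the enumeration from the floor. Points with the same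
  -- floor get different colours, so each colour is locally finite and has no ties; it may still be
  -- bounded on a side.
  obtain ⟨k, hkm, hk⟩ : ∃ k : X → ℕ, Measurable k ∧ ∀ x y, π x = π y → k x = k y → x = y := by
    refine ⟨fun x => idx (π x) x, by fun_prop, fun x y h1 h2 => ?_⟩
    dsimp only at h2
    rw [← hidx' (π x) x (F.symm (hπ.rel x)), ← hidx' (π y) y (F.symm (hπ.rel y)), h2, h1]
  let G : X → ℕ → Prop := fun x c =>
    (∀ n : ℕ, ∃ y, F x y ∧ (k y = c ∧ n < ρ y x)) ∧ ∀ n : ℕ, ∃ y, F x y ∧ (k y = c ∧ n < ρ x y)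
  have hGm : ∀ c, Measurable fun x => G x c := fun c => by
    simp only [G, hF.exists_iff]
    fun_prop
  have hG : ∀ x y c, F x y → G x c → G y c := by
    rintro x y c hxy ⟨h1, h2⟩
    constructor <;> intro n
    · obtain ⟨m, hmn⟩ := exists_nat_ge (n * ρ y x)
      obtain ⟨z, hz, hzc, hzn⟩ := h1 m
      have h := F.trans (F.symm hxy) hz
      refine ⟨z, h, hzc, lt_of_mul_lt_mul_right ?_ (hρ.pos y x (F.symm hxy)).le⟩
      rw [← hρ.mul z y x (F.symm h) (F.symm hxy)]
      exact hmn.trans_lt hzn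
    · obtain ⟨m, hmn⟩ := exists_nat_ge (ρ x y * n)
      obtain ⟨z, hz, hzc, hzn⟩ := h2 m
      have h := F.trans (F.symm hxy) hz
      refine ⟨z, h, hzc, lt_of_mul_lt_mul_left ?_ (hρ.pos x y hxy).le⟩
      rw [← hρ.mul x y z hxy h]
      exact hmn.trans_lt hzn
  let D : X → ℕ → Prop := fun x c => (∃ y, F x y ∧ k y = c) ∧ ¬ G x c
  have hDm : ∀ c, Measurable fun x => D x c := fun c => by
    simp only [D, hF.exists_iff]
    fun_prop
  have hD : ∀ x y c, F x y → D x c → D y c := by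
    rintro x y c hxy ⟨⟨z, hz, hzc⟩, h⟩
    exact ⟨⟨z, F.trans (F.symm hxy) hz, hzc⟩, fun h' => h (hG _ _ _ (F.symm hxy) h')⟩
  -- The least defective colour of a class, one that occurs but is bounded on a side, marks a
  -- locally finite set with a one-sided bound. This gives a distinguished point in every class with
  -- a defect.
  let V : Set X := {x | D x (k x) ∧ ∀ c, c < k x → ¬ D x c}
  have hV : MeasurableSet V := by
    have hDk : Measurable fun p : ℕ × X => D p.2 p.1 := measurable_from_prod_countable_right hDm
    exact measurableSet_setOfPred.2 ((hDk.comp (hkm.prodMk measurable_id)).and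
      (Measurable.forall fun c => Measurable.imp (by fun_prop) (hDm c).not))
  have hVk : ∀ x ∈ V, ∀ y ∈ V, F x y → k x = k y := by
    rintro x ⟨hx, hx'⟩ y ⟨hy, hy'⟩ hxy
    rcases lt_trichotomy (k x) (k y) with h | h | h
    · exact absurd (hD _ _ _ hxy hx) (hy' _ h)
    · exact h
    · exact absurd (hD _ _ _ (F.symm hxy) hy) (hx' _ h)
  obtain ⟨Y, hYV, hYm, hYt, hY⟩ := IsLocallyFinite.exists_transversal hF hρ hm hV
    (hπ.isLocallyFinite hρ hLf hdown fun x hx y hy hxy h => hk x y h (hVk x hx y hy hxy))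
    (fun x hx => by
      have h := hx.1.2
      simp only [G, not_and_or] at h
      push Not at h
      rcases h with ⟨n, hn⟩ | ⟨n, hn⟩
      · exact Or.inl ⟨n, fun v hv hxv => hn v hxv (hVk v hv x hx (F.symm hxv))⟩
      · exact Or.inr ⟨n, fun v hv hxv => hn v hxv (hVk v hv x hx (F.symm hxv))⟩)
  let Bad : X → Prop := fun x => ∃ c, D x c
  have hBadm : Measurable Bad := by fun_prop
  have hBad : ∀ x y, F x y → Bad x → Bad y := fun x y hxy h => h.imp fun c => hD x y c hxy
  have hBadY : ∀ x, Bad x → ∃ y, F x y ∧ y ∈ Y := by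
    intro x hx
    obtain ⟨v, hv, hkv⟩ := (Nat.find_spec hx).1
    obtain ⟨y, hy, hvy⟩ := hY v ⟨hkv ▸ hD _ _ _ hv (Nat.find_spec hx), fun c hc h =>
      Nat.find_min hx (hkv ▸ hc) (hD _ _ _ (F.symm hv) h)⟩
    exact ⟨y, F.trans hv hvy, hy⟩
  have hYm' : Measurable fun x => x ∈ Y := hYm.mem
  obtain ⟨o, hom, ho⟩ := hF.exists_select (P := fun x y => Bad x → y ∈ Y) (by fun_prop) fun x => by
    by_cases h : Bad x
    · exact (hBadY x h).imp fun y hy => ⟨hy.1, fun _ => hy.2⟩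
    · exact ⟨x, F.refl x, fun h' => absurd h' h⟩
  have hoeq : ∀ x y, F x y → Bad x → o x = o y := fun x y hxy hx =>
    hYt _ ((ho x).2 hx) _ ((ho y).2 (hBad _ _ hxy hx))
      (F.trans (F.symm (ho x).1) (F.trans hxy (ho y).1))
  obtain ⟨κ, hκm, hκ⟩ := exists_coloring_isCofinal_of_basepoint hF hρ hm hL hLf hup hdown
    (o := fun x => π (o x)) (by fun_prop) (fun x => F.trans (ho x).1 (hπ.rel _)) fun x => hπ.mem _
  -- On defective classes recolour `L` by `κ`, all of whose colours are unbounded on both sides. The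
  -- other points over a floor keep the colour `k`, shifted by one from `κ (π x)` on to leave that
  -- value to the floor itself.
  have hιBad : ∃ ι : X → ℕ, Measurable ι ∧ (∀ x, ¬ Bad x → ι x = k x) ∧
      (∀ x ∈ L, Bad x → ι x = κ x) ∧ ∀ x y, F x y → ι x = ι y → π x = π y → x = y := by
    refine ⟨fun x => if Bad x then (if x ∈ L then κ x else if k x < κ (π x) then k x else k x + 1)
      else k x, ?_, fun x hx => if_neg hx, fun x hx h => by simp [h, hx], fun x y hxy h1 h2 => ?_⟩
    · have hlt : Measurable fun x => k x < κ (π x) := by fun_prop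
      exact Measurable.ite (measurableSet_setOfPred.2 hBadm) (Measurable.ite hL hκm
        (Measurable.ite (measurableSet_setOfPred.2 hlt) hkm (by fun_prop))) hkm
    · by_cases hx : Bad x
      · have hy := hBad _ _ hxy hx
        simp only [hx, hy, if_true] at h1
        by_cases hxL : x ∈ L <;> by_cases hyL : y ∈ L
        · rwa [hπ.eq_self hρ htie hxL, hπ.eq_self hρ htie hyL] at h2
        · rw [hπ.eq_self hρ htie hxL] at h2
          rw [if_pos hxL, if_neg hyL, h2] at h1
          split_ifs at h1 <;> omega
        · rw [hπ.eq_self hρ htie hyL] at h2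
          rw [if_neg hxL, if_pos hyL, ← h2] at h1
          split_ifs at h1 <;> omega
        · rw [if_neg hxL, if_neg hyL, h2] at h1
          refine hk x y h2 ?_
          split_ifs at h1 <;> omega
      · have hy : ¬ Bad y := fun h => hx (hBad _ _ (F.symm hxy) h)
        simp only [hx, hy, if_false] at h1
        exact hk x y h2 h1
  obtain ⟨ι, hιm, hιk, hικ, hιπ⟩ := hιBad
  have hcof : ∀ x, ∃ y z, (F x y ∧ ι y = ι x ∧ 1 < ρ y x) ∧ F x z ∧ ι z = ι x ∧ 1 < ρ x z := by
    intro x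
    by_cases hx : Bad x
    · obtain ⟨⟨y, hyL, hy, hyc, hy1⟩, z, hzL, hz, hzc, hz1⟩ := hκ x
        (fun y hxy => by rw [hoeq x y hxy hx]) (ι x) 1
      exact ⟨y, z, ⟨hy, by rw [hικ y hyL (hBad _ _ hy hx), hyc], hy1⟩, hz,
        by rw [hικ z hzL (hBad _ _ hz hx), hzc], hz1⟩
    · have hb : ∀ y, F x y → ¬ Bad y := fun y hxy h => hx (hBad _ _ (F.symm hxy) h)
      have hg : G x (k x) := by
        by_contra hg
        exact hx ⟨k x, ⟨x, F.refl x, rfl⟩, hg⟩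
      obtain ⟨y, hy, hyk, hy1⟩ := hg.1 1
      obtain ⟨z, hz, hzk, hz1⟩ := hg.2 1
      rw [Nat.cast_one] at hy1 hz1
      exact ⟨y, z, ⟨hy, by rw [hιk y (hb y hy), hιk x hx, hyk], hy1⟩, hz,
        by rw [hιk z (hb z hz), hιk x hx, hzk], hz1⟩
  refine hF.exists_automorphism_of_coloring hρ hm hιm (fun c => ?_) (fun x y hxy h h1 => ?_)
    (fun x => ?_) (fun x => ?_)
  · refine hπ.isLocallyFinite hρ hLf hdown fun x hx y hy hxy h => hιπ x y hxy ?_ h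
    rw [mem_preimage.1 hx, mem_preimage.1 hy]
  · exact hιπ x y hxy h (hπ.eq_of_tie hρ htie hxy h1)
  · obtain ⟨y, z, h, -⟩ := hcof x; exact ⟨y, h⟩
  · obtain ⟨y, z, -, h⟩ := hcof x; exact ⟨z, h⟩

end Automorphism

/-! ### Restriction, and splitting off a smooth part -/

section Restrict

variable {X : Type*} {ρ : X → X → ℝ}

theorem size_restrictCocycle {B : Set X} (z : B) (S : Set B) :
    size (restrictCocycle ρ B) z S = size ρ z (Subtype.val '' S) :=
  (Equiv.Set.image Subtype.val S Subtype.val_injective).tsum_eq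
    fun y => ENNReal.ofReal (ρ y z)

variable [MeasurableSpace X] {F : Setoid X}

theorem IsBorelRel.restrict (hF : IsBorelRel F) (B : Set X) : IsBorelRel (restrictRel F B) :=
  hF.comap measurable_subtype_coe

theorem IsBorelCocycle.restrict (hρ : IsBorelCocycle F ρ) (B : Set X) :
    IsBorelCocycle (restrictRel F B) (restrictCocycle ρ B) where
  pos x y h := hρ.pos x y h
  mul x y z h h' := hρ.mul x y z h h'
  borel := Measurable.comp (f := fun p : {p : B × B // restrictRel F B p.1 p.2} =>
    (⟨(p.1.1, p.1.2), p.2⟩ : {p : X × X // F p.1 p.2})) hρ.borel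
    (Measurable.subtype_mk (by fun_prop))

theorem IsCountableBorel.restrict (hF : IsCountableBorel F) (B : Set X) :
    IsCountableBorel (restrictRel F B) :=
  ⟨hF.borel.restrict B, fun x => (hF.countable x).preimage Subtype.val_injective⟩

end Restrict

section Splitting

variable {X : Type*} [MeasurableSpace X] [StandardBorelSpace X] {E F : Setoid X} {ρ : X → X → ℝ}

/-- Outside the `E`-saturation `B` of the classes on which `V` is unbounded on both sides, every
trace of `V` is bounded on some side and has a transversal. Inside `B`, every point is attached to a
class of the unbounded kind. -/
theorem IsLocallyFinite.exists_splitting (hE : IsCountableBorel E) (hρ : IsBorelCocycle E ρ)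
    (hm : Measurable fun p : X × X => ρ p.1 p.2) (hFE : F ≤ E) (hFb : IsBorelRel F)
    (hap : IsAperiodic F ρ) {V : Set X} (hV : MeasurableSet V) (hVc : ∀ x, ∃ v ∈ V, F x v)
    (hVf : IsLocallyFinite F ρ V) :
    ∃ (B : Set X) (F' : Setoid X), MeasurableSet B ∧ IsInvariant E B ∧ F' ≤ E ∧ IsBorelRel F' ∧
      IsSmoothRel (restrictRel F' Bᶜ) ∧
      IsAperiodic (restrictRel F' Bᶜ) (restrictCocycle ρ Bᶜ) ∧
      ∃ φ : B ≃ᵐ B, IsStrictlyIncreasing (restrictRel F' B) (restrictCocycle ρ B) φ := by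
  have hF := hE.mono hFE hFb
  have hρF := hρ.mono hFE
  have hVm : Measurable fun x => x ∈ V := hV.mem
  let N : X → Prop := fun x => (∀ n : ℕ, ∃ v, F x v ∧ (v ∈ V ∧ n < ρ v x)) ∧
    ∀ n : ℕ, ∃ v, F x v ∧ (v ∈ V ∧ n < ρ x v)
  have hNm : Measurable N := by
    simp only [N, hF.exists_iff]
    fun_prop
  have hN : ∀ x y, F x y → N x → N y := by
    rintro x y hxy ⟨h1, h2⟩
    constructor <;> intro n
    · obtain ⟨m, hmn⟩ := exists_nat_ge (n * ρ y x)
      obtain ⟨z, hz, hzc, hzn⟩ := h1 m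
      have h := F.trans (F.symm hxy) hz
      refine ⟨z, h, hzc, lt_of_mul_lt_mul_right ?_ (hρF.pos y x (F.symm hxy)).le⟩
      rw [← hρF.mul z y x (F.symm h) (F.symm hxy)]
      exact hmn.trans_lt hzn
    · obtain ⟨m, hmn⟩ := exists_nat_ge (ρ x y * n)
      obtain ⟨z, hz, hzc, hzn⟩ := h2 m
      have h := F.trans (F.symm hxy) hz
      refine ⟨z, h, hzc, lt_of_mul_lt_mul_left ?_ (hρF.pos x y hxy).le⟩
      rw [← hρF.mul x y z hxy h]
      exact hmn.trans_lt hzn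
  let B : Set X := {x | ∃ y, E x y ∧ N y}
  have hB : MeasurableSet B := by
    simp only [B, hE.exists_iff]
    exact measurableSet_setOfPred.2 (by fun_prop)
  have hBm : Measurable fun x => x ∈ B := hB.mem
  have hBE : IsInvariant E B := by
    rintro x y hxy ⟨z, hz, hNz⟩
    exact ⟨z, E.trans (E.symm hxy) hz, hNz⟩
  have hNB : ∀ x, N x → x ∈ B := fun x hx => ⟨x, E.refl x, hx⟩
  -- `f` fixes the points of `V` satisfying `N`, so pulling `F` back along `f` neither merges nor
  -- splits their traces; off `B` it is the identity and leaves `F` unchanged.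
  obtain ⟨f, hf, hfP⟩ := hE.exists_select (P := fun x y => (x ∈ B → (y ∈ V ∧ N y) ∧
      (x ∈ V → N x → y = x)) ∧ (x ∉ B → y = x)) (by fun_prop) (fun x => by
    by_cases hx : x ∈ B
    · by_cases hxV : x ∈ V ∧ N x
      · exact ⟨x, E.refl x, fun _ => ⟨hxV, fun _ _ => rfl⟩, fun _ => rfl⟩
      · obtain ⟨y, hy, hNy⟩ := id hx
        obtain ⟨v, hv, hyv⟩ := hVc y
        exact ⟨v, E.trans hy (hFE hyv), fun _ => ⟨⟨hv, hN _ _ hyv hNy⟩,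
          fun h1 h2 => absurd ⟨h1, h2⟩ hxV⟩, fun h => absurd hx h⟩
    · exact ⟨x, E.refl x, fun h => absurd h hx, fun _ => rfl⟩)
  have hfE : ∀ x, E x (f x) := fun x => (hfP x).1
  have hfB : ∀ x ∈ B, f x ∈ V ∧ N (f x) := fun x hx => ((hfP x).2.1 hx).1
  have hfL : ∀ x ∈ V, N x → f x = x := fun x h1 h2 => ((hfP x).2.1 (hNB x h2)).2 h1 h2
  have hfc : ∀ x ∉ B, f x = x := fun x hx => (hfP x).2.2 hx
  have hFE' : F.comap f ≤ E := fun x y h =>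
    E.trans (hfE x) (E.trans (hFE (show F (f x) (f y) from h)) (E.symm (hfE y)))
  have hFb' : IsBorelRel (F.comap f) := hFb.comap hf
  have hcomp : ∀ x y, x ∉ B → ((F.comap f) x y ↔ F x y) := by
    intro x y hx
    constructor
    · intro h
      have hy : y ∉ B := fun hy => hx (hBE _ _ (E.symm (hFE' h)) hy)
      have h' : F (f x) (f y) := h
      rwa [hfc x hx, hfc y hy] at h'
    · intro h
      have hy : y ∉ B := fun hy => hx (hBE _ _ (E.symm (hFE h)) hy)
      change F (f x) (f y)
      rwa [hfc x hx, hfc y hy]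
  refine ⟨B, F.comap f, hB, hBE, hFE', hFb', ?_, ?_, ?_⟩
  · obtain ⟨Y, hYV, hYm, hYt, hY⟩ := IsLocallyFinite.exists_transversal hF hρF hm
      (hV.inter hB.compl) (hVf.mono inter_subset_left) (by
        rintro x ⟨hx, hxB⟩
        have h : ¬ N x := fun h => hxB (hNB x h)
        simp only [N, not_and_or] at h
        push Not at h
        rcases h with ⟨n, hn⟩ | ⟨n, hn⟩
        · exact Or.inl ⟨n, fun v hv hxv => hn v hxv hv.1⟩
        · exact Or.inr ⟨n, fun v hv hxv => hn v hxv hv.1⟩)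
    refine ⟨Subtype.val ⁻¹' Y, measurable_subtype_coe hYm, fun x => ?_, fun x hx y hy hxy => ?_⟩
    · obtain ⟨v, hv, hxv⟩ := hVc x
      have hvB : v ∉ B := fun h => x.2 (hBE _ _ (E.symm (hFE hxv)) h)
      obtain ⟨y, hy, hvy⟩ := hY v ⟨hv, hvB⟩
      exact ⟨⟨y, (hYV hy).2⟩, hy, (hcomp _ _ x.2).2 (F.trans hxv hvy)⟩
    · exact Subtype.ext (hYt _ hx _ hy ((hcomp _ _ x.2).1 hxy))
  · intro z
    rw [size_restrictCocycle, ← hap z]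
    congr 1
    ext y
    constructor
    · rintro ⟨w, hw, rfl⟩
      exact (hcomp _ _ w.2).1 hw
    · intro h
      have hy : y ∉ B := fun hy => z.2 (hBE _ _ (hFE h) hy)
      exact ⟨⟨y, hy⟩, (hcomp _ _ hy).2 h, rfl⟩
  · have := hB.standardBorel
    have hρ' := hρ.mono hFE'
    have hL : MeasurableSet (Subtype.val ⁻¹' {x | x ∈ V ∧ N x} : Set B) :=
      measurable_subtype_coe (hV.inter (measurableSet_setOfPred.2 hNm))
    have hcof : ∀ x : B, ∀ v, F (f x) v → N v ∧ v ∈ B := fun x v h => by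
      have := hN _ _ h (hfB x x.2).2
      exact ⟨this, hNB v this⟩
    have hrel : ∀ x : B, ∀ v : B, F (f x) v → v.1 ∈ V → (restrictRel (F.comap f) B) x v := by
      intro x v h hv
      change F (f x) (f v)
      rwa [hfL v hv (hcof x v h).1]
    refine IsLocallyFinite.exists_automorphism ((hE.mono hFE' hFb').restrict B) (hρ'.restrict B)
      (hm.comp (by fun_prop : Measurable fun p : B × B => (p.1.1, p.2.1))) hL ?_ ?_ ?_
    · intro x b
      refine ((hVf (f x) (max (b * ρ x (f x)) (ρ (f x) x * b))).preimage
        Subtype.val_injective.injOn).subset ?_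
      rintro v ⟨hv, ⟨hvV, hvN⟩, h1, h2⟩
      have hxv : F (f x) v := by
        have h' : F (f x) (f v) := hv
        rwa [hfL v hvV hvN] at h'
      have hvf := E.symm (hFE hxv)
      refine ⟨hxv, hvV, le_trans ?_ (le_max_left _ _), le_trans ?_ (le_max_right _ _)⟩
      · rw [hρ.mul v x (f x) (E.trans hvf (E.symm (hfE x))) (hfE x)]
        exact mul_le_mul_of_nonneg_right h1 (hρ.pos _ _ (hfE x)).le
      · rw [hρ.mul (f x) x v (E.symm (hfE x)) (E.trans (hfE x) (E.symm hvf))]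
        exact mul_le_mul_of_nonneg_left h2 (hρ.pos _ _ (E.symm (hfE x))).le
    · intro x b
      obtain ⟨n, hn⟩ := exists_nat_ge (b * ρ x (f x))
      obtain ⟨v, hv, hvV, hvn⟩ := (hfB x x.2).2.1 n
      refine ⟨⟨v, (hcof x v hv).2⟩, ⟨hvV, (hcof x v hv).1⟩, hrel x ⟨v, _⟩ hv hvV, ?_⟩
      rw [hρ.mul v x (f x) (E.trans (E.symm (hFE hv)) (E.symm (hfE x))) (hfE x)] at hvn
      exact lt_of_mul_lt_mul_right (hn.trans_lt hvn) (hρ.pos _ _ (hfE x)).le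
    · intro x b
      obtain ⟨n, hn⟩ := exists_nat_ge (ρ (f x) x * b)
      obtain ⟨v, hv, hvV, hvn⟩ := (hfB x x.2).2.2 n
      refine ⟨⟨v, (hcof x v hv).2⟩, ⟨hvV, (hcof x v hv).1⟩, hrel x ⟨v, _⟩ hv hvV, ?_⟩
      rw [hρ.mul (f x) x v (E.symm (hfE x)) (E.trans (hfE x) (hFE hv))] at hvn
      exact lt_of_mul_lt_mul_left (hn.trans_lt hvn) (hρ.pos _ _ (E.symm (hfE x))).le

end Splitting

/-! ### Quotient cocycles and lifts of compressions -/

section SizeFinite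

variable {X : Type*} {ρ : X → X → ℝ}

theorem size_lt_top {z : X} {Y : Set X} (hY : Y.Finite) : size ρ z Y < ∞ := by
  have := hY.fintype
  rw [size, tsum_fintype]
  exact ENNReal.sum_lt_top.2 fun _ _ => ENNReal.ofReal_lt_top

theorem size_union {z : X} {Y Y' : Set X} (h : Disjoint Y Y') :
    size ρ z (Y ∪ Y') = size ρ z Y + size ρ z Y' :=
  ENNReal.summable.tsum_union_disjoint (f := fun y => ENNReal.ofReal (ρ y z)) h ENNReal.summable

theorem ofReal_le_size {z y : X} {Y : Set X} (h : y ∈ Y) :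
    ENNReal.ofReal (ρ y z) ≤ size ρ z Y := by
  rw [← size_singleton]
  exact size_mono (singleton_subset_iff.2 h)

theorem size_empty {z : X} : size ρ z ∅ = 0 :=
  tsum_empty

end SizeFinite

section Lift

variable {X : Type*} {E F : Setoid X} {ρ : X → X → ℝ}

/-- `h` lifts an injective compression of the quotient `ρ / F`. -/
structure IsLift (E F : Setoid X) (ρ : X → X → ℝ) (h : X → X) : Prop where
  rel : ∀ x, E x (h x)
  rel_iff : ∀ x y, F (h x) (h y) ↔ F x y
  le : ∀ x, size ρ x {y | F x y} ≤ size ρ x {y | F (h x) y}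
  complete : ∀ x, ∃ a, E x a ∧ ∀ y, F (h y) a → size ρ a {z | F y z} < size ρ a {z | F a z}

theorem quotientRel_mk (hFE : F ≤ E) (x y : X) :
    quotientRel E F hFE (Quotient.mk F x) (Quotient.mk F y) ↔ E x y := by
  constructor
  · rintro ⟨a, b, h, ha, hb⟩
    exact E.trans (E.symm (hFE (Quotient.exact ha))) (E.trans h (hFE (Quotient.exact hb)))
  · exact fun h => ⟨x, y, h, rfl, rfl⟩

theorem size_class_ne_top (hfin : IsFiniteRel F) (y z : X) : size ρ z {w | F y w} ≠ ∞ :=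
  (size_lt_top ((hfin y).subset fun _ hw => F.symm hw)).ne

variable [MeasurableSpace X]

/-- A change of reference point multiplies both sizes by the same positive factor, so the chosen
representative of the quotient class does not matter. -/
theorem ofReal_quotientCocycle (hρ : IsBorelCocycle E ρ) (hFE : F ≤ E) (hfin : IsFiniteRel F)
    {x y z : X} (hxy : E x y) (hyz : E y z) :
    ENNReal.ofReal (quotientCocycle F ρ (Quotient.mk F x) (Quotient.mk F y)) =
      size ρ z {w | F x w} / size ρ z {w | F y w} := by
  have hcls : ∀ x, {w | Quotient.mk F w = Quotient.mk F x} = {w | F x w} := fun x => by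
    ext w
    exact ⟨fun h => F.symm (Quotient.exact h), fun h => Quotient.sound (F.symm h)⟩
  have hfin' : ∀ x, {w | F x w}.Finite := fun x =>
    (hfin x).subset fun w hw => F.symm hw
  have ho : F (Quotient.mk F y).out y := Quotient.mk_out y
  set o := (Quotient.mk F y).out
  have hoy := hFE ho
  have hyo := E.symm hoy
  have hpos : size ρ o {w | F y w} ≠ 0 := by
    refine (lt_of_lt_of_le ?_ (ofReal_le_size (F.refl y))).ne'
    exact ENNReal.ofReal_pos.2 (hρ.pos _ _ hyo)
  rw [quotientCocycle, hcls, hcls, ENNReal.ofReal_toReal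
    (ENNReal.div_lt_top (size_lt_top (hfin' x)).ne hpos).ne]
  have hoz := E.trans hoy hyz
  rw [hρ.size_mul hoz (Y := {w | F x w}) fun w hw => E.trans hoy (E.trans (E.symm hxy) (hFE hw)),
    hρ.size_mul hoz (Y := {w | F y w}) fun w hw => E.trans hoy (hFE hw)]
  rw [ENNReal.mul_div_mul_right _ _ (ENNReal.ofReal_pos.2 (hρ.pos _ _ hoz)).ne'
    ENNReal.ofReal_ne_top]

theorem size_quotientCocycle_preimage (hρ : IsBorelCocycle E ρ) (hFE : F ≤ E)
    (hfin : IsFiniteRel F) {φ : Quotient F → Quotient F} (hφ : φ.Injective) {x y : X}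
    (hxy : E x y) (h : φ (Quotient.mk F x) = Quotient.mk F y) :
    size (quotientCocycle F ρ) (Quotient.mk F y) (φ ⁻¹' {Quotient.mk F y}) =
      size ρ y {w | F x w} / size ρ y {w | F y w} := by
  have : φ ⁻¹' {Quotient.mk F y} = {Quotient.mk F x} := by
    ext a
    rw [mem_preimage, mem_singleton_iff, mem_singleton_iff, ← h, hφ.eq_iff]
  rw [this, size_singleton, ofReal_quotientCocycle hρ hFE hfin hxy (E.refl y)]

theorem size_class_pos (hρ : IsBorelCocycle E ρ) (y : X) : size ρ y {w | F y w} ≠ 0 := by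
  refine (lt_of_lt_of_le ?_ (ofReal_le_size (F.refl y))).ne'
  exact ENNReal.ofReal_pos.2 (hρ.pos _ _ (E.refl y))

theorem IsLift.exists_compression (hρ : IsBorelCocycle E ρ) (hFE : F ≤ E) (hfin : IsFiniteRel F)
    {h : X → X} (hm : Measurable h) (hh : IsLift E F ρ h) :
    ∃ φ : Quotient F → Quotient F, Measurable φ ∧ Function.Injective φ ∧
      IsCompression (quotientRel E F hFE) (quotientCocycle F ρ) φ := by
  let φ : Quotient F → Quotient F := Quotient.map h fun x y hxy => (hh.rel_iff x y).2 hxy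
  have hφ : Function.Injective φ := by
    rintro ⟨x⟩ ⟨y⟩ hxy
    exact Quotient.sound ((hh.rel_iff x y).1 (Quotient.exact hxy))
  refine ⟨φ, measurable_from_quotient.2 (measurable_quotient_mk'.comp hm), hφ, ?_, ?_, ?_⟩
  · rintro ⟨x⟩
    exact (quotientRel_mk hFE _ _).2 (hh.rel x)
  · rintro ⟨y⟩
    change size (quotientCocycle F ρ) (Quotient.mk F y) (φ ⁻¹' {Quotient.mk F y}) ≤ 1
    by_cases hy : ∃ x, F (h x) y
    · obtain ⟨x, hxy⟩ := hy
      have hE := E.trans (hh.rel x) (hFE hxy)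
      rw [size_quotientCocycle_preimage hρ hFE hfin hφ hE (Quotient.sound hxy)]
      refine ENNReal.div_le_of_le_mul ?_
      rw [one_mul, hρ.size_mul hE (Y := {w | F x w}) fun w hw => hFE hw,
        hρ.size_mul hE (Y := {w | F y w}) fun w hw => E.trans hE (hFE hw)]
      refine mul_le_mul_left ((hh.le x).trans_eq ?_) _
      congr 1
      ext w
      exact ⟨fun h' => F.trans (F.symm hxy) h', fun h' => F.trans hxy h'⟩
    · have : φ ⁻¹' {Quotient.mk F y} = ∅ := by
        refine eq_empty_iff_forall_notMem.2 ?_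
        rintro ⟨x⟩ hx
        exact hy ⟨x, Quotient.exact hx⟩
      rw [this, size_empty]
      exact zero_le_one
  · rintro ⟨x⟩
    obtain ⟨a, hxa, ha⟩ := hh.complete x
    refine ⟨Quotient.mk F a, ?_, (quotientRel_mk hFE _ _).2 hxa⟩
    rw [mem_ofPred]
    by_cases hy : ∃ y, F (h y) a
    · obtain ⟨y, hya⟩ := hy
      have hE := E.trans (hh.rel y) (hFE hya)
      rw [size_quotientCocycle_preimage hρ hFE hfin hφ hE (Quotient.sound hya)]
      refine (ENNReal.div_lt_iff (Or.inl (size_class_pos hρ a)) (Or.inl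
        (size_class_ne_top hfin a a))).2 ?_
      rw [one_mul]
      exact ha y hya
    · have : φ ⁻¹' {Quotient.mk F a} = ∅ := by
        refine eq_empty_iff_forall_notMem.2 ?_
        rintro ⟨x⟩ hx
        exact hy ⟨x, Quotient.exact hx⟩
      rw [this, size_empty]
      exact zero_lt_one

/-- A finite Borel relation has a Borel transversal, hence the quotient map has a Borel section `t`;
compose the quotient map, `φ` and `t`. -/
theorem IsCompression.exists_isLift [StandardBorelSpace X] (hE : IsCountableBorel E)
    (hρ : IsBorelCocycle E ρ) (hFE : F ≤ E) (hF : IsBorelRel F) (hfin : IsFiniteRel F)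
    {φ : Quotient F → Quotient F} (hφm : Measurable φ) (hφ : Function.Injective φ)
    (h : IsCompression (quotientRel E F hFE) (quotientCocycle F ρ) φ) :
    ∃ h : X → X, Measurable h ∧ IsLift E F ρ h := by
  have hFc := hE.mono hFE hF
  obtain ⟨Y, -, hYm, hYt, hY⟩ := hFc.exists_transversal_of_finite .univ fun x =>
    (hfin x).subset fun w hw => F.symm hw.1
  have hYm' : Measurable fun x => x ∈ Y := hYm.mem
  obtain ⟨s, hs, hsP⟩ := hFc.exists_select (P := fun _ y => y ∈ Y) (by fun_prop) fun x => by
    obtain ⟨y, hy, hxy⟩ := hY x (mem_univ x)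
    exact ⟨y, hxy, hy⟩
  let t : Quotient F → X := Quotient.lift s fun x y hxy => hYt _ (hsP x).2 _ (hsP y).2
    (F.trans (F.symm (hsP x).1) (F.trans hxy (hsP y).1))
  have ht : Measurable t := measurable_from_quotient.2 hs
  have hmk : ∀ a, Quotient.mk F (t a) = a := by
    rintro ⟨x⟩
    exact Quotient.sound (F.symm (hsP x).1)
  have hrel : ∀ x, E x (t (φ (Quotient.mk F x))) := fun x => by
    rw [← quotientRel_mk hFE, hmk]
    exact h.graph _
  refine ⟨fun x => t (φ (Quotient.mk F x)), ht.comp (hφm.comp measurable_quotient_mk'), hrel,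
    fun x y => ?_, fun x => ?_, fun x => ?_⟩
  · constructor
    · intro h'
      have h' := Quotient.sound h'
      rw [hmk, hmk] at h'
      exact Quotient.exact (hφ h')
    · intro h'
      rw [Quotient.sound h']
  · have h1 := h.le_one (φ (Quotient.mk F x))
    rw [← hmk (φ (Quotient.mk F x)), size_quotientCocycle_preimage hρ hFE hfin hφ (hrel x)
      (hmk _).symm] at h1
    have h2 := (ENNReal.div_le_iff (size_class_pos hρ _) (size_class_ne_top hfin _ _)).1 h1
    rw [one_mul] at h2
    rw [hρ.size_mul (E.symm (hrel x)) (Y := {y | F x y}) fun w hw =>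
      E.trans (E.symm (hrel x)) (hFE hw), hρ.size_mul (E.symm (hrel x))
      (Y := {y | F (t (φ (Quotient.mk F x))) y}) fun w hw => hFE hw]
    gcongr
  · obtain ⟨⟨a⟩, ha, hxa⟩ := h.complete (Quotient.mk F x)
    refine ⟨a, (quotientRel_mk hFE _ _).1 hxa, fun y hy => ?_⟩
    have h1 : φ (Quotient.mk F y) = Quotient.mk F a := by
      rw [← hmk (φ (Quotient.mk F y))]
      exact Quotient.sound hy
    have ha : size (quotientCocycle F ρ) (Quotient.mk F a) (φ ⁻¹' {Quotient.mk F a}) < 1 := ha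
    rw [size_quotientCocycle_preimage hρ hFE hfin hφ (E.trans (hrel y) (hFE hy)) h1,
      ENNReal.div_lt_iff (Or.inl (size_class_pos hρ a)) (Or.inl
        (size_class_ne_top hfin a a)), one_mul] at ha
    exact ha

end Lift

/-! ### From a splitting to a compression -/

section Blocks

variable {X : Type*} [MeasurableSpace X] [StandardBorelSpace X] {E F : Setoid X} {ρ : X → X → ℝ}

/-- On smooth classes of infinite size, a Borel partition of each class into a sequence of finite
blocks of nondecreasing size. -/
theorem IsCountableBorel.exists_blocks (hF : IsCountableBorel F) (hρ : IsBorelCocycle F ρ)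
    (hm : Measurable fun p : X × X => ρ p.1 p.2) {A : Set X} (hA : MeasurableSet A)
    (hAF : IsInvariant F A) {o : X → X} (hom : Measurable o) (ho : ∀ x, F x (o x))
    (hoA : ∀ x ∈ A, ∀ y, F x y → o x = o y) (hap : ∀ x ∈ A, size ρ x {y | F x y} = ∞) :
    ∃ j : X → ℕ, Measurable j ∧ ∀ x ∈ A, ∀ i, {y | F x y ∧ j y = i}.Finite ∧
      (∃ y, F x y ∧ j y = i) ∧
      size ρ x {y | F x y ∧ j y = i} ≤ size ρ x {y | F x y ∧ j y = i + 1} := by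
  obtain ⟨idx, hidx, hidx'⟩ := hF.exists_index
  have hAm : Measurable fun x => x ∈ A := hA.mem
  let P : X → ℕ → ℝ≥0∞ := fun x n => size ρ x {y | F x y ∧ idx x y < n}
  have hfin : ∀ x n, {y | F x y ∧ idx x y < n}.Finite := fun x n => by
    refine Set.Finite.of_injOn (f := idx x) (t := Iio n) (fun y hy => hy.2) ?_ (finite_Iio n)
    intro y hy z hz h
    rw [← hidx' x y hy.1, h, hidx' x z hz.1]
  have hPtop : ∀ x n, P x n ≠ ∞ := fun x n => (size_lt_top (hfin x n)).ne
  have hPmono : ∀ x, Monotone (P x) := fun x n m h => size_mono fun y hy => ⟨hy.1, hy.2.trans_le h⟩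
  have hPsup : ∀ x ∈ A, ∀ b : ℝ≥0∞, b < ∞ → ∃ n, b ≤ P x n := by
    intro x hx b hb
    rw [← hap x hx, size, ENNReal.tsum_eq_iSup_sum, lt_iSup_iff] at hb
    obtain ⟨s, hs⟩ := hb
    obtain ⟨M, hM⟩ := (s.finite_toSet.image fun y => idx x y.1).bddAbove
    refine ⟨M + 1, hs.le.trans ?_⟩
    rw [← s.sum_coe_sort]
    have hinj : Function.Injective fun y : s => (⟨y.1.1, y.1.2, Nat.lt_succ_of_le
        (hM ⟨y.1, y.2, rfl⟩)⟩ : {y | F x y ∧ idx x y < M + 1}) := by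
      rintro ⟨⟨y, _⟩, _⟩ ⟨⟨z, _⟩, _⟩ h
      simpa using h
    have h1 := ENNReal.summable.tsum_le_tsum_of_inj
      (f := fun y : s => ENNReal.ofReal (ρ y.1.1 x))
      (g := fun y : {y | F x y ∧ idx x y < M + 1} => ENNReal.ofReal (ρ y x)) _ hinj
      (fun _ _ => zero_le) (fun _ => le_rfl) ENNReal.summable
    rwa [tsum_fintype] at h1
  -- Consecutive cut points satisfy `1 + 2 * P x (N i x) ≤ P x (N (i + 1) x)`: each block outweighs
  -- everything before it by at least `1`. So the blocks are nonempty and their sizes nondecreasing.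
  have hstep : ∀ N : {N : X → ℕ // Measurable N}, ∃ N' : {N : X → ℕ // Measurable N},
      ∀ x ∈ A, 1 + 2 * P x (N.1 x) ≤ P x (N'.1 x) := by
    rintro ⟨N, hN⟩
    have hPm : ∀ M : X → ℕ, Measurable M → Measurable fun x => P x (M x) := fun M hM =>
      hF.measurable_size hm measurable_id measurable_id (P := fun a y => idx a y < M a)
        (by fun_prop)
    have hPN := hPm N hN
    have hPc := fun n => hPm (fun _ => n) measurable_const
    obtain ⟨N', hN', h⟩ := exists_measurable_least
      (P := fun x n => x ∈ A → 1 + 2 * P x (N x) ≤ P x n) (fun n => hAm.imp (measurableSet_setOfPred.1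
        (measurableSet_le ((hPN.const_mul 2).const_add 1) (hPc n)))) fun x => by
        by_cases hx : x ∈ A
        · obtain ⟨n, hn⟩ := hPsup x hx (1 + 2 * P x (N x)) (ENNReal.add_lt_top.2
            ⟨ENNReal.one_lt_top, ENNReal.mul_lt_top (by simp) (hPtop x _).lt_top⟩)
          exact ⟨n, fun _ => hn⟩
        · exact ⟨0, fun h => absurd h hx⟩
    exact ⟨⟨N', hN'⟩, fun x => (h x).1⟩
  choose next hnext using hstep
  let N' : ℕ → {N : X → ℕ // Measurable N} :=
    fun n => Nat.rec ⟨fun _ => 0, measurable_const⟩ (fun _ N => next N) n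
  obtain ⟨N, hNm, hN0, hNs⟩ : ∃ N : ℕ → X → ℕ, (∀ i, Measurable (N i)) ∧ (∀ x, N 0 x = 0) ∧
      ∀ i, ∀ x ∈ A, 1 + 2 * P x (N i x) ≤ P x (N (i + 1) x) :=
    ⟨fun i => (N' i).1, fun i => (N' i).2, fun x => rfl, fun i => hnext (N' i)⟩
  have hNmono : ∀ x ∈ A, StrictMono fun i => N i x := fun x hx => by
    refine strictMono_nat_of_lt_succ fun i => ?_
    by_contra! h
    have h1 := (hNs i x hx).trans (hPmono x h)
    refine absurd h1 (not_le.2 ?_)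
    rw [two_mul, ← add_assoc]
    exact (ENNReal.lt_add_right (hPtop _ _) one_ne_zero).trans_le
      (by rw [add_comm 1]; exact le_self_add)
  -- Blocks are read off from the distinguished point `o x`, which makes them the same for all
  -- points of the class.
  obtain ⟨j, hjm, hj⟩ := exists_measurable_least
    (P := fun x i => x ∈ A → idx (o x) x < N (i + 1) (o x)) (fun i => by fun_prop) fun x => by
      by_cases hx : x ∈ A
      · exact ⟨idx (o x) x, fun _ => (hNmono (o x) (hAF _ _ (ho x) hx)).le_apply⟩
      · exact ⟨0, fun h => absurd h hx⟩
  refine ⟨j, hjm, fun x hx i => ?_⟩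
  have hoA' : o x ∈ A := hAF _ _ (ho x) hx
  have hjiff : ∀ y, F (o x) y → ∀ i,
      (j y = i ↔ ¬ idx (o x) y < N i (o x) ∧ idx (o x) y < N (i + 1) (o x)) := by
    intro y hy i
    have hyA : y ∈ A := hAF _ _ hy hoA'
    have he : o y = o x := (hoA x hx y (F.trans (ho x) hy)).symm
    have h1 := (hj y).1 hyA
    have h2 : ∀ m, idx (o x) y < N (m + 1) (o x) → j y ≤ m := fun m hm =>
      (hj y).2 m fun _ => by rwa [he]
    rw [he] at h1
    have hmono := (hNmono _ hoA').monotone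
    constructor
    · rintro rfl
      refine ⟨fun h => ?_, h1⟩
      rcases hjy : j y with _ | m
      · rw [hjy, hN0] at h
        exact absurd h (Nat.not_lt_zero _)
      · rw [hjy] at h
        have := h2 m h
        omega
    · rintro ⟨h3, h4⟩
      refine le_antisymm (h2 i h4) ?_
      by_contra! h
      exact h3 (h1.trans_le (hmono (Nat.succ_le_of_lt h)))
  have hS : ∀ i, size ρ (o x) {y | F x y ∧ j y = i} + P (o x) (N i (o x)) =
      P (o x) (N (i + 1) (o x)) := by
    intro i
    rw [← size_union]
    · change _ = size _ _ _
      congr 1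
      ext y
      constructor
      · rintro (⟨hy, h⟩ | ⟨hy, h⟩)
        · have hy := F.trans (F.symm (ho x)) hy
          exact ⟨hy, ((hjiff y hy i).1 h).2⟩
        · exact ⟨hy, h.trans (hNmono _ hoA' (Nat.lt_succ_self i))⟩
      · rintro ⟨hy, h⟩
        by_cases h' : idx (o x) y < N i (o x)
        · exact Or.inr ⟨hy, h'⟩
        · exact Or.inl ⟨F.trans (ho x) hy, (hjiff y hy i).2 ⟨h', h⟩⟩
    · rw [disjoint_left]
      rintro y ⟨hy, h⟩ ⟨hy', h'⟩
      exact ((hjiff y hy' i).1 h).1 h'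
  have hlow : ∀ i, 1 + P (o x) (N i (o x)) ≤ size ρ (o x) {y | F x y ∧ j y = i} := by
    intro i
    have h1 := hNs i (o x) hoA'
    rw [← hS i, two_mul, ← add_assoc] at h1
    exact (ENNReal.add_le_add_iff_right (hPtop _ _)).1 h1
  refine ⟨(hfin (o x) (N (i + 1) (o x))).subset ?_, ?_, ?_⟩
  · rintro y ⟨hy, h⟩
    have hy := F.trans (F.symm (ho x)) hy
    exact ⟨hy, ((hjiff y hy i).1 h).2⟩
  · by_contra h
    have h1 := hlow i
    rw [show {y | F x y ∧ j y = i} = ∅ from eq_empty_iff_forall_notMem.2 fun y hy => h ⟨y, hy⟩,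
      size_empty] at h1
    simp at h1
  · have h1 : size ρ (o x) {y | F x y ∧ j y = i} ≤ size ρ (o x) {y | F x y ∧ j y = i + 1} :=
      calc _ ≤ P (o x) (N (i + 1) (o x)) := by rw [← hS i]; exact le_self_add
        _ ≤ 1 + P (o x) (N (i + 1) (o x)) := le_add_self
        _ ≤ _ := hlow (i + 1)
    have h2 := F.symm (ho x)
    rw [hρ.size_mul h2 (Y := {y | F x y ∧ j y = i}) fun y hy => F.trans h2 hy.1,
      hρ.size_mul h2 (Y := {y | F x y ∧ j y = i + 1}) fun y hy => F.trans h2 hy.1]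
    exact mul_le_mul_left h1 _

/-- A smooth aperiodic part together with a strictly increasing automorphism of the remaining part
yield a compression of the quotient by a finite relation. -/
theorem exists_isLift_of_splitting (hE : IsCountableBorel E) (hρ : IsBorelCocycle E ρ)
    (hm : Measurable fun p : X × X => ρ p.1 p.2) {B : Set X} (hB : MeasurableSet B)
    (hBE : IsInvariant E B) (hFE : F ≤ E) (hFb : IsBorelRel F)
    (hs : IsSmoothRel (restrictRel F Bᶜ))
    (hap : IsAperiodic (restrictRel F Bᶜ) (restrictCocycle ρ Bᶜ)) {φ : B ≃ᵐ B}
    (hφ : IsStrictlyIncreasing (restrictRel F B) (restrictCocycle ρ B) φ) :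
    ∃ F' ≤ E, IsBorelRel F' ∧ IsFiniteRel F' ∧ ∃ h, Measurable h ∧ IsLift E F' ρ h := by
  classical
  have hF := hE.mono hFE hFb
  have hρF := hρ.mono hFE
  have hBm : Measurable fun x => x ∈ B := hB.mem
  have hBF : ∀ x y, F x y → (x ∈ B ↔ y ∈ B) := fun x y h =>
    ⟨hBE _ _ (hFE h), hBE _ _ (E.symm (hFE h))⟩
  obtain ⟨Y, hYm, hYc, hYt⟩ := hs
  have hYm' : Measurable fun x => x ∈ Subtype.val '' Y :=
    ((MeasurableEmbedding.subtype_coe hB.compl).measurableSet_image.2 hYm).mem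
  obtain ⟨o, hom, ho⟩ := hF.exists_select (P := fun x y => x ∉ B → y ∈ Subtype.val '' Y)
    (by fun_prop) fun x => by
      by_cases hx : x ∈ B
      · exact ⟨x, F.refl x, fun h => absurd hx h⟩
      · obtain ⟨y, hy, hxy⟩ := hYc ⟨x, hx⟩
        exact ⟨y, hxy, fun _ => ⟨y, hy, rfl⟩⟩
  obtain ⟨j, hjm, hj⟩ := hF.exists_blocks hρF hm hB.compl
    (fun x y h hx hy => hx ((hBF x y h).2 hy)) hom (fun x => (ho x).1) (fun x hx y hxy => by
      obtain ⟨a, ha, hax⟩ := (ho x).2 hx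
      obtain ⟨b, hb, hby⟩ := (ho y).2 fun hy => hx ((hBF x y hxy).2 hy)
      rw [← hax, ← hby]
      refine congrArg Subtype.val (hYt a ha b hb ?_)
      change F a.1 b.1
      rw [hax, hby]
      exact F.trans (F.symm (ho x).1) (F.trans hxy (ho y).1)) (fun x hx => by
      have h := hap ⟨x, hx⟩
      rw [size_restrictCocycle] at h
      rw [eq_top_iff, ← h]
      refine size_mono ?_
      rintro _ ⟨y, hy, rfl⟩
      exact F.symm hy)
  obtain ⟨g, hgm, hg⟩ := hF.exists_select (P := fun x y => x ∉ B → j y = j x + 1)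
    (by fun_prop) fun x => by
      by_cases hx : x ∈ B
      · exact ⟨x, F.refl x, fun h => absurd hx h⟩
      · obtain ⟨y, hy, h⟩ := (hj x hx (j x + 1)).2.1
        exact ⟨y, hy, fun _ => h⟩
  -- Singletons on `B`, blocks off `B`.
  let F' : Setoid X :=
    { r := fun x y => x = y ∨ x ∉ B ∧ F x y ∧ j x = j y
      iseqv :=
        { refl := fun x => Or.inl rfl
          symm := by
            rintro x y (rfl | ⟨hx, h, h'⟩)
            · exact Or.inl rfl
            · exact Or.inr ⟨fun hy => hx ((hBF _ _ h).2 hy), F.symm h, h'.symm⟩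
          trans := by
            rintro x y z (rfl | ⟨hx, h, h'⟩) (rfl | ⟨hy, h2, h2'⟩)
            · exact Or.inl rfl
            · exact Or.inr ⟨hy, h2, h2'⟩
            · exact Or.inr ⟨hx, h, h'⟩
            · exact Or.inr ⟨hx, F.trans h h2, h'.trans h2'⟩ } }
  have hF'B : ∀ x ∈ B, ∀ y, F' x y ↔ x = y := fun x hx y =>
    ⟨fun h => h.resolve_right fun h => h.1 hx, Or.inl⟩
  have hF'c : ∀ x ∉ B, ∀ y, F' x y ↔ F x y ∧ j y = j x := fun x hx y => by
    constructor
    · rintro (rfl | ⟨-, h, h'⟩)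
      exacts [⟨F.refl x, rfl⟩, ⟨h, h'.symm⟩]
    · exact fun h => Or.inr ⟨hx, h.1, h.2.symm⟩
  have hF'F : F' ≤ F := by
    rintro x y (rfl | ⟨-, h, -⟩)
    exacts [F.refl x, h]
  have hclsB : ∀ x ∈ B, {y | F' x y} = {x} := fun x hx => by
    ext y
    exact (hF'B x hx y).trans eq_comm
  let h : X → X := fun x => if hx : x ∈ B then φ ⟨x, hx⟩ else g x
  have hhB : ∀ x (hx : x ∈ B), h x = φ ⟨x, hx⟩ := fun x hx => dif_pos hx
  have hhc : ∀ x ∉ B, h x = g x := fun x hx => dif_neg hx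
  have hhF : ∀ x, F x (h x) := fun x => by
    by_cases hx : x ∈ B
    · rw [hhB x hx]; exact hφ.graph ⟨x, hx⟩
    · rw [hhc x hx]; exact (hg x).1
  have hlt : ∀ x : B, ENNReal.ofReal (ρ x (φ x)) < 1 := fun x => by
    have h1 := hφ.lt_one (φ x)
    rw [size_restrictCocycle] at h1
    exact (ofReal_le_size (by exact ⟨x, rfl, rfl⟩)).trans_lt h1
  refine ⟨F', hF'F.trans hFE, ?_, fun x => ?_, h, ?_, ⟨fun x => hFE (hhF x), fun x y => ?_,
    fun x => ?_, fun x => ?_⟩⟩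
  · have hFr := hF.measurable_rel
    have : Measurable fun p : X × X => p.1 = p.2 ∨ p.1 ∉ B ∧ F p.1 p.2 ∧ j p.1 = j p.2 :=
      (Measurable.eq measurable_fst measurable_snd).or (by fun_prop)
    exact measurableSet_setOfPred.2 this
  · by_cases hx : x ∈ B
    · refine (finite_singleton x).subset fun y hy => ?_
      exact ((hF'B x hx y).1 (F'.symm hy)).symm
    · exact ((hj x hx (j x)).1).subset fun y hy => (hF'c x hx y).1 (F'.symm hy)
  · exact Measurable.dite (s := B) (measurable_subtype_coe.comp φ.measurable)
      (hgm.comp measurable_subtype_coe) hB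
  · by_cases hx : x ∈ B
    · have hhx : h x ∈ B := (hBF _ _ (hhF x)).1 hx
      rw [hF'B x hx, hF'B _ hhx]
      constructor
      · intro he
        have hy : y ∈ B := (hBF _ _ (hhF y)).2 (he ▸ hhx)
        rw [hhB x hx, hhB y hy] at he
        exact congrArg Subtype.val (φ.injective (Subtype.ext he))
      · exact fun h => h ▸ rfl
    · have hhx : h x ∉ B := fun hh => hx ((hBF _ _ (hhF x)).2 hh)
      rw [hF'c x hx, hF'c _ hhx]
      have hF2 : F (h x) (h y) ↔ F x y :=
        ⟨fun hh => F.trans (hhF x) (F.trans hh (F.symm (hhF y))),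
          fun hh => F.trans (F.symm (hhF x)) (F.trans hh (hhF y))⟩
      rw [hF2]
      refine and_congr_right fun hxy => ?_
      have hy : y ∉ B := fun hy => hx ((hBF _ _ hxy).2 hy)
      rw [hhc x hx, hhc y hy, (hg x).2 hx, (hg y).2 hy]
      omega
  · by_cases hx : x ∈ B
    · have hhx : h x ∈ B := (hBF _ _ (hhF x)).1 hx
      rw [hclsB x hx, hclsB _ hhx, size_singleton, size_singleton]
      refine ENNReal.ofReal_le_ofReal ?_
      have h1 := hlt ⟨x, hx⟩
      rw [ENNReal.ofReal_lt_one, ← hhB x hx] at h1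
      rw [hρ.self]
      exact ((hρF.lt_one_iff (hhF x)).1 h1).le
    · have hhx : h x ∉ B := fun hh => hx ((hBF _ _ (hhF x)).2 hh)
      have h1 : {y | F' x y} = {y | F x y ∧ j y = j x} := by ext y; exact hF'c x hx y
      have h2 : {y | F' (h x) y} = {y | F x y ∧ j y = j x + 1} := by
        ext y
        refine (hF'c _ hhx y).trans ?_
        rw [hhc x hx, (hg x).2 hx]
        exact and_congr_left fun _ =>
          ⟨fun hh => F.trans (hg x).1 hh, fun hh => F.trans (F.symm (hg x).1) hh⟩
      rw [h1, h2]
      exact (hj x hx (j x)).2.2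
  · by_cases hx : x ∈ B
    · refine ⟨x, E.refl x, fun y hy => ?_⟩
      have hyB : y ∈ B := (hBF _ _ (F.trans (hhF y) (hF'F hy))).2 hx
      have he := (hF'B _ ((hBF _ _ (hhF y)).1 hyB) x).1 hy
      rw [hclsB x hx, hclsB y hyB, size_singleton, size_singleton, hρ.self, ENNReal.ofReal_one,
        ← he, hhB y hyB]
      exact hlt ⟨y, hyB⟩
    -- Off `B` the map raises the block number by one, so block `0` has no preimage and strictness
    -- holds vacuously there.
    · obtain ⟨a, ha, ha0⟩ := (hj x hx 0).2.1
      refine ⟨a, hFE ha, fun y hy => ?_⟩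
      have haB : a ∉ B := fun h => hx ((hBF _ _ ha).2 h)
      have hyB : y ∉ B := fun h => haB ((hBF _ _ (F.trans (hhF y) (hF'F hy))).1 h)
      have h1 := ((hF'c a haB _).1 (F'.symm hy)).2
      rw [hhc y hyB, (hg y).2 hyB, ha0] at h1
      omega

end Blocks

/-! ### Orbits of a lift modulo the finite relation -/

section Orbit

variable {X : Type*} {E R : Setoid X} {ρ : X → X → ℝ} {h : X → X}

theorem IsLift.iterate_rel_iff (hl : IsLift E R ρ h) (n : ℕ) (x y : X) :
    R (h^[n] x) (h^[n] y) ↔ R x y := by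
  induction n generalizing x y with
  | zero => rfl
  | succ n ih => rw [Function.iterate_succ_apply, Function.iterate_succ_apply, ih, hl.rel_iff]

theorem IsLift.rel_iterate (hl : IsLift E R ρ h) (n : ℕ) (x : X) : E x (h^[n] x) := by
  induction n with
  | zero => exact E.refl x
  | succ n ih => rw [Function.iterate_succ_apply']; exact E.trans ih (hl.rel _)

/-- Some iterate of `h` maps the `R`-class of `x` to that of `y`. -/
def Precedes (R : Setoid X) (h : X → X) (x y : X) : Prop :=
  ∃ n, R (h^[n] x) y

theorem Precedes.trans (hl : IsLift E R ρ h) {x y z : X} (h1 : Precedes R h x y)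
    (h2 : Precedes R h y z) : Precedes R h x z := by
  obtain ⟨n, hn⟩ := h1
  obtain ⟨m, hm⟩ := h2
  refine ⟨m + n, ?_⟩
  rw [Function.iterate_add_apply]
  exact R.trans ((hl.iterate_rel_iff m _ _).2 hn) hm

theorem Precedes.rel (hl : IsLift E R ρ h) (hRE : R ≤ E) {x y : X} (h1 : Precedes R h x y) :
    E x y := by
  obtain ⟨n, hn⟩ := h1
  exact E.trans (hl.rel_iterate n x) (hRE hn)

/-- The orbit equivalence relation of `h` modulo `R`. -/
def IsLift.orbit (hl : IsLift E R ρ h) : Setoid X where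
  r x y := ∃ m n, R (h^[m] x) (h^[n] y)
  iseqv :=
    { refl := fun x => ⟨0, 0, R.refl x⟩
      symm := fun ⟨m, n, h⟩ => ⟨n, m, R.symm h⟩
      trans := by
        rintro x y z ⟨m, n, h1⟩ ⟨p, q, h2⟩
        refine ⟨p + m, n + q, ?_⟩
        rw [Function.iterate_add_apply, Function.iterate_add_apply]
        refine R.trans ((hl.iterate_rel_iff p _ _).2 h1) ?_
        rw [← Function.iterate_add_apply, add_comm, Function.iterate_add_apply]
        exact (hl.iterate_rel_iff n _ _).2 h2 }

/-- Injectivity of `h` modulo `R` cancels common iterates, so the classes of an orbit are comparable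
under `Precedes`. -/
theorem IsLift.orbit_iff (hl : IsLift E R ρ h) {x y : X} :
    hl.orbit x y ↔ Precedes R h x y ∨ Precedes R h y x := by
  constructor
  · rintro ⟨m, n, hmn⟩
    rcases le_total m n with hle | hle
    · obtain ⟨k, rfl⟩ := Nat.exists_eq_add_of_le hle
      rw [Function.iterate_add_apply, hl.iterate_rel_iff] at hmn
      exact Or.inr ⟨k, R.symm hmn⟩
    · obtain ⟨k, rfl⟩ := Nat.exists_eq_add_of_le hle
      rw [Function.iterate_add_apply, hl.iterate_rel_iff] at hmn
      exact Or.inl ⟨k, hmn⟩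
  · rintro (⟨n, hn⟩ | ⟨n, hn⟩)
    · exact ⟨n, 0, hn⟩
    · exact ⟨0, n, R.symm hn⟩

theorem IsLift.orbit_le (hl : IsLift E R ρ h) (hRE : R ≤ E) : hl.orbit ≤ E := by
  rintro x y ⟨m, n, hmn⟩
  exact E.trans (hl.rel_iterate m x) (E.trans (hRE hmn) (E.symm (hl.rel_iterate n y)))

/-- The size of the `R`-class of `x`, relative to `z`. -/
noncomputable def classSize (R : Setoid X) (ρ : X → X → ℝ) (z x : X) : ℝ :=
  (size ρ z {y | R x y}).toReal

theorem ofReal_classSize (hfin : IsFiniteRel R) (z x : X) :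
    ENNReal.ofReal (classSize R ρ z x) = size ρ z {y | R x y} :=
  ENNReal.ofReal_toReal (size_class_ne_top hfin x z)

theorem le_classSize (hfin : IsFiniteRel R) (z x : X) : ρ x z ≤ classSize R ρ z x := by
  have h1 := ofReal_le_size (ρ := ρ) (z := z) (R.refl x : x ∈ {y | R x y})
  exact (ENNReal.ofReal_le_iff_le_toReal (size_class_ne_top hfin x z)).1 h1

theorem classSize_congr {x y : X} (hxy : R x y) (z : X) :
    classSize R ρ z x = classSize R ρ z y := by
  rw [classSize, classSize]
  congr 2
  ext w
  exact ⟨fun h => R.trans (R.symm hxy) h, fun h => R.trans hxy h⟩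

/-- A point of the set such that no predecessor belongs to the set. -/
def firstSet (E R : Setoid X) (h : X → X) (Q : X → Prop) : Set X :=
  {x | Q x ∧ ∀ y, E x y → R (h y) x → ¬ Q y}

/-- The points larger than all points that strictly precede them. -/
def recordSet (E R : Setoid X) (ρ : X → X → ℝ) (h : X → X) : Set X :=
  {x | ∀ y, E x y → (∃ n, R (h^[n + 1] y) x) → ρ y x < 1}

/-- For a property that persists along `h`, if one of two points preceded the other by a positive
number of steps, the later one would have a predecessor with the property. -/
theorem IsLift.rel_of_mem_firstSet (hl : IsLift E R ρ h) (hRE : R ≤ E) {Q : X → Prop}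
    (hQ : ∀ x y, Precedes R h x y → Q x → Q y) {x y : X} (hx : x ∈ firstSet E R h Q)
    (hy : y ∈ firstSet E R h Q) (hxy : hl.orbit x y) : R x y := by
  have aux : ∀ x ∈ firstSet E R h Q, ∀ y ∈ firstSet E R h Q, Precedes R h x y → R x y := by
    rintro x hx y hy ⟨_ | n, hn⟩
    · exact hn
    · rw [Function.iterate_succ_apply'] at hn
      have h1 : E y (h^[n] x) := E.symm (E.trans (hl.rel _) (hRE hn))
      exact absurd (hQ x _ ⟨n, R.refl _⟩ hx.1) (hy.2 _ h1 hn)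
  rcases hl.orbit_iff.1 hxy with h1 | h1
  · exact aux x hx y hy h1
  · exact R.symm (aux y hy x hx h1)

theorem IsLift.exists_mem_firstSet (hl : IsLift E R ρ h) {Q : X → Prop}
    (hQ : ∀ x y, Precedes R h x y → Q x → Q y) {x y : X} (hx : Q x) (hy : ¬ Q y)
    (hxy : hl.orbit x y) : ∃ v ∈ firstSet E R h Q, hl.orbit x v := by
  classical
  have h1 : Precedes R h y x := by
    rcases hl.orbit_iff.1 hxy with h1 | h1
    · exact absurd (hQ _ _ h1 hx) hy
    · exact h1
  obtain ⟨n, hn⟩ := h1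
  have hex : ∃ n, Q (h^[n] y) := ⟨n, hQ _ _ ⟨0, R.symm hn⟩ hx⟩
  obtain ⟨i, hi⟩ : ∃ i, Nat.find hex = i + 1 := by
    refine Nat.exists_eq_succ_of_ne_zero fun h0 => hy ?_
    have := Nat.find_spec hex
    rwa [h0] at this
  have hspec := Nat.find_spec hex
  rw [hi] at hspec
  refine ⟨h^[i + 1] y, ⟨hspec, fun w _ hw hQw => ?_⟩, hl.orbit.trans hxy ⟨i + 1, 0, R.refl _⟩⟩
  rw [Function.iterate_succ_apply', hl.rel_iff] at hw
  exact Nat.find_min hex (hi ▸ Nat.lt_succ_self i) (hQ _ _ ⟨0, hw⟩ hQw)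

/-- The classes of the orbit relation of `h` on which the size of the `R`-classes is not preserved
by `h`. -/
def IsLift.IsActive (hl : IsLift E R ρ h) (x : X) : Prop :=
  ∃ a, hl.orbit x a ∧ ∀ y, E a y → R (h y) a → classSize R ρ a y < classSize R ρ a a

theorem IsLift.IsActive.congr {hl : IsLift E R ρ h} {x y : X} (hx : hl.IsActive x)
    (hxy : hl.orbit x y) : hl.IsActive y := by
  obtain ⟨a, ha, h1⟩ := hx
  exact ⟨a, hl.orbit.trans (hl.orbit.symm hxy) ha, h1⟩

/-- The points preceded by a point of at least half the size of every point of the orbit. -/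
def IsLift.IsLate (hl : IsLift E R ρ h) (x : X) : Prop :=
  ∃ y, E x y ∧ Precedes R h y x ∧ ∀ w, hl.orbit x w → ρ w y ≤ 2

theorem IsLift.isLate_mono (hl : IsLift E R ρ h) (hRE : R ≤ E) (x y : X)
    (hxy : Precedes R h x y) (hx : hl.IsLate x) : hl.IsLate y := by
  obtain ⟨w, hw, hwx, h1⟩ := hx
  exact ⟨w, E.trans (E.symm (hxy.rel hl hRE)) hw, hwx.trans hl hxy,
    fun v hv => h1 v (hl.orbit.trans (hl.orbit_iff.2 (Or.inl hxy)) hv)⟩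

theorem IsLift.finite_firstSet (hl : IsLift E R ρ h) (hRE : R ≤ E) (hfin : IsFiniteRel R)
    {Q : X → Prop} (hQ : ∀ x y, Precedes R h x y → Q x → Q y) (z : X) :
    {v | hl.orbit z v ∧ v ∈ firstSet E R h Q}.Finite := by
  rcases eq_empty_or_nonempty {v | hl.orbit z v ∧ v ∈ firstSet E R h Q} with h0 | ⟨v, hv, hvQ⟩
  · rw [h0]; exact finite_empty
  · refine (hfin v).subset ?_
    rintro w ⟨hw, hwQ⟩
    exact hl.rel_of_mem_firstSet hRE hQ hwQ hvQ (hl.orbit.trans (hl.orbit.symm hw) hv)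

variable [MeasurableSpace X]

theorem classSize_mul (hρ : IsBorelCocycle E ρ) (hRE : R ≤ E) {x z w : X} (hzx : E z x)
    (hzw : E z w) : classSize R ρ w x = classSize R ρ z x * ρ z w := by
  rw [classSize, classSize, hρ.size_mul hzw (Y := {y | R x y}) fun y hy => E.trans hzx (hRE hy),
    ENNReal.toReal_mul, ENNReal.toReal_ofReal (hρ.pos _ _ hzw).le]

theorem classSize_pos (hρ : IsBorelCocycle E ρ) (hfin : IsFiniteRel R) {x z : X} (hzx : E z x) :
    0 < classSize R ρ z x :=
  (hρ.pos _ _ (E.symm hzx)).trans_le (le_classSize hfin z x)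

theorem IsLift.classSize_mono (hl : IsLift E R ρ h) (hρ : IsBorelCocycle E ρ) (hRE : R ≤ E)
    (hfin : IsFiniteRel R) {x y z : X} (hzx : E z x) (hxy : Precedes R h x y) :
    classSize R ρ z x ≤ classSize R ρ z y := by
  obtain ⟨n, hn⟩ := hxy
  rw [← classSize_congr hn]
  clear hn
  induction n with
  | zero => rfl
  | succ n ih =>
    refine ih.trans ?_
    have h1 := ENNReal.toReal_mono (size_class_ne_top hfin _ _) (hl.le (h^[n] x))
    rw [Function.iterate_succ_apply']
    have hzn := E.trans hzx (hl.rel_iterate n x)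
    rw [classSize_mul hρ hRE (z := h^[n] x) (E.refl _) (E.symm hzn),
      classSize_mul hρ hRE (z := h^[n] x) (hl.rel _) (E.symm hzn)]
    exact mul_le_mul_of_nonneg_right h1 (hρ.pos _ _ (E.symm hzn)).le

/-- A recurrence would make the whole orbit a cycle. The predecessor of the active point `a` would
then also come after `a`, hence be no smaller by monotonicity, yet strictly smaller by activity. -/
theorem IsLift.IsActive.eq_of_rel {hl : IsLift E R ρ h} (hρ : IsBorelCocycle E ρ) (hRE : R ≤ E)
    (hfin : IsFiniteRel R) {x : X} (hx : hl.IsActive x) {m n : ℕ}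
    (hmn : R (h^[m] x) (h^[n] x)) : m = n := by
  have aux : ∀ m k, ¬ R (h^[m] x) (h^[m + (k + 1)] x) := by
    intro m k hk
    rw [Function.iterate_add_apply, hl.iterate_rel_iff] at hk
    obtain ⟨a, ⟨p, q, hpq⟩, ha⟩ := hx
    have h1 : R (h^[k + 1] (h^[p] x)) (h^[k + 1] (h^[q] a)) := (hl.iterate_rel_iff _ _ _).2 hpq
    rw [← Function.iterate_add_apply, ← Function.iterate_add_apply, add_comm _ p, add_comm _ q,
      Function.iterate_add_apply h p, Function.iterate_add_apply h q] at h1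
    have h2 : R (h^[q] (h^[k + 1] a)) (h^[q] a) :=
      R.trans (R.symm h1) (R.trans ((hl.iterate_rel_iff p _ _).2 (R.symm hk)) hpq)
    rw [hl.iterate_rel_iff, Function.iterate_succ_apply'] at h2
    exact absurd (ha _ (hl.rel_iterate k a) h2) (not_lt.2
      (hl.classSize_mono hρ hRE hfin (E.refl a) ⟨k, R.refl _⟩))
  rcases lt_trichotomy m n with hlt | he | hlt
  · obtain ⟨k, rfl⟩ := Nat.exists_eq_add_of_lt hlt
    exact absurd hmn (aux m k)
  · exact he
  · obtain ⟨k, rfl⟩ := Nat.exists_eq_add_of_lt hlt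
    exact absurd (R.symm hmn) (aux n k)

/-- The classes of the iterates of `x` are pairwise disjoint, and each is at least as large as the
class of `x`. -/
theorem IsLift.IsActive.size_eq_top {hl : IsLift E R ρ h} (hρ : IsBorelCocycle E ρ) (hRE : R ≤ E)
    (hfin : IsFiniteRel R) {x z : X} (hx : hl.IsActive x) (hzx : E z x) :
    size ρ z {y | hl.orbit x y} = ∞ := by
  have hinj : Function.Injective fun p : Σ n : ℕ, {y | R (h^[n] x) y} =>
      (⟨p.2.1, p.1, 0, p.2.2⟩ : {y | hl.orbit x y}) := by
    rintro ⟨n, y, hy⟩ ⟨m, w, hw⟩ he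
    have he : y = w := congrArg Subtype.val he
    subst he
    have := hx.eq_of_rel hρ hRE hfin (R.trans hy (R.symm hw))
    subst this
    rfl
  have h1 := ENNReal.tsum_comp_le_tsum_of_injective hinj
    fun y : {y | hl.orbit x y} => ENNReal.ofReal (ρ y z)
  rw [eq_top_iff]
  refine le_trans ?_ h1
  dsimp only
  rw [ENNReal.tsum_sigma']
  rw [← ENNReal.tsum_const_eq_top_of_ne_zero (α := ℕ)
    (ENNReal.ofReal_pos.2 (classSize_pos hρ hfin hzx)).ne']
  refine ENNReal.tsum_le_tsum fun n => ?_
  refine (ENNReal.ofReal_le_ofReal (hl.classSize_mono hρ hRE hfin hzx ⟨n, R.refl _⟩)).trans ?_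
  rw [ofReal_classSize hfin]
  exact le_rfl

end Orbit

/-! ### Locally finite candidates on active orbits -/

section Candidates

variable {X : Type*} [MeasurableSpace X] {E R : Setoid X} {ρ : X → X → ℝ} {h : X → X}

/-- The points whose `R`-class is larger, by a factor depending on `k`, than a preceding one. -/
def HasGrown (E R : Setoid X) (ρ : X → X → ℝ) (h : X → X) (k : ℕ) (x : X) : Prop :=
  ∃ y, E x y ∧ Precedes R h y x ∧ (k + 2) * classSize R ρ x y ≤ (k + 1) * classSize R ρ x x

/-- A list of sets such that some set of the list is locally finite and nonempty on each active
orbit. -/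
def IsLift.candidate (hl : IsLift E R ρ h) : ℕ → Set X
  | 0 => firstSet E R h fun _ => True
  | 1 => recordSet E R ρ h
  | 2 => firstSet E R h hl.IsLate
  | k + 3 => firstSet E R h (HasGrown E R ρ h k)

theorem IsLift.hasGrown_mono (hl : IsLift E R ρ h) (hρ : IsBorelCocycle E ρ) (hRE : R ≤ E)
    (hfin : IsFiniteRel R) (k : ℕ) (x y : X) (hxy : Precedes R h x y)
    (hx : HasGrown E R ρ h k x) : HasGrown E R ρ h k y := by
  obtain ⟨w, hw, hwx, h1⟩ := hx
  have hE := hxy.rel hl hRE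
  refine ⟨w, E.trans (E.symm hE) hw, hwx.trans hl hxy, ?_⟩
  rw [classSize_mul hρ hRE hw hE, classSize_mul hρ hRE hE hE, ← mul_assoc, ← mul_assoc]
  refine mul_le_mul_of_nonneg_right (h1.trans ?_) (hρ.pos _ _ hE).le
  exact mul_le_mul_of_nonneg_left (hl.classSize_mono hρ hRE hfin (E.refl x) hxy) (by positivity)

/-- A first class serves when there is one. Otherwise the orbit runs back without end, and the class
sizes going backwards either tend to `0` or stay away from `0`. In the first case large points
cannot come early, so there is a first late class if point sizes are bounded, and the record points
work if not. In the second case some strict growth occurs, and the backward limit of the sizes keeps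
it from having occurred at every earlier stage. -/
theorem IsLift.IsActive.exists_candidate {hl : IsLift E R ρ h} (hρ : IsBorelCocycle E ρ)
    (hRE : R ≤ E) (hfin : IsFiniteRel R) {z : X} (hz : hl.IsActive z) :
    ∃ i, (∃ v, hl.orbit z v ∧ v ∈ hl.candidate i) ∧
      ∀ b : ℝ, {v | hl.orbit z v ∧ v ∈ hl.candidate i ∧ ρ v z ≤ b ∧ ρ z v ≤ b}.Finite := by
  have hOE := hl.orbit_le hRE
  have hfirst : ∀ i Q, hl.candidate i = firstSet E R h Q →
      (∀ x y, Precedes R h x y → Q x → Q y) → (∃ v, hl.orbit z v ∧ v ∈ firstSet E R h Q) →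
      ∃ i, (∃ v, hl.orbit z v ∧ v ∈ hl.candidate i) ∧
        ∀ b : ℝ, {v | hl.orbit z v ∧ v ∈ hl.candidate i ∧ ρ v z ≤ b ∧ ρ z v ≤ b}.Finite := by
    intro i Q hi hQ hne
    refine ⟨i, by rwa [hi], fun b => ?_⟩
    rw [hi]
    exact (hl.finite_firstSet hRE hfin hQ z).subset fun v hv => ⟨hv.1, hv.2.1⟩
  by_cases hstart : ∃ x, hl.orbit z x ∧ x ∈ firstSet E R h fun _ => True
  · exact hfirst 0 _ rfl (fun _ _ _ h => h) hstart
  have hpred : ∀ x, hl.orbit z x → ∃ y, R (h y) x := by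
    intro x hx
    by_contra hne
    exact hstart ⟨x, hx, trivial, fun y _ hy => absurd ⟨y, hy⟩ hne⟩
  have htot : ∀ x y, hl.orbit z x → hl.orbit z y → ¬ Precedes R h x y → Precedes R h y x :=
    fun x y hx hy hn =>
      (hl.orbit_iff.1 (hl.orbit.trans (hl.orbit.symm hx) hy)).resolve_left hn
  have hmono : ∀ x y, hl.orbit z x → Precedes R h x y →
      classSize R ρ z x ≤ classSize R ρ z y := fun x y hx hxy =>
    hl.classSize_mono hρ hRE hfin (hOE hx) hxy
  by_cases hinf : ∀ ε > 0, ∃ x, hl.orbit z x ∧ classSize R ρ z x < ε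
  · have hnot : ∀ x y, hl.orbit z x → hl.orbit z y → classSize R ρ z y < ρ x z →
        Precedes R h y x := fun x y hx hy hlt => htot x y hx hy fun hxy =>
      absurd ((le_classSize hfin z x).trans (hmono x y hx hxy)) (not_le.2 hlt)
    by_cases hbdd : ∃ M, ∀ x, hl.orbit z x → ρ x z ≤ M
    · obtain ⟨M, hM⟩ := hbdd
      have hbd : BddAbove ((fun x => ρ x z) '' {x | hl.orbit z x}) :=
        ⟨M, by rintro _ ⟨x, hx, rfl⟩; exact hM x hx⟩
      have hzS : (fun x => ρ x z) z ∈ (fun x => ρ x z) '' {x | hl.orbit z x} :=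
        ⟨z, hl.orbit.refl z, rfl⟩
      have hS1 := le_csSup hbd hzS
      simp only [hρ.self] at hS1
      -- A point above half the supremum is late. A class smaller than half of `a` is not, since no
      -- point up to it can be within a factor `2` of `a`.
      obtain ⟨_, ⟨a, ha, rfl⟩, haS⟩ := exists_lt_of_lt_csSup ⟨_, hzS⟩
        (show sSup ((fun x => ρ x z) '' {x | hl.orbit z x}) / 2 < _ from
          half_lt_self (one_pos.trans_le hS1))
      have hza := hOE ha
      have haz := hρ.pos _ _ (E.symm hza)
      have hamax : ∀ w, hl.orbit z w → ρ w z ≤ 2 * ρ a z := fun w hw => by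
        have := le_csSup hbd ⟨w, hw, rfl⟩
        dsimp only at this haS
        linarith
      obtain ⟨y, hy, hya⟩ := hinf (ρ a z / 2) (by positivity)
      have hlate : hl.IsLate a := by
        refine ⟨a, E.refl a, ⟨0, R.refl a⟩, fun w hw => ?_⟩
        have hzw := hl.orbit.trans ha hw
        have h1 := hamax w hzw
        rw [hρ.mul w z a (E.symm (hOE hzw)) hza]
        have h2 := hρ.mul_swap hza
        have h3 := hρ.pos _ _ hza
        nlinarith
      have hnlate : ¬ hl.IsLate y := by
        rintro ⟨w, hw, hwy, h1⟩
        have hzw := hl.orbit.trans hy (hl.orbit_iff.2 (Or.inr hwy))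
        have h2 := h1 a (hl.orbit.trans (hl.orbit.symm hy) ha)
        have h3 := (le_classSize hfin z w).trans (hmono w y hzw hwy)
        have h4 := hρ.mul a w z (E.trans (E.symm hza) (hOE hzw)) (E.symm (hOE hzw))
        have h5 := hρ.pos w z (E.symm (hOE hzw))
        nlinarith
      obtain ⟨v, hv, hav⟩ := hl.exists_mem_firstSet (hl.isLate_mono hRE) hlate hnlate
        (hl.orbit.trans (hl.orbit.symm ha) hy)
      exact hfirst 2 _ rfl (hl.isLate_mono hRE) ⟨v, hl.orbit.trans ha hav, hv⟩
    · push Not at hbdd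
      refine ⟨1, ?_, fun b => ?_⟩
      · classical
        obtain ⟨y, hy, hy1⟩ := hinf 1 one_pos
        have hnot1 : ∀ x, hl.orbit z x → 1 ≤ ρ x z → Precedes R h y x := fun x hx h1 =>
          hnot x y hx hy (hy1.trans_le h1)
        -- All points at least as large as `z` come after `y`, so there is a first class containing
        -- one; any such point in it is a record.
        have hex : ∃ i, ∃ x, R (h^[i] y) x ∧ 1 ≤ ρ x z := by
          obtain ⟨n, hn⟩ := hnot1 z (hl.orbit.refl z) (hρ.self z).ge
          exact ⟨n, z, hn, (hρ.self z).ge⟩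
        obtain ⟨x, hx, hx1⟩ := Nat.find_spec hex
        have hzx : hl.orbit z x := hl.orbit.trans hy ⟨_, 0, hx⟩
        refine ⟨x, hzx, fun w hw hwx => ?_⟩
        obtain ⟨p, hp⟩ := hwx
        have hzw : hl.orbit z w := hl.orbit.trans hzx ⟨0, p + 1, R.symm hp⟩
        by_contra! hge
        have hwz : 1 ≤ ρ w z := by
          rw [hρ.mul w x z (E.symm hw) (E.symm (hOE hzx))]
          nlinarith
        obtain ⟨q, hq⟩ := hnot1 w hzw hwz
        have h1 : Nat.find hex ≤ q := Nat.find_min' hex ⟨w, hq, hwz⟩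
        have h2 : R (h^[p + 1 + q] y) (h^[Nat.find hex] y) := by
          rw [Function.iterate_add_apply]
          exact R.trans ((hl.iterate_rel_iff _ _ _).2 hq) (R.trans hp (R.symm hx))
        have h3 := (hz.congr hy).eq_of_rel hρ hRE hfin h2
        omega
      -- Records of bounded size are trapped between two classes: they are too large to come before
      -- `y`, and too small to come after `x`, which is larger than `b`. Only finitely many finite
      -- classes lie between.
      · obtain ⟨y, hy, hyb⟩ := hinf (max b 1)⁻¹ (by positivity)
        obtain ⟨x, hx, hxb⟩ := hbdd b
        have key : ∀ v, hl.orbit z v → v ∈ recordSet E R ρ h → ρ v z ≤ b → ρ z v ≤ b →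
            Precedes R h y v ∧ Precedes R h v x := by
          intro v hv hvr h1 h2
          constructor
          · refine hnot v y hv hy (hyb.trans_le ?_)
            rw [eq_inv_of_mul_eq_one_left (hρ.mul_swap (E.symm (hOE hv)))]
            exact inv_anti₀ (hρ.pos _ _ (hOE hv)) (h2.trans (le_max_left _ _))
          · by_contra hn
            obtain ⟨_ | n, hn'⟩ := htot v x hv hx hn
            · exact hn ⟨0, R.symm hn'⟩
            · have hvx := E.trans (E.symm (hOE hv)) (hOE hx)
              have h3 := hvr x hvx ⟨n, hn'⟩
              rw [hρ.mul x v z (E.symm hvx) (E.symm (hOE hv))] at hxb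
              have := hρ.pos v z (E.symm (hOE hv))
              nlinarith
        by_cases hyx : Precedes R h y x
        · obtain ⟨N, hN⟩ := hyx
          refine ((finite_Iic N).biUnion fun n _ => (hfin (h^[n] y))).subset ?_
          rintro v ⟨hv, hvr, h1, h2⟩
          obtain ⟨⟨n, hn⟩, m, hm⟩ := key v hv hvr h1 h2
          have h3 : R (h^[m + n] y) (h^[N] y) := by
            rw [Function.iterate_add_apply]
            exact R.trans ((hl.iterate_rel_iff _ _ _).2 hn) (R.trans hm (R.symm hN))
          have h4 := (hz.congr hy).eq_of_rel hρ hRE hfin h3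
          exact mem_biUnion (show n ∈ Iic N by simp only [mem_Iic]; omega) (R.symm hn)
        · convert finite_empty (α := X)
          refine eq_empty_iff_forall_notMem.2 ?_
          rintro v ⟨hv, hvr, h1, h2⟩
          obtain ⟨h3, h4⟩ := key v hv hvr h1 h2
          exact hyx (h3.trans hl h4)
  · push Not at hinf
    obtain ⟨ε, hε, hεS⟩ := hinf
    obtain ⟨a, ha, hstrict⟩ := id hz
    obtain ⟨b, hb⟩ := hpred a ha
    have hab : E a b := E.symm (E.trans (hl.rel b) (hRE hb))
    have hzb : hl.orbit z b := hl.orbit.trans ha ⟨0, 1, R.symm hb⟩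
    have hlt := hstrict b hab hb
    -- `k` is large enough for the strict increase from `b` to `a` to be at least by the factor `(k
    -- + 2) / (k + 1)`. A class within this factor of the infimum has not grown that much.
    obtain ⟨k, hk⟩ := exists_nat_ge
      (classSize R ρ a b / (classSize R ρ a a - classSize R ρ a b))
    rw [div_le_iff₀ (sub_pos.2 hlt)] at hk
    have hga : HasGrown E R ρ h k a := ⟨b, hab, ⟨1, hb⟩, by nlinarith⟩
    let T : Set ℝ := classSize R ρ z '' {x | hl.orbit z x}
    have hTne : T.Nonempty := ⟨_, z, hl.orbit.refl z, rfl⟩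
    have hTb : BddBelow T := ⟨ε, by rintro _ ⟨x, hx, rfl⟩; exact hεS x hx⟩
    have hm : 0 < sInf T := hε.trans_le (le_csInf hTne (by rintro _ ⟨x, hx, rfl⟩; exact hεS x hx))
    obtain ⟨_, ⟨y, hy, rfl⟩, hym⟩ := exists_lt_of_csInf_lt hTne
      (show sInf T < (k + 2) / (k + 1) * sInf T by
        refine lt_mul_of_one_lt_left hm ?_
        rw [one_lt_div (by positivity)]
        linarith)
    have hgy : ¬ HasGrown E R ρ h k y := by
      rintro ⟨w, hw, hwy, h1⟩
      have hzw := hl.orbit.trans hy (hl.orbit_iff.2 (Or.inr hwy))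
      have h2 := csInf_le hTb ⟨w, hzw, rfl⟩
      rw [classSize_mul hρ hRE (hOE hzw) (hOE hy), classSize_mul hρ hRE (hOE hy) (hOE hy),
        ← mul_assoc, ← mul_assoc, mul_le_mul_iff_of_pos_right (hρ.pos _ _ (hOE hy))] at h1
      rw [div_mul_eq_mul_div, lt_div_iff₀ (by positivity)] at hym
      have h3 : (k + 2 : ℝ) * sInf T ≤ (k + 2) * classSize R ρ z w := by gcongr
      linarith
    obtain ⟨v, hv, hav⟩ := hl.exists_mem_firstSet (hl.hasGrown_mono hρ hRE hfin k) hga hgy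
      (hl.orbit.trans (hl.orbit.symm ha) hy)
    exact hfirst (k + 3) _ rfl (hl.hasGrown_mono hρ hRE hfin k) ⟨v, hl.orbit.trans ha hav, hv⟩

end Candidates

/-! ### An aperiodic smooth subrelation from a lift -/

section LiftMeasurable

variable {X : Type*} [MeasurableSpace X] [StandardBorelSpace X] {E R : Setoid X} {ρ : X → X → ℝ}
  {h : X → X}

theorem IsLift.measurable_candidate (hl : IsLift E R ρ h) (hE : IsCountableBorel E) (hRE : R ≤ E)
    (hR : IsBorelRel R) (hm : Measurable fun p : X × X => ρ p.1 p.2) (hh : Measurable h) :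
    IsBorelRel hl.orbit ∧ Measurable hl.IsActive ∧ ∀ i, MeasurableSet (hl.candidate i) := by
  have hRc := hE.mono hRE hR
  have hRm := hRc.measurable_rel
  have hhi : ∀ n, Measurable h^[n] := fun n => hh.iterate n
  have hOm : Measurable fun p : X × X => hl.orbit p.1 p.2 := by
    change Measurable fun p : X × X => ∃ m n, R (h^[m] p.1) (h^[n] p.2)
    fun_prop
  have hO : IsBorelRel hl.orbit := measurableSet_setOfPred.2 hOm
  have hOc := hE.mono (hl.orbit_le hRE) hO
  have hSm : Measurable fun p : X × X => classSize R ρ p.1 p.2 := by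
    have h1 := hRc.measurable_size hm (measurable_snd (α := X) (β := X)) measurable_fst
      (P := fun _ _ => True) measurable_const
    simp only [and_true] at h1
    exact h1.ennreal_toReal
  have hPm : Measurable fun p : X × X => Precedes R h p.1 p.2 := by
    unfold Precedes
    fun_prop
  have hfirst : ∀ Q : X → Prop, Measurable Q → MeasurableSet (firstSet E R h Q) := fun Q hQ => by
    unfold firstSet
    simp only [hE.forall_iff]
    exact measurableSet_setOfPred.2 (by fun_prop)
  refine ⟨hO, ?_, fun i => ?_⟩
  · unfold IsLift.IsActive
    simp only [hOc.exists_iff, hE.forall_iff]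
    fun_prop
  · match i with
    | 0 => exact hfirst _ measurable_const
    | 1 =>
      change MeasurableSet (recordSet E R ρ h)
      unfold recordSet
      simp only [hE.forall_iff]
      exact measurableSet_setOfPred.2 (by fun_prop)
    | 2 =>
      refine hfirst _ ?_
      unfold IsLift.IsLate
      simp only [hOc.forall_iff, hE.exists_iff]
      fun_prop
    | k + 3 =>
      refine hfirst _ ?_
      unfold HasGrown
      simp only [hE.exists_iff]
      fun_prop

/-- A compression of the quotient by a finite relation yields a subrelation on which the cocycle is
aperiodic and which has a locally finite complete Borel set. -/
theorem IsLift.exists_isLocallyFinite (hl : IsLift E R ρ h) (hE : IsCountableBorel E)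
    (hρ : IsBorelCocycle E ρ) (hm : Measurable fun p : X × X => ρ p.1 p.2) (hRE : R ≤ E)
    (hR : IsBorelRel R) (hfin : IsFiniteRel R) (hh : Measurable h) :
    ∃ F ≤ E, IsBorelRel F ∧ IsAperiodic F ρ ∧
      ∃ V, MeasurableSet V ∧ (∀ x, ∃ v ∈ V, F x v) ∧ IsLocallyFinite F ρ V := by
  obtain ⟨hO, hAm, hcm⟩ := hl.measurable_candidate hE hRE hR hm hh
  have hOE := hl.orbit_le hRE
  have hOc := hE.mono hOE hO
  have hρO := hρ.mono hOE
  obtain ⟨f, hf, hfE, hfA, hfid⟩ := hE.exists_retract (measurableSet_setOfPred.2 hAm) fun x => by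
    obtain ⟨a, hxa, ha⟩ := hl.complete x
    refine ⟨a, ⟨a, hl.orbit.refl a, fun y _ hy => ?_⟩, hxa⟩
    exact (ENNReal.toReal_lt_toReal (size_class_ne_top hfin _ _)
      (size_class_ne_top hfin _ _)).2 (ha y hy)
  have hfA : ∀ x, hl.IsActive (f x) := hfA
  have hfid : ∀ x, hl.IsActive x → f x = x := hfid
  -- The least index of a working candidate is constant on each active orbit, which makes the union
  -- of the chosen candidates a single Borel set.
  let C : X → ℕ → Prop := fun x i => (∃ v, hl.orbit x v ∧ v ∈ hl.candidate i) ∧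
    ∀ n : ℕ, {v | hl.orbit x v ∧ v ∈ hl.candidate i ∧ ρ v x ≤ n ∧ ρ x v ≤ n}.Finite
  have hC : ∀ x y i, hl.orbit x y → C x i → C y i := by
    rintro x y i hxy ⟨⟨v, hv, hvi⟩, hfin⟩
    refine ⟨⟨v, hl.orbit.trans (hl.orbit.symm hxy) hv, hvi⟩, fun n => ?_⟩
    obtain ⟨m, hmn⟩ := exists_nat_ge (max (n * ρ y x) (ρ x y * n))
    refine (hfin m).subset ?_
    rintro w ⟨hw, hwi, h1, h2⟩
    refine ⟨hl.orbit.trans hxy hw, hwi, le_trans ?_ ((le_max_left _ _).trans hmn),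
      le_trans ?_ ((le_max_right _ _).trans hmn)⟩
    · rw [hρO.mul w y x (hl.orbit.symm hw) (hl.orbit.symm hxy)]
      exact mul_le_mul_of_nonneg_right h1 (hρO.pos _ _ (hl.orbit.symm hxy)).le
    · rw [hρO.mul x y w hxy hw]
      exact mul_le_mul_of_nonneg_left h2 (hρO.pos _ _ hxy).le
  have hCm : ∀ i, Measurable fun x => hl.IsActive x → C x i := fun i => by
    have hVm : Measurable fun x => x ∈ hl.candidate i := (hcm i).mem
    simp only [C, hOc.exists_iff, hOc.finite_iff]
    have he : ∀ m n : ℕ, Measurable fun x => hOc.enum m x = hOc.enum n x := fun m n =>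
      Measurable.eq (hOc.measurable_enum m) (hOc.measurable_enum n)
    fun_prop
  obtain ⟨i, him, hi⟩ := exists_measurable_least hCm fun x => by
    by_cases hx : hl.IsActive x
    · obtain ⟨i, hi, hi'⟩ := hx.exists_candidate hρ hRE hfin
      exact ⟨i, fun _ => ⟨hi, fun n => hi' n⟩⟩
    · exact ⟨0, fun h => absurd h hx⟩
  have hiO : ∀ x y, hl.IsActive x → hl.orbit x y → i x = i y := fun x y hx hxy =>
    le_antisymm ((hi x).2 _ fun _ => hC _ _ _ (hl.orbit.symm hxy) ((hi y).1 (hx.congr hxy)))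
      ((hi y).2 _ fun _ => hC _ _ _ hxy ((hi x).1 hx))
  -- `f` fixes active points, so each class of the pullback contains exactly one active orbit, from
  -- which it inherits infinite size and the chosen candidate.
  refine ⟨hl.orbit.comap f, fun x y hxy => ?_, hO.comap hf, fun z => ?_,
    {x | hl.IsActive x ∧ x ∈ hl.candidate (i x)}, ?_, fun x => ?_, fun x b => ?_⟩
  · exact E.trans (hfE x) (E.trans (hOE (show hl.orbit (f x) (f y) from hxy)) (E.symm (hfE y)))
  · rw [eq_top_iff, ← (hfA z).size_eq_top hρ hRE hfin (hfE z)]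
    refine size_mono fun y hy => ?_
    change hl.orbit (f y) (f z)
    rw [hfid y ((hfA z).congr hy)]
    exact hl.orbit.symm hy
  · have h1 : Measurable fun p : ℕ × X => p.2 ∈ hl.candidate p.1 :=
      measurable_from_prod_countable_right fun i => (hcm i).mem
    exact measurableSet_setOfPred.2 (hAm.and (h1.comp (him.prodMk measurable_id)))
  · obtain ⟨v, hv, hvi⟩ := ((hi (f x)).1 (hfA x)).1
    have hvA := (hfA x).congr hv
    refine ⟨v, ⟨hvA, by rwa [← hiO _ _ (hfA x) hv]⟩, ?_⟩
    change hl.orbit (f x) (f v)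
    rwa [hfid v hvA]
  · obtain ⟨n, hn⟩ := exists_nat_ge (max (b * ρ x (f x)) (ρ (f x) x * b))
    refine (((hi (f x)).1 (hfA x)).2 n).subset ?_
    rintro v ⟨hv, ⟨hvA, hvi⟩, h1, h2⟩
    have hxv : hl.orbit (f x) v := by
      have hv' : hl.orbit (f x) (f v) := hv
      rwa [hfid v hvA] at hv'
    have hvx : E v x := E.symm (E.trans (hfE x) (hOE hxv))
    refine ⟨hxv, by rwa [hiO _ _ (hfA x) hxv], le_trans ?_ ((le_max_left _ _).trans hn),
      le_trans ?_ ((le_max_right _ _).trans hn)⟩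
    · rw [hρ.mul v x (f x) hvx (hfE x)]
      exact mul_le_mul_of_nonneg_right h1 (hρ.pos _ _ (hfE x)).le
    · rw [hρ.mul (f x) x v (E.symm (hfE x)) (E.symm hvx)]
      exact mul_le_mul_of_nonneg_left h2 (hρ.pos _ _ (E.symm (hfE x))).le

end LiftMeasurable

/-! ### Independence of the values off the relation -/

section Congr

variable {X : Type*} {E F : Setoid X} {ρ ρ' : X → X → ℝ}

theorem IsAperiodic.congr (hF : IsAperiodic F ρ) (h : ∀ x y, F x y → ρ' x y = ρ x y) :
    IsAperiodic F ρ' := fun z => by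
  rw [← hF z]
  exact size_congr fun y hy => h y z hy

theorem IsSmoothCocycle.congr [MeasurableSpace X] (hF : IsSmoothCocycle F ρ)
    (h : ∀ x y, F x y → ρ' x y = ρ x y) : IsSmoothCocycle F ρ' := by
  obtain ⟨U, hU, hU0, hU1, c, hc, hcU⟩ := hF
  refine ⟨U, hU, hU0, hU1, c, hc, fun x y hxy => hcU x y ?_⟩
  obtain ⟨h1, h2, h3⟩ := hxy
  exact ⟨h1, h2, h x y h2 ▸ h3⟩

theorem IsStrictlyIncreasing.congr {φ : X → X} (hF : IsStrictlyIncreasing F ρ φ)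
    (h : ∀ x y, F x y → ρ' x y = ρ x y) : IsStrictlyIncreasing F ρ' φ where
  graph := hF.graph
  lt_one x := by
    refine lt_of_eq_of_lt (size_congr fun y hy => h y x ?_) (hF.lt_one x)
    rw [← mem_singleton_iff.1 (mem_preimage.1 hy)]
    exact hF.graph y

theorem IsLift.congr {f : X → X} (hl : IsLift E F ρ f) (hFE : F ≤ E)
    (h : ∀ x y, E x y → ρ' x y = ρ x y) : IsLift E F ρ' f where
  rel := hl.rel
  rel_iff := hl.rel_iff
  le x := by
    rw [size_congr (ρ := ρ') (ρ' := ρ) (Y := {y | F x y}) fun y hy => h y x (E.symm (hFE hy)),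
      size_congr (ρ := ρ') (ρ' := ρ) (Y := {y | F (f x) y}) fun y hy =>
        h y x (E.symm (E.trans (hl.rel x) (hFE hy)))]
    exact hl.le x
  complete x := by
    obtain ⟨a, hxa, ha⟩ := hl.complete x
    refine ⟨a, hxa, fun y hy => ?_⟩
    have hya := E.trans (hl.rel y) (hFE hy)
    rw [size_congr (ρ := ρ') (ρ' := ρ) (Y := {z | F y z}) fun z hz =>
        h z a (E.trans (E.symm (hFE hz)) hya),
      size_congr (ρ := ρ') (ρ' := ρ) (Y := {z | F a z}) fun z hz => h z a (E.symm (hFE hz))]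
    exact ha y hy

end Congr

end BorelCocycle

theorem mainTheorem4 {X : Type*} [MeasurableSpace X] [StandardBorelSpace X]
    (E : Setoid X) (hE : BorelCocycle.IsCountableBorel E)
    (ρ : X → X → ℝ) (hρ : BorelCocycle.IsBorelCocycle E ρ) :
    List.TFAE [
      -- an injective Borel compression of the quotient by a finite Borel subequivalence relation
      ∃ (F : Setoid X) (hFE : F ≤ E), BorelCocycle.IsBorelRel F ∧ BorelCocycle.IsFiniteRel F ∧
        ∃ φ : Quotient F → Quotient F, Measurable φ ∧ Function.Injective φ ∧
          BorelCocycle.IsCompression (BorelCocycle.quotientRel E F hFE)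
            (BorelCocycle.quotientCocycle F ρ) φ,
      -- a Borel subequivalence relation on which the cocycle is aperiodic and smooth
      ∃ F : Setoid X, F ≤ E ∧ BorelCocycle.IsBorelRel F ∧
        BorelCocycle.IsAperiodic F ρ ∧ BorelCocycle.IsSmoothCocycle F ρ,
      -- an invariant Borel splitting
      ∃ (B : Set X) (F : Setoid X), MeasurableSet B ∧ BorelCocycle.IsInvariant E B ∧
        F ≤ E ∧ BorelCocycle.IsBorelRel F ∧
        BorelCocycle.IsSmoothRel (BorelCocycle.restrictRel F Bᶜ) ∧
        BorelCocycle.IsAperiodic (BorelCocycle.restrictRel F Bᶜ)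
          (BorelCocycle.restrictCocycle ρ Bᶜ) ∧
        ∃ φ : B ≃ᵐ B, BorelCocycle.IsStrictlyIncreasing (BorelCocycle.restrictRel F B)
          (BorelCocycle.restrictCocycle ρ B) φ] := by
  -- `ρ` is Borel only on `E`. The constructions run with an extension Borel on the whole square,
  -- and the conclusions are carried back since they depend only on values at equivalent pairs.
  obtain ⟨ρ', h, hm⟩ := hρ.exists_measurable_extension hE.borel
  have h' : ∀ x y, E x y → ρ x y = ρ' x y := fun x y hxy => (h x y hxy).symm
  have hρ' := hρ.congr h
  tfae_have 1 → 2 := by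
    rintro ⟨R, hRE, hR, hfin, φ, hφm, hφ, hc⟩
    obtain ⟨f, hf, hl⟩ := hc.exists_isLift hE hρ hRE hR hfin hφm hφ
    obtain ⟨F, hFE, hF, hap, V, hV, hVc, hVf⟩ :=
      (hl.congr hRE h).exists_isLocallyFinite hE hρ' hm hRE hR hfin hf
    refine ⟨F, hFE, hF, hap.congr fun x y hxy => h' x y (hFE hxy), ?_⟩
    exact (hVf.isSmoothCocycle (hE.mono hFE hF) (hρ'.mono hFE) hm hV hVc).congr
      fun x y hxy => h' x y (hFE hxy)
  tfae_have 2 → 3 := by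
    rintro ⟨F, hFE, hF, hap, hs⟩
    obtain ⟨V, hV, hVc, hVf⟩ := (hs.congr fun x y hxy => h x y (hFE hxy)).exists_isLocallyFinite
      (hE.mono hFE hF) (hρ'.mono hFE)
    obtain ⟨B, F', hB, hBE, hF'E, hF', hs', hap', φ, hφ⟩ := hVf.exists_splitting hE hρ' hm hFE hF
      (hap.congr fun x y hxy => h x y (hFE hxy)) hV hVc
    exact ⟨B, F', hB, hBE, hF'E, hF', hs', hap'.congr fun x y hxy => h' x y (hF'E hxy), φ,
      hφ.congr fun x y hxy => h' x y (hF'E hxy)⟩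
  tfae_have 3 → 1 := by
    rintro ⟨B, F, hB, hBE, hFE, hF, hs, hap, φ, hφ⟩
    obtain ⟨R, hRE, hR, hfin, f, hf, hl⟩ := BorelCocycle.exists_isLift_of_splitting hE hρ' hm hB hBE hFE hF hs
      (hap.congr fun x y hxy => h x y (hFE hxy)) (hφ.congr fun x y hxy => h x y (hFE hxy))
    exact ⟨R, hRE, hR, hfin, (hl.congr hRE h').exists_compression hρ hRE hfin hf⟩
  tfae_finish
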